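/- For $d\ge 2$, a weight $W:\mathbb{R}^d\times\mathbb{S}^{d-1}\to\mathbb{R}$ and a function $f:\mathbb{R}^d\to\mathbb{R}$, let $$R_Wf(s,\theta)=\int_{x\cdot\theta=s}W(x,\theta)f(x)\,dx,\qquad (s,\theta)\in\mathbb{R}\times\mathbb{S}^{d-1},$$ where $dx$ is Lebesgue measure on the hyperplane. Let $(e_1,\dots,e_d)$ be the canonical basis of $\mathbb{R}^d$ and $\Theta(e_1,e_2)=\{\theta\in\mathbb{S}^{d-1}:\theta\perp e_1,\ \theta\perp e_2\}$. **Theorem.** There are a weight $w_0\in C^\infty(\mathbb{R}^2\times\mathbb{S}^1)$ with $1/2\le w_0\le 1$ and a function $f_0\in C_0^\infty(\mathbb{R}^2)$, $f_0\not\equiv 0$, supported in the closed unit disc, with $$\int_{\mathbb{R}}w_0(x+t\theta,\theta)f_0(x+t\theta)\,dt=0\qquad\text{for all }x\in\mathbb{R}^2,\ \theta\in\mathbb{S}^1\text{ with }x\cdot\theta=0$$ (a counterexample of the type of J. Boman), such that the following holds for every $d\ge 3$. The set $\Theta(e_1,e_2)$ has zero surface measure on $\mathbb{S}^{d-1}$.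 There are functions $\psi\in C_0^\infty(\mathbb{R}^{d-2})$ whose support is the closed unit ball and which are positive on the open unit ball. There are maps $\alpha$ from $\mathbb{S}^{d-1}$ to the unit circle of $\mathrm{span}(e_1,e_2)$ such that $\alpha(\theta)\perp\theta$ and $\det(\alpha(\theta),\theta,e_3,\dots,e_d)>0$ for all $\theta\notin\Theta(e_1,e_2)$; the values on $\Theta(e_1,e_2)$ are arbitrary. For every such $\psi$ and $\alpha$, put $$W(x,\theta)=w_0(x_1,x_2,\alpha_1(\theta),\alpha_2(\theta)),\qquad f(x)=\psi(x_3,\dots,x_d)\,f_0(x_1,x_2).$$ Then: 1. $R_Wf\equiv 0$ on $\mathbb{R}\times\mathbb{S}^{d-1}$, and all the integrals defining $R_Wf$ converge absolutely; 2. $W$ is real valued, $W\ge c>0$ for a constant $c$, and $W\in L^\infty(\mathbb{R}^d\times\mathbb{S}^{d-1})$; 3. $f\in C_0^\infty(\mathbb{R}^d)$ and $f\not\equiv 0$; 4. $1/2\le W\le 1$, and $W$ is $C^\infty$-smooth on $\mathbb{R}^d\times(\mathbb{S}^{d-1}\setminus\Theta(e_1,e_2))$. -/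

import Mathlib

open MeasureTheory Metric
open scoped Manifold ContDiff RealInnerProductSpace

noncomputable section

/-- Euclidean space `ℝ^d`. -/
abbrev Euc (d : ℕ) : Type := EuclideanSpace ℝ (Fin d)

/-- The unit sphere `S^(d-1)` of `ℝ^d`. -/
abbrev Sph (d : ℕ) : Type := sphere (0 : Euc d) 1

/-- The integrand of the weighted Radon transform on the hyperplane `{x | x θ = s}`, which is
parametrized isometrically by `y ↦ s θ + y` with `y` in the hyperplane through the origin
orthogonal to `θ`. -/
def radonIntegrand {d : ℕ} (W : Euc d → Sph d → ℝ) (f : Euc d → ℝ) (s : ℝ) (θ : Sph d)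
    (y : (ℝ ∙ (θ : Euc d))ᗮ) : ℝ :=
  W (s • (θ : Euc d) + (y : Euc d)) θ * f (s • (θ : Euc d) + (y : Euc d))

/-- The weighted Radon transform along hyperplanes,
`R_W f (s, θ) = ∫_{x θ = s} W(x, θ) f(x) dx`, where `dx` is the Lebesgue measure of the
hyperplane. -/
def weightedRadon {d : ℕ} (W : Euc d → Sph d → ℝ) (f : Euc d → ℝ) (s : ℝ) (θ : Sph d) : ℝ :=
  ∫ y, radonIntegrand W f s θ y

/-- The weighted ray transform `P_w f (x, θ) = ∫ w(x + t θ, θ) f(x + t θ) dt`. -/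
def weightedRay {d : ℕ} (w : Euc d → Sph d → ℝ) (f : Euc d → ℝ) (x : Euc d) (θ : Sph d) : ℝ :=
  ∫ t : ℝ, w (x + t • (θ : Euc d)) θ * f (x + t • (θ : Euc d))

/-- A (real valued) weight is admissible if it is bounded from below by a positive constant and
lies in `L^∞(ℝ^d × S^(d-1))`, for the product of the Lebesgue and the surface measure. -/
def IsAdmissibleWeight {d : ℕ} (W : Euc d → Sph d → ℝ) : Prop :=
  (∃ c : ℝ, 0 < c ∧ ∀ x θ, c ≤ W x θ) ∧
    MemLp (Function.uncurry W) ⊤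
      ((volume : Measure (Euc d)).prod (volume : Measure (Euc d)).toSphere)

/-- `Θ(v₁, v₂)`: the unit vectors orthogonal to `v₁` and `v₂`. -/
def orthSphere {d : ℕ} (v₁ v₂ : Euc d) : Set (Sph d) :=
  {θ | ⟪(θ : Euc d), v₁⟫ = 0 ∧ ⟪(θ : Euc d), v₂⟫ = 0}

/-- `stdVec i` is the `i`-th vector of the canonical basis, indexed from `0`. -/
def stdVec {d : ℕ} (i : Fin d) : Euc d := EuclideanSpace.single i 1

/-- A planar counterexample of Boman's type: a smooth weight `w₀` with `1/2 ≤ w₀ ≤ 1` and a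
nonzero smooth function `f₀` supported in the closed unit disc, such that the weighted ray
transform of `f₀` vanishes on all oriented lines of the plane. -/
structure IsBomanPair (w₀ : Euc 2 → Sph 2 → ℝ) (f₀ : Euc 2 → ℝ) : Prop where
  bounds : ∀ x θ, 1 / 2 ≤ w₀ x θ ∧ w₀ x θ ≤ 1
  smooth_weight :
    ContMDiff (𝓘(ℝ, Euc 2).prod (𝓡 1)) 𝓘(ℝ, ℝ) ∞ (Function.uncurry w₀)
  smooth_fun : ContDiff ℝ ∞ f₀
  ne_zero : f₀ ≠ 0
  support_subset : tsupport f₀ ⊆ closedBall 0 1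
  ray_eq_zero : ∀ (x : Euc 2) (θ : Sph 2), ⟪x, (θ : Euc 2)⟫ = 0 → weightedRay w₀ f₀ x θ = 0

/-- A function `ψ ∈ C_0^∞(ℝ^n)` with support the closed unit ball, positive on the open ball. -/
structure IsCutoff {n : ℕ} (ψ : Euc n → ℝ) : Prop where
  smooth : ContDiff ℝ ∞ ψ
  support_eq : tsupport ψ = closedBall 0 1
  pos : ∀ x ∈ ball (0 : Euc n) 1, 0 < ψ x

/-- `(x₁, x₂)` for `x = (x₁, …, x_d)`, with `d = n + 2`. -/
def headPart {n : ℕ} (x : Euc (n + 2)) : Euc 2 := !₂[x 0, x 1]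

/-- `(x₃, …, x_d)` for `x = (x₁, …, x_d)`, with `d = n + 2`. -/
def tailPart {n : ℕ} (x : Euc (n + 2)) : Euc n := WithLp.toLp 2 fun i => x i.succ.succ

/-- `(a₁, a₂, 0, …, 0)` for `a = (a₁, a₂)`; this identifies `ℝ²` with `span (e₁, e₂)`. -/
def planeVec {n : ℕ} (a : Euc 2) : Euc (n + 2) := a 0 • stdVec 0 + a 1 • stdVec 1

/-- The determinant `det (u, v, e₃, …, e_d)` of column vectors, with `d = n + 2`. -/
def frameDet {n : ℕ} (u v : Euc (n + 2)) : ℝ :=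
  Matrix.det (Matrix.of fun i j : Fin (n + 2) =>
    (Fin.cons u (Fin.cons v fun k : Fin n => stdVec k.succ.succ) : Fin (n + 2) → Euc (n + 2)) j i)

/-- `α` assigns to `θ` a unit vector `α(θ)` of `span (e₁, e₂)`, given through its two
coordinates, which for `θ ∉ Θ(e₁, e₂)` is the direction of the line in which `span (e₁, e₂)`
meets the hyperplanes orthogonal to `θ`, oriented by `det (α(θ), θ, e₃, …, e_d) > 0`.
For `θ ∈ Θ(e₁, e₂)` the unit vector is arbitrary. -/
def IsDirectionMap {n : ℕ} (α : Sph (n + 2) → Sph 2) : Prop :=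
  ∀ θ : Sph (n + 2), θ ∉ orthSphere (stdVec 0) (stdVec 1) →
    ⟪planeVec (α θ : Euc 2), (θ : Euc (n + 2))⟫ = 0 ∧
      0 < frameDet (planeVec (α θ : Euc 2)) (θ : Euc (n + 2))

/-- The weight `W(x, θ) = w₀(x₁, x₂, α(θ))`. -/
def liftedWeight {n : ℕ} (w₀ : Euc 2 → Sph 2 → ℝ) (α : Sph (n + 2) → Sph 2) :
    Euc (n + 2) → Sph (n + 2) → ℝ :=
  fun x θ => w₀ (headPart x) (α θ)

/-- The function `f(x) = ψ(x₃, …, x_d) f₀(x₁, x₂)`. -/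
def liftedFun {n : ℕ} (ψ : Euc n → ℝ) (f₀ : Euc 2 → ℝ) : Euc (n + 2) → ℝ :=
  fun x => ψ (tailPart x) * f₀ (headPart x)

end

/-! The planar function is `f = ∑ B^(-j²) g_j`, where the pieces `g_j` (`ringPiece`) have disjoint
supports: for `1 ≤ j`, in the annuli `2^(j+1) (1 - r²) ∈ (1, 2)`, a cut-off times `cos (2 n φ)` with
`n = N 4^j`; for `j = 0`, a radial chirp `cos (K r²)`. The weight is `3/4 (1 - G)`, with `|G| ≤
1/3`. A line `L` at distance `p` from the origin has scale `k` if `2^(k+1) (1 - p²)` lies between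
`5/4` and `3`. With a dyadic partition of unity `χ_k` in `1 - p²`, put `G = ∑ χ_k(L) g_k B^(k²) (∫_L
f) / ∫_L g_k²`. Since `g_k f = B^(-k²) g_k²`, integrating `G f` over `L` gives `∑ χ_k(L) ∫_L f = ∫_L
f`, so `∫_L (1 - G) f = 0` (`integral_correction_eq_zero`). The point is that `G` is smooth and
small. A line of scale `k` meets only the annuli with `k - 1 ≤ j`, so `B^(k²) f` may be replaced
there by the tail `ringTail`, whose coefficients are at most `B^(2k)`. Repeated integration by parts
shows that `∫_L g_j` is smaller than every power of `2^(-j)`, because the frequency `4^j` outruns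
the scale `2^j` of the cut-off (`exists_abs_lineInt_succ_le`). The angle is constant along lines
through the origin, whence the chirp for `j = 0`, with integrals `O(K^(-1/2))`. On the other hand
`∫_L g_k²` is at least `c 2^(-k-1)` at scale `k` (`exists_lineInt_sq_ge`). So the terms of `G` decay
faster than any geometric sequence, while each of their derivatives grows at most geometrically;
interpolation makes all derivatives summable (`GeomBounded.contDiff_tsum`). Large `B`, `N`, `K` give
`|G| ≤ 1/3` (`exists_ring_parameters`). In higher dimensions the hyperplane orthogonal to `θ` is
foliated by lines of direction `α(θ)`, which lies in the plane of `e₁` and `e₂`. Along them `ψ` is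
constant, and what remains is a vanishing planar ray integral (`radon_lifted`). -/

/-! ### Calculus of geometrically bounded families and rapidly decaying series -/

section SmoothFamilies

variable {E G H : Type} [NormedAddCommGroup E] [NormedSpace ℝ E]
  [NormedAddCommGroup G] [NormedSpace ℝ G] [NormedAddCommGroup H] [NormedSpace ℝ H]

/-- A sequence of smooth functions all of whose derivatives grow at most geometrically in the
index, uniformly on `S`. -/
structure GeomBounded (S : Set E) (F : ℕ → E → G) : Prop where
  smooth : ∀ k, ContDiff ℝ ∞ (F k)
  bound : ∀ m : ℕ, ∃ R : ℝ, 1 ≤ R ∧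
    ∀ k, ∀ x ∈ S, ‖iteratedFDeriv ℝ m (F k) x‖ ≤ R ^ (k + 1)

/-- A sequence of functions which tends to zero uniformly, faster than any geometric sequence. -/
def RapidDecay (F : ℕ → E → G) : Prop :=
  ∀ r : ℝ, 0 < r → ∃ C : ℝ, 0 ≤ C ∧ ∀ k x, ‖F k x‖ ≤ C * r ^ k

theorem GeomBounded.uniform {S : Set E} {F : ℕ → E → G} (hF : GeomBounded S F) (n : ℕ) :
    ∃ R : ℝ, 1 ≤ R ∧ ∀ m ≤ n, ∀ k, ∀ x ∈ S, ‖iteratedFDeriv ℝ m (F k) x‖ ≤ R ^ (k + 1) := by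
  choose R hR h using hF.bound
  refine ⟨1 + ∑ m ∈ Finset.range (n + 1), R m, ?_, fun m hm k x hx => (h m k x hx).trans ?_⟩
  · have : 0 ≤ ∑ m ∈ Finset.range (n + 1), R m :=
      Finset.sum_nonneg fun m _ => zero_le_one.trans (hR m)
    linarith
  · have h1 : R m ≤ ∑ m ∈ Finset.range (n + 1), R m :=
      Finset.single_le_sum (f := R) (fun m _ => zero_le_one.trans (hR m))
        (Finset.mem_range.2 (by omega))
    have h2 := hR m
    gcongr
    linarith

theorem le_pow_succ_of_le {a R : ℝ} (hR : 1 ≤ R) (h : a ≤ R) (k : ℕ) : a ≤ R ^ (k + 1) :=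
  h.trans (le_self_pow₀ hR (by omega))

theorem GeomBounded.const_of_bound {S : Set E} {F : E → G} (hF : ContDiff ℝ ∞ F)
    (hb : ∀ m : ℕ, ∃ C, ∀ x ∈ S, ‖iteratedFDeriv ℝ m F x‖ ≤ C) :
    GeomBounded S (fun _ => F) :=
  ⟨fun _ => hF, fun m => by
    obtain ⟨C, hC⟩ := hb m
    exact ⟨max C 1, le_max_right _ _, fun k x hx =>
      le_pow_succ_of_le (le_max_right _ _) ((hC x hx).trans (le_max_left _ _)) k⟩⟩

theorem exists_bound_iteratedFDeriv {S : Set E} (hS : IsCompact S) {F : E → G}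
    (hF : ContDiff ℝ ∞ F) (m : ℕ) : ∃ C, ∀ x ∈ S, ‖iteratedFDeriv ℝ m F x‖ ≤ C :=
  hS.exists_bound_of_continuousOn
    (hF.continuous_iteratedFDeriv (by exact_mod_cast le_top)).continuousOn

theorem GeomBounded.const {S : Set E} (hS : IsCompact S) {F : E → G} (hF : ContDiff ℝ ∞ F) :
    GeomBounded S (fun _ => F) :=
  .const_of_bound hF (exists_bound_iteratedFDeriv hS hF)

theorem GeomBounded.const_of_hasCompactSupport {S : Set E} {F : E → G} (hF : ContDiff ℝ ∞ F)
    (hs : HasCompactSupport F) : GeomBounded S (fun _ => F) :=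
  .const_of_bound hF fun m => by
    obtain ⟨C, hC⟩ := (hs.iteratedFDeriv (𝕜 := ℝ) m).exists_bound_of_continuous
      (hF.continuous_iteratedFDeriv (by exact_mod_cast le_top))
    exact ⟨C, fun x _ => hC x⟩

theorem GeomBounded.of_succ {S : Set E} (hS : IsCompact S) {F : ℕ → E → G}
    (h0 : ContDiff ℝ ∞ (F 0)) (h : GeomBounded S (fun k => F (k + 1))) : GeomBounded S F := by
  refine ⟨fun k => ?_, fun m => ?_⟩
  · cases k with
    | zero => exact h0
    | succ k => exact h.smooth k
  · obtain ⟨C, hC⟩ := exists_bound_iteratedFDeriv hS h0 m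
    obtain ⟨R, hR, hb⟩ := h.bound m
    have h1 : 1 ≤ max C R := hR.trans (le_max_right _ _)
    refine ⟨max C R, h1, fun k x hx => ?_⟩
    cases k with
    | zero => exact le_pow_succ_of_le h1 ((hC x hx).trans (le_max_left _ _)) 0
    | succ k =>
      calc _ ≤ R ^ (k + 1) := hb k x hx
        _ ≤ (max C R) ^ (k + 1) := by gcongr; exact le_max_right _ _
        _ ≤ _ := pow_le_pow_right₀ h1 (by omega)

theorem GeomBounded.mul {S : Set E} {F F' : ℕ → E → ℝ} (hF : GeomBounded S F)
    (hF' : GeomBounded S F') : GeomBounded S (fun k x => F k x * F' k x) := by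
  refine ⟨fun k => (hF.smooth k).mul (hF'.smooth k), fun n => ?_⟩
  obtain ⟨R, hR, hb⟩ := hF.uniform n
  obtain ⟨R', hR', hb'⟩ := hF'.uniform n
  have h2 : (1 : ℝ) ≤ 2 ^ n := one_le_pow₀ (by norm_num)
  refine ⟨2 ^ n * (R * R'), one_le_mul_of_one_le_of_one_le h2
    (one_le_mul_of_one_le_of_one_le hR hR'), fun k x hx => ?_⟩
  refine (norm_iteratedFDeriv_mul_le (hF.smooth k) (hF'.smooth k) x
    (n := n) (by exact_mod_cast le_top)).trans ?_
  calc ∑ i ∈ Finset.range (n + 1), (n.choose i : ℝ) * ‖iteratedFDeriv ℝ i (F k) x‖ *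
        ‖iteratedFDeriv ℝ (n - i) (F' k) x‖
      ≤ ∑ i ∈ Finset.range (n + 1), (n.choose i : ℝ) * (R ^ (k + 1) * R' ^ (k + 1)) := by
        refine Finset.sum_le_sum fun i hi => ?_
        rw [mul_assoc]
        gcongr
        · exact hb i (by simpa [Nat.lt_succ_iff] using hi) k x hx
        · exact hb' (n - i) (by omega) k x hx
    _ = 2 ^ n * (R * R') ^ (k + 1) := by
        rw [← Finset.sum_mul, mul_pow]
        congr 1
        exact_mod_cast Nat.sum_range_choose n
    _ ≤ (2 ^ n * (R * R')) ^ (k + 1) := by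
        rw [mul_pow (2 ^ n : ℝ)]
        gcongr
        exact le_self_pow₀ h2 (by omega)

theorem GeomBounded.geom_mul {S : Set E} {F : ℕ → E → ℝ} (hF : GeomBounded S F)
    {a : ℕ → ℝ} {r : ℝ} (hr : 1 ≤ r) (ha : ∀ k, |a k| ≤ r ^ (k + 1)) :
    GeomBounded S (fun k x => a k * F k x) := by
  refine ⟨fun k => contDiff_const.mul (hF.smooth k), fun n => ?_⟩
  obtain ⟨R, hR, hb⟩ := hF.bound n
  refine ⟨r * R, one_le_mul_of_one_le_of_one_le hr hR, fun k x hx => ?_⟩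
  have : (fun x => a k * F k x) = a k • F k := rfl
  rw [this, iteratedFDeriv_const_smul_apply ((hF.smooth k).contDiffAt.of_le
    (by exact_mod_cast le_top)), norm_smul, mul_pow]
  exact mul_le_mul (ha k) (hb k x hx) (norm_nonneg _) (by positivity)

/-- The Faà di Bruno estimate `n! C D^n` stays geometric in `k` when `C` and `D` are `(k + 1)`-st
powers. -/
theorem GeomBounded.comp {S : Set E} {T : Set G} {g : ℕ → G → H} {f : ℕ → E → G}
    (hg : GeomBounded T g) (hf : GeomBounded S f) (hST : ∀ k, ∀ x ∈ S, f k x ∈ T) :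
    GeomBounded S (fun k x => g k (f k x)) := by
  refine ⟨fun k => (hg.smooth k).comp (hf.smooth k), fun n => ?_⟩
  obtain ⟨R, hR, hb⟩ := hg.uniform n
  obtain ⟨R', hR', hb'⟩ := hf.uniform n
  have h2 : (1 : ℝ) ≤ n.factorial := by exact_mod_cast n.factorial_pos
  have h3 : 1 ≤ R' ^ n := one_le_pow₀ hR'
  refine ⟨n.factorial * (R * R' ^ n), one_le_mul_of_one_le_of_one_le h2
    (one_le_mul_of_one_le_of_one_le hR h3), fun k x hx => ?_⟩
  refine (norm_iteratedFDeriv_comp_le (hg.smooth k) (hf.smooth k) (n := n)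
    (by exact_mod_cast le_top) x (C := R ^ (k + 1)) (D := R' ^ (k + 1))
    (fun i hi => hb i hi k _ (hST k x hx))
    (fun i hi hi' => (hb' i hi' k x hx).trans
      (le_self_pow₀ (one_le_pow₀ hR') (by omega)))).trans ?_
  rw [mul_pow, mul_pow, ← pow_mul, ← pow_mul, mul_comm (k + 1) n, ← mul_assoc]
  gcongr
  exact le_self_pow₀ h2 (by omega)

theorem GeomBounded.clm_comp {S : Set E} {f : ℕ → E → G} (hf : GeomBounded S f)
    (L : G →L[ℝ] H) : GeomBounded S (fun k x => L (f k x)) := by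
  refine ⟨fun k => L.contDiff.comp (hf.smooth k), fun n => ?_⟩
  obtain ⟨R, hR, hb⟩ := hf.bound n
  have h1 : 1 ≤ max ‖L‖ 1 := le_max_right _ _
  refine ⟨max ‖L‖ 1 * R, one_le_mul_of_one_le_of_one_le h1 hR, fun k x hx => ?_⟩
  refine (L.norm_iteratedFDeriv_comp_left (hf.smooth k).contDiffAt
    (by exact_mod_cast le_top)).trans ?_
  rw [mul_pow]
  gcongr
  · exact le_pow_succ_of_le h1 (le_max_left _ _) k
  · exact hb k x hx

theorem GeomBounded.of_eq_zero_outside {S : Set E} {F : ℕ → E → G} (hF : GeomBounded S F)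
    (h0 : ∀ k, ∀ x ∉ S, F k =ᶠ[nhds x] 0) : GeomBounded Set.univ F := by
  refine ⟨hF.smooth, fun n => ?_⟩
  obtain ⟨R, hR, hb⟩ := hF.bound n
  refine ⟨R, hR, fun k x _ => ?_⟩
  by_cases hx : x ∈ S
  · exact hb k x hx
  · rw [((h0 k x hx).iteratedFDeriv ℝ n).eq_of_nhds]
    have : iteratedFDeriv ℝ n (0 : E → G) x = 0 := by
      change iteratedFDeriv ℝ n (fun _ => (0 : G)) x = 0
      rw [iteratedFDeriv_fun_zero]; rfl
    rw [this, norm_zero]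
    positivity

/-- Interpolation of Landau type: compare `f (x + v) - f x` with its linear part for `‖v‖ = h`. The
free step `h` trades the size of `f` against that of its second derivative. -/
theorem norm_fderiv_le_of_bounds {f : E → G} (hf : ContDiff ℝ 2 f) {a b h : ℝ} (hh : 0 < h)
    (ha : ∀ x, ‖f x‖ ≤ a) (hb : ∀ x, ‖fderiv ℝ (fderiv ℝ f) x‖ ≤ b) (x : E) :
    ‖fderiv ℝ f x‖ ≤ 2 * a / h + b * h := by
  have hb0 : 0 ≤ b := (ContinuousLinearMap.opNorm_nonneg _).trans (hb x)
  have ha0 : 0 ≤ a := (norm_nonneg _).trans (ha x)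
  have hd : Differentiable ℝ f := hf.differentiable (by norm_num)
  have hd' : Differentiable ℝ (fderiv ℝ f) :=
    (hf.fderiv_right (m := 1) (by norm_num)).differentiable (by norm_num)
  have hlip : ∀ y, ‖fderiv ℝ f y - fderiv ℝ f x‖ ≤ b * ‖y - x‖ := fun y =>
    Convex.norm_image_sub_le_of_norm_fderiv_le (fun z _ => hd' z) (fun z _ => hb z)
      convex_univ (Set.mem_univ x) (Set.mem_univ y)
  have key : ∀ v : E, ‖v‖ = h → ‖fderiv ℝ f x v‖ ≤ 2 * a + b * h * h := by
    intro v hv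
    have := (convex_closedBall x h).norm_image_sub_le_of_norm_fderiv_le' (𝕜 := ℝ)
      (φ := fderiv ℝ f x) (C := b * h) (f := f)
      (fun z _ => hd z) (fun z hz => (hlip z).trans (by
        gcongr; simpa [dist_eq_norm] using hz))
      (mem_closedBall_self hh.le) (y := x + v) (by simp [hv])
    simp only [add_sub_cancel_left, hv] at this
    have h1 := norm_sub_le (f (x + v) - f x) (f (x + v) - f x - fderiv ℝ f x v)
    rw [sub_sub_cancel] at h1
    have h2 := norm_sub_le (f (x + v)) (f x)
    have h3 := ha x
    have h4 := ha (x + v)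
    linarith
  refine ContinuousLinearMap.opNorm_le_bound _ (by positivity) fun v => ?_
  rcases eq_or_ne v 0 with rfl | hv
  · simp
  have hv' : 0 < ‖v‖ := norm_pos_iff.2 hv
  have := key ((h / ‖v‖) • v) (by
    rw [norm_smul, Real.norm_of_nonneg (by positivity)]; field_simp)
  rw [map_smul, norm_smul, Real.norm_of_nonneg (by positivity)] at this
  have h5 : ‖fderiv ℝ f x v‖ = (h / ‖v‖ * ‖fderiv ℝ f x v‖) * (‖v‖ / h) := by field_simp
  rw [h5]
  calc _ ≤ (2 * a + b * h * h) * (‖v‖ / h) := by gcongr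
    _ = _ := by field_simp

theorem GeomBounded.fderiv {S : Set E} {F : ℕ → E → G} (hF : GeomBounded S F) :
    GeomBounded S (fun k => fderiv ℝ (F k)) :=
  ⟨fun k => (hF.smooth k).fderiv_right (m := ∞) le_rfl, fun m => by
    obtain ⟨R, hR, hb⟩ := hF.bound (m + 1)
    exact ⟨R, hR, fun k x hx => norm_iteratedFDeriv_fderiv.trans_le (hb k x hx)⟩⟩

theorem RapidDecay.fderiv {F : ℕ → E → G} (h0 : RapidDecay F)
    (hF : GeomBounded Set.univ F) : RapidDecay (fun k x => fderiv ℝ (F k) x) := by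
  intro r hr
  obtain ⟨R, hR, hb⟩ := hF.fderiv.fderiv.bound 0
  have hR0 : 0 < R := by linarith
  -- With step `h = (r / R)^k`, both `a / h` and `b h` in the interpolation inequality become
  -- multiples of `r^k`.
  obtain ⟨C, hC, h⟩ := h0 (r * (r / R)) (by positivity)
  refine ⟨2 * C + R, by positivity, fun k x => ?_⟩
  have := norm_fderiv_le_of_bounds (contDiff_infty.1 (hF.smooth k) 2)
    (h := (r / R) ^ k) (by positivity) (fun x => h k x) (b := R ^ (k + 1))
    (fun x => by simpa only [norm_iteratedFDeriv_zero] using hb k x (Set.mem_univ x)) x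
  refine this.trans (le_of_eq ?_)
  rw [mul_pow, div_pow]
  field_simp
  ring

theorem RapidDecay.iteratedFDeriv {F : ℕ → E → G} (h0 : RapidDecay F)
    (hF : GeomBounded Set.univ F) (m : ℕ) :
    RapidDecay (fun k x => iteratedFDeriv ℝ m (F k) x) := by
  induction m generalizing G with
  | zero =>
    intro r hr
    obtain ⟨C, hC, h⟩ := h0 r hr
    exact ⟨C, hC, fun k x => by simpa using h k x⟩
  | succ m ih =>
    intro r hr
    obtain ⟨C, hC, h⟩ := ih (h0.fderiv hF) hF.fderiv r hr
    exact ⟨C, hC, fun k x => norm_iteratedFDeriv_fderiv.symm.trans_le (h k x)⟩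

theorem GeomBounded.contDiff_tsum {F : ℕ → E → G} [CompleteSpace G] (hF : GeomBounded Set.univ F)
    (h0 : RapidDecay F) : ContDiff ℝ ∞ (fun x => ∑' k, F k x) := by
  have h : ∀ m : ℕ, ∃ C : ℝ, 0 ≤ C ∧ ∀ k x, ‖iteratedFDeriv ℝ m (F k) x‖ ≤ C * (1 / 2) ^ k :=
    fun m => h0.iteratedFDeriv hF m (1 / 2) (by norm_num)
  choose C hC hb using h
  exact _root_.contDiff_tsum (N := ⊤) (v := fun m k => C m * (1 / 2) ^ k) hF.smooth
    (fun m _ => (summable_geometric_of_lt_one (by norm_num) (by norm_num)).mul_left _)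
    (fun m k x _ => hb m k x)

theorem hasFDerivAt_intervalIntegral_of_contDiff [FiniteDimensional ℝ E] [CompleteSpace G]
    {F : E × ℝ → G} (hF : ContDiff ℝ 1 F) (a b : ℝ) (x₀ : E) :
    HasFDerivAt (fun x => ∫ t in a..b, F (x, t))
      (∫ t in a..b, (fderiv ℝ F (x₀, t)).comp (ContinuousLinearMap.inl ℝ E ℝ)) x₀ := by
  have : ProperSpace E := FiniteDimensional.proper ℝ E
  have hc : Continuous fun y : E × ℝ => (fderiv ℝ F y).comp (ContinuousLinearMap.inl ℝ E ℝ) :=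
    (hF.continuous_fderiv (by norm_num)).clm_comp continuous_const
  obtain ⟨C, hC⟩ := ((isCompact_closedBall x₀ 1).prod (isCompact_uIcc (a := a) (b := b))
    ).exists_bound_of_continuousOn hc.continuousOn
  refine (intervalIntegral.hasFDerivAt_integral_of_dominated_of_fderiv_le (𝕜 := ℝ)
    (F := fun x t => F (x, t))
    (F' := fun x t => (fderiv ℝ F (x, t)).comp (ContinuousLinearMap.inl ℝ E ℝ))
    (bound := fun _ => C) (s := closedBall x₀ 1) (closedBall_mem_nhds _ one_pos)
    ?_ ?_ ?_ ?_ ?_ ?_)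
  · exact .of_forall fun x =>
      (hF.continuous.comp (by fun_prop : Continuous fun t : ℝ => (x, t))).aestronglyMeasurable
  · exact (hF.continuous.comp
      (by fun_prop : Continuous fun t : ℝ => (x₀, t))).intervalIntegrable _ _
  · exact (hc.comp (by fun_prop : Continuous fun t : ℝ => (x₀, t))).aestronglyMeasurable
  · exact .of_forall fun t ht x hx => hC (x, t) ⟨hx, Set.uIoc_subset_uIcc ht⟩
  · exact intervalIntegrable_const
  · refine .of_forall fun t _ x _ => ?_
    have h1 : HasFDerivAt F (fderiv ℝ F (x, t)) (x, t) :=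
      (hF.differentiable (by norm_num) _).hasFDerivAt
    exact h1.comp x (hasFDerivAt_prodMk_left x t)

theorem contDiff_intervalIntegral [FiniteDimensional ℝ E] [CompleteSpace G]
    {F : E × ℝ → G} (hF : ContDiff ℝ ∞ F) (a b : ℝ) :
    ContDiff ℝ ∞ (fun x => ∫ t in a..b, F (x, t)) := by
  refine contDiff_infty.2 fun n => ?_
  induction n generalizing G with
  | zero =>
    exact contDiff_zero.2 (intervalIntegral.continuous_parametric_intervalIntegral_of_continuous'
      (f := fun x t => F (x, t)) hF.continuous a b)
  | succ n ih =>
    have h := hasFDerivAt_intervalIntegral_of_contDiff (hF.of_le (by exact_mod_cast le_top)) a b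
    refine (contDiff_succ_iff_fderiv (n := n)).2
      ⟨fun x => (h x).differentiableAt, by simp, ?_⟩
    rw [funext fun x => (h x).fderiv]
    exact ih (((hF.fderiv_right (m := ∞) le_rfl)).clm_comp contDiff_const)

/-- Differentiation passes under the integral, and restricting a derivative to the `E` directions is
a contraction, so no constant is lost at any order. -/
theorem norm_iteratedFDeriv_intervalIntegral_le [FiniteDimensional ℝ E] [CompleteSpace G]
    {F : E × ℝ → G} (hF : ContDiff ℝ ∞ F) {a b : ℝ} {C : ℝ} (m : ℕ) (x : E)
    (hC : ∀ t ∈ Set.uIcc a b, ‖iteratedFDeriv ℝ m F (x, t)‖ ≤ C) :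
    ‖iteratedFDeriv ℝ m (fun x => ∫ t in a..b, F (x, t)) x‖ ≤ C * |b - a| := by
  induction m generalizing G with
  | zero =>
    simp only [norm_iteratedFDeriv_zero] at hC ⊢
    exact intervalIntegral.norm_integral_le_of_norm_le_const
      fun t ht => hC t (Set.uIoc_subset_uIcc ht)
  | succ m ih =>
    have h := hasFDerivAt_intervalIntegral_of_contDiff (hF.of_le (by exact_mod_cast le_top)) a b
    rw [← norm_iteratedFDeriv_fderiv, funext fun x => (h x).fderiv]
    have hF' : ContDiff ℝ ∞ (_root_.fderiv ℝ F) := hF.fderiv_right (m := ∞) le_rfl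
    have hF'' : ContDiff ℝ ∞ fun y : E × ℝ =>
        (_root_.fderiv ℝ F y).comp (ContinuousLinearMap.inl ℝ E ℝ) := hF'.clm_comp contDiff_const
    have hle := @ih (E →L[ℝ] G) _ _ _ _ hF'' fun t ht => ?_
    · exact hle
    obtain ⟨L, hL, hLf⟩ : ∃ L : ((E × ℝ) →L[ℝ] G) →L[ℝ] (E →L[ℝ] G), ‖L‖ ≤ 1 ∧
        ∀ f, L f = f.comp (ContinuousLinearMap.inl ℝ E ℝ) := by
      refine ⟨(ContinuousLinearMap.compL ℝ E (E × ℝ) G).flip (ContinuousLinearMap.inl ℝ E ℝ),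
        ContinuousLinearMap.opNorm_le_bound _ zero_le_one fun f => ?_, fun f => rfl⟩
      rw [one_mul]
      refine (ContinuousLinearMap.opNorm_comp_le _ _).trans ?_
      exact mul_le_of_le_one_right (norm_nonneg _) (ContinuousLinearMap.norm_inl_le_one ℝ E ℝ)
    rw [show (fun y : E × ℝ => (_root_.fderiv ℝ F y).comp (ContinuousLinearMap.inl ℝ E ℝ)) =
      L ∘ _root_.fderiv ℝ F from funext fun y => (hLf _).symm]
    calc ‖iteratedFDeriv ℝ m (L ∘ _root_.fderiv ℝ F) (x, t)‖
        ≤ ‖L‖ * ‖iteratedFDeriv ℝ m (_root_.fderiv ℝ F) (x, t)‖ :=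
          L.norm_iteratedFDeriv_comp_left hF'.contDiffAt (by exact_mod_cast le_top)
      _ ≤ 1 * ‖iteratedFDeriv ℝ m (_root_.fderiv ℝ F) (x, t)‖ := by gcongr
      _ = ‖iteratedFDeriv ℝ (m + 1) F (x, t)‖ := by rw [one_mul, norm_iteratedFDeriv_fderiv]
      _ ≤ C := hC t ht

theorem GeomBounded.intervalIntegral [FiniteDimensional ℝ E] [CompleteSpace G] {S : Set E}
    {a b : ℝ} {F : ℕ → E × ℝ → G} (hF : GeomBounded (S ×ˢ Set.uIcc a b) F) :
    GeomBounded S (fun k x => ∫ t in a..b, F k (x, t)) := by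
  refine ⟨fun k => contDiff_intervalIntegral (hF.smooth k) a b, fun m => ?_⟩
  obtain ⟨R, hR, hb⟩ := hF.bound m
  have h1 : 1 ≤ max |b - a| 1 := le_max_right _ _
  refine ⟨R * max |b - a| 1, one_le_mul_of_one_le_of_one_le hR h1, fun k x hx => ?_⟩
  refine (norm_iteratedFDeriv_intervalIntegral_le (hF.smooth k) m x
    fun t ht => hb k (x, t) ⟨hx, ht⟩).trans ?_
  rw [mul_pow]
  gcongr
  exact le_pow_succ_of_le h1 (le_max_left _ _) k

/-- Summation of a geometrically bounded sequence against a superexponentially decaying matrix of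
coefficients. -/
theorem GeomBounded.tsum_mul {F : ℕ → E → ℝ} (hF : GeomBounded Set.univ F) {c : ℕ → ℕ → ℝ}
    (hc : ∀ r : ℝ, 1 ≤ r → ∃ R : ℝ, 1 ≤ R ∧ ∀ k j, |c k j| * r ^ (j + 1) ≤ R ^ (k + 1)) :
    GeomBounded Set.univ (fun k x => ∑' j, c k j * F j x) := by
  have key : ∀ m : ℕ, ∃ R : ℝ, 1 ≤ R ∧ ∀ k j x,
      ‖iteratedFDeriv ℝ m (fun x => c k j * F j x) x‖ ≤ R ^ (k + 1) * (1 / 2) ^ (j + 1) := by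
    intro m
    obtain ⟨r, hr, hb⟩ := hF.bound m
    obtain ⟨R, hR, hR'⟩ := hc (2 * r) (by linarith)
    refine ⟨R, hR, fun k j x => ?_⟩
    have : (fun x => c k j * F j x) = c k j • F j := rfl
    rw [this, iteratedFDeriv_const_smul_apply ((hF.smooth j).contDiffAt.of_le
      (by exact_mod_cast le_top)), norm_smul, Real.norm_eq_abs]
    calc _ ≤ |c k j| * r ^ (j + 1) := by gcongr; exact hb j x (Set.mem_univ x)
      _ = |c k j| * (2 * r) ^ (j + 1) * (1 / 2) ^ (j + 1) := by
        rw [mul_assoc, ← mul_pow]; congr 2; ring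
      _ ≤ _ := by gcongr; exact hR' k j
  choose R hR hb using key
  have hs : ∀ a : ℝ, HasSum (fun j : ℕ => a * (1 / 2 : ℝ) ^ (j + 1)) a := fun a => by
    have := (hasSum_geometric_two.mul_left (a / 2))
    rw [div_mul_cancel₀ a two_ne_zero] at this
    refine this.congr_fun fun j => ?_
    rw [pow_succ]; ring
  have hsm : ∀ k j, ContDiff ℝ ((⊤ : ℕ∞) : WithTop ℕ∞) (fun x => c k j * F j x) :=
    fun k j => contDiff_const.mul (hF.smooth j)
  refine ⟨fun k => _root_.contDiff_tsum (N := ⊤)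
    (v := fun m j => R m ^ (k + 1) * (1 / 2) ^ (j + 1)) (hsm k) (fun m _ => (hs _).summable)
    (fun m j x _ => hb m k j x), fun m => ⟨R m, hR m, fun k x _ => ?_⟩⟩
  rw [iteratedFDeriv_tsum_apply (N := ⊤)
    (v := fun m j => R m ^ (k + 1) * (1 / 2) ^ (j + 1)) (hsm k) (fun m _ => (hs _).summable)
    (fun m j x _ => hb m k j x) le_top]
  exact tsum_of_norm_bounded (hs _) fun j => hb m k j x

theorem norm_iteratedFDeriv_pow_le (m n : ℕ) {w : ℂ} (hw : ‖w‖ ≤ 1) :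
    ‖iteratedFDeriv ℝ m (fun w : ℂ => w ^ n) w‖ ≤ (n : ℝ) ^ m := by
  induction m generalizing n with
  | zero => simpa using pow_le_one₀ (norm_nonneg w) hw
  | succ m ih =>
    have h : fderiv ℝ (fun w : ℂ => w ^ n) =
        (n : ℝ) • ((ContinuousLinearMap.mul ℝ ℂ) ∘ fun w : ℂ => w ^ (n - 1)) := by
      ext1 z
      rw [((hasDerivAt_pow n z).hasFDerivAt.restrictScalars ℝ).fderiv]
      ext1
      all_goals simp
      all_goals ring
    have hs : ContDiff ℝ ∞ fun w : ℂ => w ^ (n - 1) := contDiff_id.pow _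
    rw [← norm_iteratedFDeriv_fderiv, h, iteratedFDeriv_const_smul_apply
      (((ContinuousLinearMap.mul ℝ ℂ).contDiff.comp hs).contDiffAt.of_le
        (by exact_mod_cast le_top)), norm_smul, pow_succ']
    have h1 := (ContinuousLinearMap.mul ℝ ℂ).norm_iteratedFDeriv_comp_left
      (f := fun w : ℂ => w ^ (n - 1)) (x := w) (n := m) hs.contDiffAt (by exact_mod_cast le_top)
    have h2 : ‖ContinuousLinearMap.mul ℝ ℂ‖ ≤ 1 := ContinuousLinearMap.opNorm_mul_le ℝ ℂ
    have h3 := ih (n - 1)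
    have h4 : ((n - 1 : ℕ) : ℝ) ^ m ≤ (n : ℝ) ^ m := by gcongr; omega
    rw [Real.norm_natCast]
    gcongr
    refine h1.trans ((mul_le_mul_of_nonneg_right h2 (norm_nonneg _)).trans ?_)
    linarith

/-- On the unit disc the `m`-th derivative of `w^n` is at most `n^m`, so geometrically growing
exponents such as `N 4^k` are harmless. -/
theorem GeomBounded.pow {n : ℕ → ℕ} {r : ℝ} (hr : 1 ≤ r) (hn : ∀ k, (n k : ℝ) ≤ r ^ (k + 1)) :
    GeomBounded (closedBall (0 : ℂ) 1) (fun k (w : ℂ) => w ^ n k) := by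
  refine ⟨fun k => contDiff_id.pow _, fun m => ⟨r ^ m, one_le_pow₀ hr, fun k x hx => ?_⟩⟩
  refine (norm_iteratedFDeriv_pow_le m (n k) (by simpa using hx)).trans ?_
  rw [← pow_mul, mul_comm, pow_mul]
  gcongr
  exact hn k

end SmoothFamilies

/-! ### Oscillatory integrals along lines: nonstationary phase and chirps -/

section Oscillation

/-- The unimodular function `e^{2iφ}`, where `φ` is the polar angle, along the horizontal line at
height `p`. -/
noncomputable def lineAngle (p t : ℝ) : ℂ := (t + p * Complex.I) / (t - p * Complex.I)

theorem sub_mul_I_ne_zero {p : ℝ} (hp : p ≠ 0) (t : ℝ) : (t : ℂ) - p * Complex.I ≠ 0 := by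
  intro h
  have := congrArg Complex.im h
  simp at this
  exact hp this

theorem norm_lineAngle {p : ℝ} (hp : p ≠ 0) (t : ℝ) : ‖lineAngle p t‖ = 1 := by
  have h : (t : ℂ) + p * Complex.I = (starRingEnd ℂ) (t - p * Complex.I) := by
    apply Complex.ext <;> simp
  rw [lineAngle, norm_div, h, Complex.norm_conj,
    div_self (norm_ne_zero_iff.2 (sub_mul_I_ne_zero hp t))]

theorem add_mul_I_mul_sub (p t : ℝ) :
    ((t : ℂ) + p * Complex.I) * (t - p * Complex.I) = (t ^ 2 + p ^ 2 : ℝ) := by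
  push_cast
  linear_combination (-(p : ℂ) ^ 2) * Complex.I_sq

theorem hasDerivAt_lineAngle_pow {p : ℝ} (hp : p ≠ 0) (n : ℕ) (t : ℝ) :
    HasDerivAt (fun t => lineAngle p t ^ n)
      (-(2 * n * p * Complex.I) * lineAngle p t ^ n / (t ^ 2 + p ^ 2 : ℝ)) t := by
  have hne := sub_mul_I_ne_zero hp t
  have hne' : (t : ℂ) + p * Complex.I ≠ 0 := by
    simpa using sub_mul_I_ne_zero (neg_ne_zero.2 hp) t
  have h0 : HasDerivAt (fun t : ℝ => (t : ℂ)) 1 t := Complex.ofRealCLM.hasDerivAt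
  have h1 : HasDerivAt (lineAngle p) _ t :=
    (h0.add_const (p * Complex.I)).div (h0.sub_const (p * Complex.I)) hne
  rw [← add_mul_I_mul_sub]
  refine (h1.pow n).congr_deriv ?_
  cases n with
  | zero => simp
  | succ n =>
    simp only [lineAngle, Nat.add_sub_cancel, pow_succ]
    field_simp
    ring

/-- A family of functions on `[-1, 1]`, depending on a large parameter `q` and on `p`, whose
`m`-th derivatives are of size `q ^ (l + m)`. -/
structure SymbolBounded (l : ℕ) (a : ℝ → ℝ → ℝ → ℝ) : Prop where
  smooth : ∀ q p, ContDiff ℝ ∞ (a q p)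
  support : ∀ q p, 1 ≤ q → tsupport (a q p) ⊆ Set.Icc (-1) 1
  bound : ∀ m : ℕ, ∃ C : ℝ, 0 ≤ C ∧ ∀ q p t, 1 ≤ q → |p| ≤ 1 → |t| ≤ 1 →
    ‖iteratedFDeriv ℝ m (a q p) t‖ ≤ C * q ^ (l + m)

/-- The transpose of `(t² + p²) d/dt`, up to sign. -/
noncomputable def transportStep (a : ℝ → ℝ → ℝ → ℝ) : ℝ → ℝ → ℝ → ℝ :=
  fun q p => deriv fun t => a q p t * (t ^ 2 + p ^ 2)

theorem exists_bound_iteratedFDeriv_sq (m : ℕ) : ∃ C : ℝ, 0 ≤ C ∧ ∀ p t : ℝ, |p| ≤ 1 → |t| ≤ 1 →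
    ‖iteratedFDeriv ℝ m (fun t : ℝ => t ^ 2 + p ^ 2) t‖ ≤ C := by
  have hs : ContDiff ℝ ∞ fun t : ℝ => t ^ 2 := contDiff_id.pow 2
  obtain ⟨C, hC⟩ := exists_bound_iteratedFDeriv (isCompact_closedBall (0 : ℝ) 1) hs m
  refine ⟨|C| + 1, by positivity, fun p t hp ht => ?_⟩
  rw [show (fun t : ℝ => t ^ 2 + p ^ 2) = (fun t => t ^ 2) + fun _ => p ^ 2 from rfl,
    iteratedFDeriv_add_apply (hs.contDiffAt.of_le (by exact_mod_cast le_top)) contDiffAt_const]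
  refine (norm_add_le _ _).trans (add_le_add ((hC t (by simpa using ht)).trans (le_abs_self _)) ?_)
  cases m with
  | zero => simpa using hp
  | succ m => rw [iteratedFDeriv_const_of_ne (by omega)]; simp

theorem SymbolBounded.transportStep {l : ℕ} {a : ℝ → ℝ → ℝ → ℝ} (ha : SymbolBounded l a) :
    SymbolBounded (l + 1) (transportStep a) := by
  have hs : ∀ p : ℝ, ContDiff ℝ ∞ fun t : ℝ => t ^ 2 + p ^ 2 := fun p =>
    (contDiff_id.pow 2).add contDiff_const
  have hs' : ∀ q p, ContDiff ℝ ∞ fun t : ℝ => a q p t * (t ^ 2 + p ^ 2) := fun q p =>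
    (ha.smooth q p).mul (hs p)
  refine ⟨fun q p => ((contDiff_infty_iff_deriv).1 (hs' q p)).2, fun q p hq => ?_, fun m => ?_⟩
  · refine tsupport_deriv_subset.trans (Set.Subset.trans ?_ (ha.support q p hq))
    exact tsupport_mul_subset_left
  · choose C hC hb using ha.bound
    choose D hD hb' using exists_bound_iteratedFDeriv_sq
    refine ⟨∑ i ∈ Finset.range (m + 1 + 1), ((m + 1).choose i : ℝ) * C i * D (m + 1 - i),
      Finset.sum_nonneg fun i _ => mul_nonneg (mul_nonneg (by positivity) (hC i)) (hD _),
      fun q p t hq hp ht => ?_⟩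
    rw [norm_iteratedFDeriv_eq_norm_iteratedDeriv, _root_.transportStep,
      ← iteratedDeriv_succ', ← norm_iteratedFDeriv_eq_norm_iteratedDeriv]
    refine (norm_iteratedFDeriv_mul_le (ha.smooth q p) (hs p) t (n := m + 1)
      (by exact_mod_cast le_top)).trans ?_
    rw [Finset.sum_mul]
    refine Finset.sum_le_sum fun i hi => ?_
    have hi' : i ≤ m + 1 := by simpa [Nat.lt_succ_iff] using hi
    calc _ ≤ ((m + 1).choose i : ℝ) * (C i * q ^ (l + i)) * D (m + 1 - i) := by
          gcongr
          · exact mul_nonneg (by positivity) (mul_nonneg (hC i) (by positivity))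
          · exact hb i q p t hq hp ht
          · exact hb' _ p t hp ht
      _ = ((m + 1).choose i : ℝ) * C i * D (m + 1 - i) * q ^ (l + i) := by ring
      _ ≤ _ := by
          have h0 : 0 ≤ ((m + 1).choose i : ℝ) * C i * D (m + 1 - i) :=
            mul_nonneg (mul_nonneg (by positivity) (hC i)) (hD _)
          exact mul_le_mul_of_nonneg_left (pow_le_pow_right₀ hq (by omega)) h0

theorem SymbolBounded.iterate {l : ℕ} {a : ℝ → ℝ → ℝ → ℝ} (ha : SymbolBounded l a) (M : ℕ) :
    SymbolBounded (l + M) (_root_.transportStep^[M] a) := by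
  induction M with
  | zero => exact ha
  | succ M ih => rw [Function.iterate_succ_apply']; exact ih.transportStep

/-- The profile `Ψ`, scaled by `q`, in the variable `1 - r²`, along the line at height `p`. -/
def scaledProfile (Ψ : ℝ → ℝ) (q p t : ℝ) : ℝ := Ψ (q * (1 - p ^ 2 - t ^ 2))

theorem scaledProfile_eq_zero {Ψ : ℝ → ℝ} (h0 : ∀ s ≤ 1, Ψ s = 0) {q p t : ℝ} (hq : 0 ≤ q)
    (ht : 1 ≤ p ^ 2 + t ^ 2) : scaledProfile Ψ q p t = 0 :=
  h0 _ ((mul_nonpos_of_nonneg_of_nonpos hq (by linarith)).trans zero_le_one)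

theorem contDiff_scaledProfile {Ψ : ℝ → ℝ} (hΨ : ContDiff ℝ ∞ Ψ) (q p : ℝ) :
    ContDiff ℝ ∞ (scaledProfile Ψ q p) :=
  hΨ.comp (contDiff_const.mul ((contDiff_const.sub (contDiff_id.pow 2))))

theorem tsupport_scaledProfile {Ψ : ℝ → ℝ} (h0 : ∀ s ≤ 1, Ψ s = 0) {q : ℝ} (p : ℝ) (hq : 0 ≤ q) :
    tsupport (scaledProfile Ψ q p) ⊆ Set.Icc (-1) 1 := by
  refine closure_minimal (fun t ht => ?_) isClosed_Icc
  by_contra h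
  refine ht (scaledProfile_eq_zero h0 hq ?_)
  rw [Set.mem_Icc, ← abs_le, not_le] at h
  nlinarith [sq_nonneg p, sq_abs t]

theorem hasCompactSupport_of_zero_outside_Ioo {G : Type} [Zero G] {Ψ : ℝ → G} {a b : ℝ}
    (h0 : ∀ s ≤ a, Ψ s = 0) (h1 : ∀ s, b ≤ s → Ψ s = 0) : HasCompactSupport Ψ :=
  HasCompactSupport.intro (isCompact_Icc (a := a) (b := b)) fun s hs => by
    rw [Set.mem_Icc, not_and_or, not_le, not_le] at hs
    exact hs.elim (fun h => h0 s h.le) (fun h => h1 s h.le)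

theorem symbolBounded_scaledProfile {Ψ : ℝ → ℝ} (hΨ : ContDiff ℝ ∞ Ψ) (h0 : ∀ s ≤ 1, Ψ s = 0)
    (h1 : ∀ s, 2 ≤ s → Ψ s = 0) : SymbolBounded 0 (scaledProfile Ψ) := by
  refine ⟨contDiff_scaledProfile hΨ,
    fun q p hq => tsupport_scaledProfile h0 p (zero_le_one.trans hq), fun m => ?_⟩
  choose A hA using fun i : ℕ =>
    ((hasCompactSupport_of_zero_outside_Ioo h0 h1).iteratedFDeriv
      (𝕜 := ℝ) i).exists_bound_of_continuous
      (hΨ.continuous_iteratedFDeriv (by exact_mod_cast le_top))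
  have hA0 : ∀ i, 0 ≤ A i := fun i => (norm_nonneg _).trans (hA i 0)
  choose D hD hb using exists_bound_iteratedFDeriv_sq
  set B := 1 + ∑ i ∈ Finset.range (m + 1), D i
  have hB : 1 ≤ B := by
    have : 0 ≤ ∑ i ∈ Finset.range (m + 1), D i := Finset.sum_nonneg fun i _ => hD i
    simp only [B]; linarith
  refine ⟨m.factorial * (∑ i ∈ Finset.range (m + 1), A i) * B ^ m,
    mul_nonneg (mul_nonneg (by positivity) (Finset.sum_nonneg fun i _ => hA0 i)) (by positivity),
    fun q p t hq hp ht => ?_⟩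
  have hinner : ContDiff ℝ ∞ fun t : ℝ => q * (1 - p ^ 2 - t ^ 2) :=
    contDiff_const.mul ((contDiff_const.sub (contDiff_id.pow 2)))
  have := norm_iteratedFDeriv_comp_le hΨ hinner (n := m) (by exact_mod_cast le_top) t
    (C := ∑ i ∈ Finset.range (m + 1), A i) (D := B * q)
    (fun i hi => (hA i _).trans (Finset.single_le_sum (f := A) (fun i _ => hA0 i)
      (Finset.mem_range.2 (by omega)))) (fun i hi hi' => ?_)
  · rw [mul_pow, ← mul_assoc] at this
    rw [zero_add]
    exact this
  -- The inner function is a constant minus `q (t² + p²)`; its derivatives of order `1 ≤ i` are at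
  -- most `q B ≤ (B q)^i`, since `B` and `q` are at least `1`.
  · have e : (fun t : ℝ => q * (1 - p ^ 2 - t ^ 2)) =
        (fun _ => q) + (-q) • fun t : ℝ => t ^ 2 + p ^ 2 := by
      ext t; simp; ring
    have hs : ContDiff ℝ ∞ fun t : ℝ => t ^ 2 + p ^ 2 := (contDiff_id.pow 2).add contDiff_const
    have hs' : ContDiffAt ℝ i (-q • fun t : ℝ => t ^ 2 + p ^ 2) t :=
      (hs.contDiffAt.of_le (by exact_mod_cast le_top)).const_smul (-q)
    rw [e, iteratedFDeriv_add_apply contDiffAt_const hs',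
      iteratedFDeriv_const_of_ne (by omega), Pi.zero_apply, zero_add,
      iteratedFDeriv_const_smul_apply (hs.contDiffAt.of_le (by exact_mod_cast le_top)),
      norm_smul, norm_neg, Real.norm_of_nonneg (by linarith), mul_pow]
    have h2 : D i ≤ B := by
      have := Finset.single_le_sum (f := D) (fun i _ => hD i)
        (Finset.mem_range.2 (by omega : i < m + 1))
      simp only [B]; linarith
    calc _ ≤ q * B := by gcongr; exact (hb i p t hp ht).trans h2
      _ ≤ q ^ i * B ^ i := by
        gcongr
        · exact le_self_pow₀ hq (by omega)
        · exact le_self_pow₀ hB (by omega)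
      _ = _ := mul_comm _ _

theorem continuous_lineAngle_pow {p : ℝ} (hp : p ≠ 0) (n : ℕ) :
    Continuous fun t => lineAngle p t ^ n :=
  continuous_iff_continuousAt.2 fun t => (hasDerivAt_lineAngle_pow hp n t).continuousAt

/-- The derivative of `lineAngle p t ^ n` is `-2 n p i / (t² + p²)` times itself; the factor `t² +
p²` put on the amplitude cancels the denominator. -/
theorem integral_lineAngle_by_parts {p : ℝ} (hp : p ≠ 0) (n : ℕ) {a : ℝ → ℝ}
    (ha : ContDiff ℝ ∞ a) (hs : HasCompactSupport a) :
    2 * n * p * Complex.I * ∫ t, (a t : ℂ) * lineAngle p t ^ n =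
      ∫ t, ((deriv (fun t => a t * (t ^ 2 + p ^ 2)) t : ℝ) : ℂ) * lineAngle p t ^ n := by
  set b : ℝ → ℝ := fun t => a t * (t ^ 2 + p ^ 2)
  have hb : ContDiff ℝ ∞ b := ha.mul ((contDiff_id.pow 2).add contDiff_const)
  have hbs : HasCompactSupport b := hs.mul_right
  have hc := continuous_lineAngle_pow hp n
  have hpos : ∀ t : ℝ, 0 < t ^ 2 + p ^ 2 := fun t => by positivity
  have hint : ∀ {c : ℝ → ℝ}, Continuous c → HasCompactSupport c → ∀ {g : ℝ → ℂ}, Continuous g →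
      Integrable fun t => (c t : ℂ) * g t := fun hc hcs g hg =>
    ((Complex.continuous_ofReal.comp hc).mul hg).integrable_of_hasCompactSupport
      ((hcs.comp_left (g := ((↑) : ℝ → ℂ)) Complex.ofReal_zero).mul_right)
  have hg' : Continuous fun t : ℝ =>
      -(2 * n * p * Complex.I) * lineAngle p t ^ n / (t ^ 2 + p ^ 2 : ℝ) :=
    (continuous_const.mul hc).div (by fun_prop) fun t => by exact_mod_cast (hpos t).ne'
  have := integral_mul_deriv_eq_deriv_mul_of_integrable
    (u := fun t => (b t : ℂ)) (v := fun t => lineAngle p t ^ n) (u' := fun t => ((deriv b t : ℝ) : ℂ))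
    (fun t _ => ((hb.differentiable (by simp) t).hasDerivAt).ofReal_comp)
    (fun t _ => hasDerivAt_lineAngle_pow hp n t)
    (hint hb.continuous hbs hg')
    (hint (hb.continuous_deriv (by simp)) hbs.deriv hc)
    (hint hb.continuous hbs hc)
  rw [← neg_inj, ← this, ← integral_const_mul, ← integral_neg]
  congr 1 with t
  have := (hpos t).ne'
  have h2 : ((t ^ 2 + p ^ 2 : ℝ) : ℂ) ≠ 0 := by exact_mod_cast this
  simp only [b, Complex.ofReal_mul]
  field_simp

/-- Each integration by parts gains `1 / (2 n |p|) ≤ 1 / n`, while `transportStep` costs one factor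
`q` in the symbol bounds. -/
theorem norm_integral_lineAngle_le {p : ℝ} (hp : 1 / 2 ≤ |p|) {n : ℕ} (hn : 1 ≤ n) {l : ℕ}
    {a : ℝ → ℝ → ℝ → ℝ} (ha : SymbolBounded l a) {q : ℝ} (hq : 1 ≤ q) (M : ℕ) :
    ‖∫ t, (a q p t : ℂ) * lineAngle p t ^ n‖ ≤
      (1 / n) ^ M * ‖∫ t, (transportStep^[M] a q p t : ℂ) * lineAngle p t ^ n‖ := by
  have hp0 : p ≠ 0 := by rintro rfl; norm_num at hp
  have hn0 : (1 : ℝ) ≤ n := by exact_mod_cast hn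
  induction M with
  | zero => simp
  | succ M ih =>
    refine ih.trans ?_
    have hM := ha.iterate M
    have := integral_lineAngle_by_parts hp0 n (hM.smooth q p)
      (HasCompactSupport.of_support_subset_isCompact isCompact_Icc
        ((subset_tsupport _).trans (hM.support q p hq)))
    rw [Function.iterate_succ_apply', pow_succ, mul_assoc]
    gcongr
    rw [transportStep, ← this]
    simp only [norm_mul, Complex.norm_I, mul_one, Complex.norm_ofNat, Complex.norm_natCast,
      Complex.norm_real, Real.norm_eq_abs]
    rw [← mul_assoc]
    refine le_mul_of_one_le_left (norm_nonneg _) ?_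
    rw [show 1 / (n : ℝ) * (2 * n * |p|) = 2 * |p| by field_simp]
    linarith

/-- Rapid decay of the oscillatory integrals of the scaled profiles along lines which stay away
from the origin. -/
theorem exists_norm_integral_scaledProfile_lineAngle_le {Ψ : ℝ → ℝ} (hΨ : ContDiff ℝ ∞ Ψ)
    (h0 : ∀ s ≤ 1, Ψ s = 0) (h1 : ∀ s, 2 ≤ s → Ψ s = 0) (M : ℕ) :
    ∃ C : ℝ, 0 ≤ C ∧ ∀ (q p : ℝ) (n : ℕ), 1 ≤ q → 1 / 2 ≤ |p| → 1 ≤ n →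
      ‖∫ t, (scaledProfile Ψ q p t : ℂ) * lineAngle p t ^ n‖ ≤ C * (q / n) ^ M := by
  have ha := symbolBounded_scaledProfile hΨ h0 h1
  obtain ⟨C, hC, hb⟩ := (ha.iterate M).bound 0
  refine ⟨C * 2, by positivity, fun q p n hq hp hn => ?_⟩
  have hn0 : (1 : ℝ) ≤ n := by exact_mod_cast hn
  rcases le_or_gt |p| 1 with hp1 | hp1
  · have hp0 : p ≠ 0 := by rintro rfl; norm_num at hp
    refine (norm_integral_lineAngle_le hp hn ha hq M).trans ?_
    have hM := (ha.iterate M).support q p hq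
    have : ‖∫ t, (transportStep^[M] (scaledProfile Ψ) q p t : ℂ) * lineAngle p t ^ n‖ ≤
        C * q ^ M * 2 := by
      rw [← setIntegral_eq_integral_of_forall_compl_eq_zero (s := Set.Icc (-1) 1)]
      · refine (norm_setIntegral_le_of_norm_le_const (C := C * q ^ M) (by simp) ?_).trans
          (le_of_eq ?_)
        · intro t ht
          rw [norm_mul, norm_pow, norm_lineAngle hp0, one_pow, mul_one, Complex.norm_real]
          simpa using hb q p t hq hp1 (abs_le.2 ht)
        · rw [Real.volume_real_Icc_of_le (by norm_num)]; norm_num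
      · intro t ht
        rw [image_eq_zero_of_notMem_tsupport (fun h => ht (hM h)), Complex.ofReal_zero, zero_mul]
    calc _ ≤ (1 / n : ℝ) ^ M * (C * q ^ M * 2) := by gcongr
      _ = _ := by rw [div_pow, div_pow, one_pow]; ring
  · have : ∀ t, scaledProfile Ψ q p t = 0 := fun t =>
      scaledProfile_eq_zero h0 (by linarith) (by nlinarith [sq_abs p, sq_nonneg t])
    simp only [this, Complex.ofReal_zero, zero_mul, integral_zero, norm_zero]
    positivity

theorem hasDerivAt_ofReal_mul_sq (c t : ℝ) :
    HasDerivAt (fun t : ℝ => ((c * t ^ 2 : ℝ) : ℂ) * Complex.I) ((2 * c * t : ℝ) * Complex.I) t := by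
  have h := (hasDerivAt_pow 2 t).const_mul c
  have h' : HasDerivAt (fun t : ℝ => c * t ^ 2) (2 * c * t) t :=
    h.congr_deriv (by push_cast; ring)
  exact h'.ofReal_comp.mul_const _

theorem norm_sq_one_add_mul_I (y : ℝ) : ‖1 + (y : ℂ) * Complex.I‖ ^ 2 = 1 + y ^ 2 := by
  rw [← Complex.normSq_eq_norm_sq, Complex.normSq_apply]
  simp
  ring

theorem one_add_mul_I_ne_zero (y : ℝ) : 1 + (y : ℂ) * Complex.I ≠ 0 := by
  intro h
  have := congrArg Complex.re h
  simp at this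

/-- The phase is stationary at `t = 0`, so one uses `(t e^{iKt²})' = (1 + 2iKt²) e^{iKt²}`, whose
factor `1 + 2iKt²` never vanishes. -/
theorem integral_chirp_by_parts {a : ℝ → ℝ} (ha : ContDiff ℝ ∞ a)
    (hts : tsupport a ⊆ Set.Icc (-1) 1) (K : ℝ) :
    ∫ t, (a t : ℂ) * Complex.exp ((K * t ^ 2 : ℝ) * Complex.I) =
      -∫ t, (((deriv a t : ℝ) * (1 + (2 * K * t ^ 2 : ℝ) * Complex.I) -
        a t * ((2 * (2 * K) * t : ℝ) * Complex.I)) / (1 + (2 * K * t ^ 2 : ℝ) * Complex.I) ^ 2) *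
          (t * Complex.exp ((K * t ^ 2 : ℝ) * Complex.I)) := by
  have hac := ha.continuous
  have hdac := ha.continuous_deriv (n := ∞) (by simp)
  have hz : ∀ t ∉ Set.Icc (-1 : ℝ) 1, a t = 0 := fun t ht =>
    image_eq_zero_of_notMem_tsupport fun h => ht (hts h)
  have hz' : ∀ t ∉ Set.Icc (-1 : ℝ) 1, deriv a t = 0 := fun t ht =>
    image_eq_zero_of_notMem_tsupport fun h => ht (hts (tsupport_deriv_subset h))
  have hdne : ∀ t : ℝ, 1 + ((2 * K * t ^ 2 : ℝ) : ℂ) * Complex.I ≠ 0 :=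
    fun t => one_add_mul_I_ne_zero _
  have hdc : Continuous fun t : ℝ => 1 + ((2 * K * t ^ 2 : ℝ) : ℂ) * Complex.I := by fun_prop
  have hec : Continuous fun t : ℝ => Complex.exp ((K * t ^ 2 : ℝ) * Complex.I) := by fun_prop
  have hv : ∀ t : ℝ, HasDerivAt (fun t : ℝ => (t : ℂ) * Complex.exp ((K * t ^ 2 : ℝ) * Complex.I))
      ((1 + (2 * K * t ^ 2 : ℝ) * Complex.I) * Complex.exp ((K * t ^ 2 : ℝ) * Complex.I)) t :=
    fun t => by
      have h0 : HasDerivAt (fun t : ℝ => (t : ℂ)) 1 t := Complex.ofRealCLM.hasDerivAt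
      refine (h0.mul (hasDerivAt_ofReal_mul_sq K t).cexp).congr_deriv ?_
      push_cast
      ring
  have hu : ∀ t : ℝ, HasDerivAt (fun t : ℝ => (a t : ℂ) / (1 + (2 * K * t ^ 2 : ℝ) * Complex.I))
      (((deriv a t : ℝ) * (1 + (2 * K * t ^ 2 : ℝ) * Complex.I) -
        a t * ((2 * (2 * K) * t : ℝ) * Complex.I)) / (1 + (2 * K * t ^ 2 : ℝ) * Complex.I) ^ 2) t :=
    fun t => ((ha.differentiable (by simp) t).hasDerivAt.ofReal_comp).div
      ((hasDerivAt_ofReal_mul_sq (2 * K) t).const_add _) (hdne t)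
  have hu'c : Continuous fun t : ℝ => (((deriv a t : ℝ) * (1 + (2 * K * t ^ 2 : ℝ) * Complex.I) -
      a t * ((2 * (2 * K) * t : ℝ) * Complex.I)) / (1 + (2 * K * t ^ 2 : ℝ) * Complex.I) ^ 2) :=
    Continuous.div (by fun_prop) (by fun_prop) fun t => pow_ne_zero _ (hdne t)
  have huc : Continuous fun t : ℝ => (a t : ℂ) / (1 + (2 * K * t ^ 2 : ℝ) * Complex.I) :=
    Continuous.div (by fun_prop) hdc hdne
  have hint : ∀ g : ℝ → ℂ, Continuous g → (∀ t ∉ Set.Icc (-1 : ℝ) 1, g t = 0) → Integrable g :=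
    fun g hg hgz => hg.integrable_of_hasCompactSupport (HasCompactSupport.intro isCompact_Icc
      fun t ht => hgz t ht)
  rw [← integral_mul_deriv_eq_deriv_mul_of_integrable (fun t _ => hu t) (fun t _ => hv t)
    (hint _ (huc.mul (hdc.mul hec)) fun t ht => by simp [hz t ht])
    (hint _ (hu'c.mul (Continuous.mul (by fun_prop) hec)) fun t ht => by simp [hz t ht, hz' t ht])
    (hint _ (huc.mul (Continuous.mul (by fun_prop) hec)) fun t ht => by simp [hz t ht])]
  congr 1 with t
  rw [← mul_assoc, div_mul_cancel₀ _ (hdne t)]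

/-- The hypothesis `|b| ≤ A' |t|` pairs the derivative term with `t² / |1 + 2iKt²| ≤ 1 / (2K)`. The
other term has a Lorentzian majorant, whose integral is of order `K^(-1/2)`. -/
theorem norm_chirp_remainder_le {K A A' a b t : ℝ} (hK : 1 ≤ K) (ha : |a| ≤ A)
    (hb : |b| ≤ A' * |t|) (hA' : 0 ≤ A') :
    ‖((b * (1 + (2 * K * t ^ 2 : ℝ) * Complex.I) -
      a * ((2 * (2 * K) * t : ℝ) * Complex.I)) / (1 + (2 * K * t ^ 2 : ℝ) * Complex.I) ^ 2) *
        (t * Complex.exp ((K * t ^ 2 : ℝ) * Complex.I))‖ ≤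
      A' / (2 * K) + 4 * A * (1 + 2 * K * t ^ 2)⁻¹ := by
  set d : ℂ := 1 + (2 * K * t ^ 2 : ℝ) * Complex.I
  set e : ℂ := Complex.exp ((K * t ^ 2 : ℝ) * Complex.I)
  have he : ‖e‖ = 1 := Complex.norm_exp_ofReal_mul_I _
  have hD : ‖d‖ ^ 2 = 1 + (2 * K * t ^ 2) ^ 2 := norm_sq_one_add_mul_I _
  have hdne : d ≠ 0 := one_add_mul_I_ne_zero _
  have hD0 : 0 < ‖d‖ := norm_pos_iff.2 hdne
  have hA0 : 0 ≤ A := (abs_nonneg a).trans ha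
  have e1 : ((b * d - a * ((2 * (2 * K) * t : ℝ) * Complex.I)) / d ^ 2) * (t * e)
      = (b * t : ℝ) / d * e - (a * (4 * K * t ^ 2) : ℝ) * Complex.I / d ^ 2 * e := by
    push_cast
    field_simp
    ring
  rw [e1]
  have h3 : 2 * K * t ^ 2 ≤ ‖d‖ := by
    refine le_of_sq_le_sq ?_ hD0.le
    rw [hD]; linarith
  refine (norm_sub_le _ _).trans (add_le_add ?_ ?_)
  · rw [norm_mul, he, mul_one, norm_div, Complex.norm_real, Real.norm_eq_abs,
      div_le_div_iff₀ hD0 (by linarith), abs_mul]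
    have h4 : |b| * |t| ≤ A' * t ^ 2 := by
      have h5 := mul_le_mul_of_nonneg_right hb (abs_nonneg t)
      rw [mul_assoc, abs_mul_abs_self] at h5
      linarith [h5, sq t]
    calc |b| * |t| * (2 * K) ≤ A' * t ^ 2 * (2 * K) := by gcongr
      _ = A' * (2 * K * t ^ 2) := by ring
      _ ≤ _ := by gcongr
  · rw [norm_mul, he, mul_one, norm_div, norm_mul, Complex.norm_I, mul_one, Complex.norm_real,
      norm_pow, hD, Real.norm_eq_abs, abs_mul, abs_of_nonneg (by positivity : 0 ≤ 4 * K * t ^ 2),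
      ← div_eq_mul_inv, div_le_div_iff₀ (by positivity) (by positivity)]
    set y := 2 * K * t ^ 2
    have hy : 0 ≤ y := by positivity
    have : |a| * (4 * K * t ^ 2) ≤ A * (2 * y) := by
      rw [show 4 * K * t ^ 2 = 2 * y by simp only [y]; ring]
      gcongr
    calc _ ≤ A * (2 * y) * (1 + y) := by gcongr
      _ ≤ 4 * A * (1 + y ^ 2) := by nlinarith [mul_nonneg hA0 (sq_nonneg (y - 1))]

theorem norm_integral_chirp_le {a : ℝ → ℝ} (ha : ContDiff ℝ ∞ a)
    (hts : tsupport a ⊆ Set.Icc (-1) 1) {A A' K : ℝ} (hK : 1 ≤ K) (hA : ∀ t, |a t| ≤ A)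
    (hA' : ∀ t, |deriv a t| ≤ A' * |t|) (hA0 : 0 ≤ A') :
    ‖∫ t, (a t : ℂ) * Complex.exp ((K * t ^ 2 : ℝ) * Complex.I)‖ ≤
      (A' + 4 * A * Real.pi) / √K := by
  have hA0' : 0 ≤ A := (abs_nonneg _).trans (hA 0)
  rw [integral_chirp_by_parts ha hts, norm_neg]
  set k := √(2 * K)
  have hk2 : k ^ 2 = 2 * K := Real.sq_sqrt (by linarith)
  have hk0 : 0 < k := Real.sqrt_pos.2 (by linarith)
  have hKs : 0 < √K := Real.sqrt_pos.2 (by linarith)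
  have hkK : √K ≤ k := Real.sqrt_le_sqrt (by linarith)
  have hKs1 : √K ≤ K := by
    rw [Real.sqrt_le_left (by linarith)]; nlinarith
  have hint2 : Integrable fun t : ℝ => 4 * A * (1 + (k * t) ^ 2)⁻¹ :=
    ((integrable_inv_one_add_sq.comp_mul_left' hk0.ne')).const_mul _
  have hint1 : Integrable (Set.indicator (Set.Icc (-1 : ℝ) 1) fun _ => A' / (2 * K)) :=
    (integrable_indicator_iff measurableSet_Icc).2 (integrableOn_const (by simp))
  refine (norm_integral_le_of_norm_le (hint1.add hint2) (.of_forall fun t => ?_)).trans ?_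
  · by_cases ht : t ∈ Set.Icc (-1 : ℝ) 1
    · refine (norm_chirp_remainder_le hK (hA t) (hA' t) hA0).trans (le_of_eq ?_)
      rw [Pi.add_apply, Set.indicator_of_mem ht, mul_pow, hk2]
    · have hz : a t = 0 := image_eq_zero_of_notMem_tsupport fun h => ht (hts h)
      have hz' : deriv a t = 0 :=
        image_eq_zero_of_notMem_tsupport fun h => ht (hts (tsupport_deriv_subset h))
      rw [Pi.add_apply, Set.indicator_of_notMem ht, hz, hz']
      simp only [Complex.ofReal_zero, zero_mul, sub_zero, zero_div, norm_zero]
      positivity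
  · rw [show (∫ t, ((Set.Icc (-1 : ℝ) 1).indicator (fun _ => A' / (2 * K)) +
        fun t => 4 * A * (1 + (k * t) ^ 2)⁻¹) t) = _ from integral_add hint1 hint2,
      integral_indicator measurableSet_Icc, integral_const_mul,
      Measure.integral_comp_mul_left (fun t : ℝ => (1 + t ^ 2)⁻¹), integral_univ_inv_one_add_sq]
    simp only [MeasureTheory.integral_const, MeasurableSet.univ, measureReal_restrict_apply,
      Set.univ_inter, smul_eq_mul]
    rw [Real.volume_real_Icc_of_le (by norm_num), abs_of_pos (inv_pos.2 hk0), add_div]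
    refine add_le_add ?_ ?_
    · rw [show (1 - (-1 : ℝ)) * (A' / (2 * K)) = A' / K by field_simp; ring]
      gcongr
    · rw [show 4 * A * (k⁻¹ * Real.pi) = 4 * A * Real.pi / k by field_simp]
      gcongr

/-- Uniform decay of the integrals of a radial chirp along lines. -/
theorem exists_norm_integral_scaledProfile_chirp_le {Ψ : ℝ → ℝ} (hΨ : ContDiff ℝ ∞ Ψ)
    (h0 : ∀ s ≤ 1, Ψ s = 0) (h1 : ∀ s, 2 ≤ s → Ψ s = 0) :
    ∃ C : ℝ, 0 ≤ C ∧ ∀ K p : ℝ, 1 ≤ K →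
      ‖∫ t, (scaledProfile Ψ 2 p t : ℂ) * Complex.exp ((K * (p ^ 2 + t ^ 2) : ℝ) * Complex.I)‖
        ≤ C / √K := by
  have hcs := hasCompactSupport_of_zero_outside_Ioo h0 h1
  obtain ⟨A, hA⟩ := hcs.exists_bound_of_continuous hΨ.continuous
  obtain ⟨A', hA'⟩ := hcs.deriv.exists_bound_of_continuous (hΨ.continuous_deriv (by simp))
  have hA0 : 0 ≤ A := (norm_nonneg _).trans (hA 0)
  have hA0' : 0 ≤ A' := (norm_nonneg _).trans (hA' 0)
  refine ⟨4 * A' + 4 * A * Real.pi, by positivity, fun K p hK => ?_⟩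
  -- The profile depends on `t` only through `t²`, so its derivative vanishes linearly at `t = 0`,
  -- as the chirp estimate requires.
  have hda : ∀ t, |deriv (scaledProfile Ψ 2 p) t| ≤ 4 * A' * |t| := by
    intro t
    have h : HasDerivAt (scaledProfile Ψ 2 p)
        (deriv Ψ (2 * (1 - p ^ 2 - t ^ 2)) * (2 * (-(2 * t)))) t := by
      have h2 : HasDerivAt (fun t : ℝ => 2 * (1 - p ^ 2 - t ^ 2)) (2 * (-(2 * t))) t := by
        have := ((hasDerivAt_pow 2 t).const_sub (1 - p ^ 2)).const_mul 2
        simpa using this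
      exact ((hΨ.differentiable (by simp) _).hasDerivAt).comp t h2
    rw [h.deriv, abs_mul, show 2 * (-(2 * t)) = -(4 * t) by ring, abs_neg, abs_mul,
      abs_of_pos (by norm_num : (0 : ℝ) < 4)]
    have := hA' (2 * (1 - p ^ 2 - t ^ 2))
    rw [Real.norm_eq_abs] at this
    calc _ ≤ A' * (4 * |t|) := by gcongr
      _ = _ := by ring
  refine le_trans (le_of_eq ?_) (norm_integral_chirp_le (contDiff_scaledProfile hΨ 2 p)
    (tsupport_scaledProfile h0 p (by norm_num)) hK (fun t => hA _) hda (by positivity))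
  have hsplit : ∀ t : ℝ, (scaledProfile Ψ 2 p t : ℂ) *
      Complex.exp ((K * (p ^ 2 + t ^ 2) : ℝ) * Complex.I) =
      Complex.exp ((K * p ^ 2 : ℝ) * Complex.I) *
        ((scaledProfile Ψ 2 p t : ℂ) * Complex.exp ((K * t ^ 2 : ℝ) * Complex.I)) := fun t => by
    rw [mul_left_comm, ← Complex.exp_add]
    congr 2; push_cast; ring
  simp_rw [hsplit]
  rw [integral_const_mul, norm_mul, Complex.norm_exp_ofReal_mul_I, one_mul]

/-- A smooth bump function, positive exactly on `(1, 2)`. -/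
noncomputable def ringBump (s : ℝ) : ℝ := expNegInvGlue (s - 1) * expNegInvGlue (2 - s)

theorem contDiff_ringBump : ContDiff ℝ ∞ ringBump :=
  (expNegInvGlue.contDiff.comp (contDiff_id.sub contDiff_const)).mul
    (expNegInvGlue.contDiff.comp (contDiff_const.sub contDiff_id))

theorem ringBump_eq_zero_of_le {s : ℝ} (hs : s ≤ 1) : ringBump s = 0 := by
  rw [ringBump, expNegInvGlue.zero_of_nonpos (by linarith), zero_mul]

theorem ringBump_eq_zero_of_ge {s : ℝ} (hs : 2 ≤ s) : ringBump s = 0 := by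
  rw [ringBump, expNegInvGlue.zero_of_nonpos (x := 2 - s) (by linarith), mul_zero]

theorem ringBump_pos {s : ℝ} (h1 : 1 < s) (h2 : s < 2) : 0 < ringBump s :=
  mul_pos (expNegInvGlue.pos_of_pos (by linarith)) (expNegInvGlue.pos_of_pos (by linarith))

theorem ringBump_nonneg (s : ℝ) : 0 ≤ ringBump s :=
  mul_nonneg (expNegInvGlue.nonneg _) (expNegInvGlue.nonneg _)

theorem expNegInvGlue_le_one (x : ℝ) : expNegInvGlue x ≤ 1 := by
  rcases le_or_gt x 0 with h | h
  · rw [expNegInvGlue.zero_of_nonpos h]; exact zero_le_one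
  · rw [expNegInvGlue, if_neg (not_le.2 h), Real.exp_le_one_iff, neg_nonpos]
    positivity

theorem ringBump_le_one (s : ℝ) : ringBump s ≤ 1 :=
  mul_le_one₀ (expNegInvGlue_le_one _) (expNegInvGlue.nonneg _) (expNegInvGlue_le_one _)

/-- The substitution `u = √q t` turns the integral into `D (q (1 - p²)) / √q`, with `D` continuous
and positive on the compact interval `[5/4, 3]`; finally `√q ≤ q`. -/
theorem exists_integral_scaledProfile_sq_ge :
    ∃ c : ℝ, 0 < c ∧ ∀ q p : ℝ, 1 ≤ q → 5 / 4 ≤ q * (1 - p ^ 2) → q * (1 - p ^ 2) ≤ 3 →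
      c / q ≤ ∫ t, scaledProfile (fun s => ringBump s ^ 2) q p t := by
  have hcont : Continuous ringBump := contDiff_ringBump.continuous
  set D : ℝ → ℝ := fun s => ∫ t in (-2 : ℝ)..2, ringBump (s - t ^ 2) ^ 2
  have hD : Continuous D :=
    intervalIntegral.continuous_parametric_intervalIntegral_of_continuous'
      (f := fun s t => ringBump (s - t ^ 2) ^ 2) (by fun_prop) _ _
  have hpos : ∀ s ∈ Set.Icc (5 / 4 : ℝ) 3, 0 < D s := by
    intro s hs
    refine intervalIntegral.integral_pos (by norm_num) (by fun_prop) (fun t _ => by positivity)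
      -- At this point the argument of `ringBump` is `9/8`, inside `(1, 2)`; the root is real
      -- because `5/4 ≤ s`, and below `2` because `s ≤ 3`.
      ⟨√(s - 9 / 8), ⟨by linarith [Real.sqrt_nonneg (s - 9 / 8)], ?_⟩, ?_⟩
    · rw [Real.sqrt_le_left (by norm_num)]; linarith [hs.2]
    · rw [Real.sq_sqrt (by linarith [hs.1])]
      exact pow_pos (ringBump_pos (by linarith) (by linarith)) _
  obtain ⟨s₀, hs₀, hmin⟩ := (isCompact_Icc (a := (5 / 4 : ℝ)) (b := 3)).exists_isMinOn
    ⟨2, by norm_num, by norm_num⟩ hD.continuousOn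
  refine ⟨D s₀, hpos s₀ hs₀, fun q p hq h1 h2 => ?_⟩
  have hq0 : 0 < √q := Real.sqrt_pos.2 (by linarith)
  have e1 : ∀ t, scaledProfile (fun s => ringBump s ^ 2) q p t =
      (fun u => ringBump (q * (1 - p ^ 2) - u ^ 2) ^ 2) (√q * t) := fun t => by
    simp only [scaledProfile, mul_pow, Real.sq_sqrt (by linarith : 0 ≤ q)]
    congr 2; ring
  simp_rw [e1]
  rw [Measure.integral_comp_mul_left (fun u => ringBump (q * (1 - p ^ 2) - u ^ 2) ^ 2),
    abs_of_pos (inv_pos.2 hq0), smul_eq_mul]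
  have e2 : ∫ u, ringBump (q * (1 - p ^ 2) - u ^ 2) ^ 2 = D (q * (1 - p ^ 2)) := by
    simp only [D]
    rw [intervalIntegral.integral_of_le (by norm_num),
      setIntegral_eq_integral_of_forall_compl_eq_zero]
    intro u hu
    rw [ringBump_eq_zero_of_le, zero_pow two_ne_zero]
    have : 4 ≤ u ^ 2 := by
      by_contra! h
      have := abs_lt_of_sq_lt_sq (by linarith : u ^ 2 < 2 ^ 2) (by norm_num)
      rw [abs_lt] at this
      exact hu ⟨this.1, this.2.le⟩
    linarith
  rw [e2, inv_mul_eq_div]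
  have hsq : √q ≤ q := by rw [Real.sqrt_le_left (by linarith)]; nlinarith
  calc D s₀ / q ≤ D s₀ / √q := by
        have := (hpos s₀ hs₀).le
        gcongr
    _ ≤ _ := by gcongr; exact hmin ⟨h1, h2⟩

end Oscillation

/-! ### The oscillating pieces on dyadic annuli and their line integrals -/

section Pieces

/-- A smooth function on the line which equals `1 / x` for `1 ≤ x`. -/
noncomputable def invCut (x : ℝ) : ℝ := Real.smoothTransition (2 * x - 1) / x

theorem mul_invCut (x : ℝ) : x * invCut x = Real.smoothTransition (2 * x - 1) := by
  rcases eq_or_ne x 0 with rfl | hx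
  · rw [zero_mul, Real.smoothTransition.zero_of_nonpos (by norm_num)]
  · rw [invCut, mul_div_cancel₀ _ hx]

theorem invCut_of_one_le {x : ℝ} (hx : 1 ≤ x) : invCut x = x⁻¹ := by
  rw [invCut, Real.smoothTransition.one_of_one_le (by linarith), one_div]

theorem contDiff_invCut : ContDiff ℝ ∞ invCut := by
  have h : ContDiff ℝ ∞ fun x : ℝ => Real.smoothTransition (2 * x - 1) :=
    Real.smoothTransition.contDiff.comp ((contDiff_const.mul contDiff_id).sub contDiff_const)
  refine contDiff_iff_contDiffAt.2 fun x => ?_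
  rcases eq_or_ne x 0 with rfl | hx
  · refine contDiffAt_const (c := (0 : ℝ)).congr_of_eventuallyEq ?_
    filter_upwards [Iio_mem_nhds (by norm_num : (0 : ℝ) < 1 / 2)] with y hy
    rw [invCut, Real.smoothTransition.zero_of_nonpos (by linarith [Set.mem_Iio.1 hy]), zero_div]
  · exact h.contDiffAt.div contDiffAt_id hx

/-- Bounds on the whole line are needed because `invCut` is later composed with arguments that grow
with `k` and stay in no fixed compact set. -/
theorem exists_bound_iteratedFDeriv_invCut (m : ℕ) :
    ∃ C, ∀ x ∈ Set.univ, ‖iteratedFDeriv ℝ m invCut x‖ ≤ C := by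
  obtain ⟨C, hC⟩ := exists_bound_iteratedFDeriv (isCompact_Icc (a := (0 : ℝ)) (b := 2))
    contDiff_invCut m
  have hC0 : 0 ≤ C := (norm_nonneg _).trans (hC 0 ⟨le_rfl, by norm_num⟩)
  refine ⟨C + m.factorial, fun x _ => ?_⟩
  by_cases h : x ∈ Set.Icc (0 : ℝ) 2
  · exact (hC x h).trans (by simp)
  rw [Set.mem_Icc, not_and_or, not_le, not_le] at h
  rw [norm_iteratedFDeriv_eq_norm_iteratedDeriv]
  rcases h with h | h
  · have : invCut =ᶠ[nhds x] fun _ => 0 := by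
      filter_upwards [Iio_mem_nhds h] with y hy
      rw [invCut, Real.smoothTransition.zero_of_nonpos (by linarith [Set.mem_Iio.1 hy]), zero_div]
    rw [this.iteratedDeriv_eq, iteratedDeriv_const]
    split_ifs <;> simp <;> positivity
  · have : invCut =ᶠ[nhds x] fun y => y⁻¹ := by
      filter_upwards [Ioi_mem_nhds (by linarith : (1 : ℝ) < x)] with y hy
      exact invCut_of_one_le (Set.mem_Ioi.1 hy).le
    rw [this.iteratedDeriv_eq, iteratedDeriv_eq_iterate, iter_deriv_inv, norm_mul, norm_mul,
      norm_pow, norm_neg, norm_one, one_pow, one_mul, Real.norm_natCast]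
    have h1 : ‖x ^ (-1 - m : ℤ)‖ ≤ 1 := by
      rw [norm_zpow, Real.norm_of_nonneg (by linarith)]
      exact zpow_le_one_of_nonpos₀ (by linarith) (by omega)
    calc _ ≤ (m.factorial : ℝ) * 1 := by gcongr
      _ ≤ _ := by linarith

/-- A smooth function on the plane which equals `e^{2iφ}`, in polar coordinates, for `1/2 ≤ r²`. -/
noncomputable def angleSq (z : ℂ) : ℂ := ((2 * invCut (2 * ‖z‖ ^ 2) : ℝ) : ℂ) * z ^ 2

theorem contDiff_angleSq : ContDiff ℝ ∞ angleSq := by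
  have h : ContDiff ℝ ∞ fun z : ℂ => 2 * invCut (2 * ‖z‖ ^ 2) :=
    contDiff_const.mul (contDiff_invCut.comp (contDiff_const.mul (contDiff_norm_sq ℝ)))
  exact (Complex.ofRealCLM.contDiff.comp h).mul (contDiff_id.pow 2)

theorem norm_angleSq_le (z : ℂ) : ‖angleSq z‖ ≤ 1 := by
  rw [angleSq, norm_mul, Complex.norm_real, Real.norm_eq_abs, norm_pow]
  calc |2 * invCut (2 * ‖z‖ ^ 2)| * ‖z‖ ^ 2 = |2 * ‖z‖ ^ 2 * invCut (2 * ‖z‖ ^ 2)| := by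
        rw [mul_right_comm, abs_mul _ (‖z‖ ^ 2), abs_of_nonneg (sq_nonneg ‖z‖)]
    _ ≤ 1 := by
        rw [mul_invCut, abs_of_nonneg (Real.smoothTransition.nonneg _)]
        exact Real.smoothTransition.le_one _

/-- The parametrization of the oriented line with direction `e^{iφ}` at signed distance `p` from
the origin. -/
noncomputable def linePt (φ p t : ℝ) : ℂ := Complex.exp (φ * Complex.I) * (t + p * Complex.I)

theorem norm_sq_linePt (φ p t : ℝ) : ‖linePt φ p t‖ ^ 2 = p ^ 2 + t ^ 2 := by
  rw [linePt, norm_mul, Complex.norm_exp_ofReal_mul_I, one_mul, ← Complex.normSq_eq_norm_sq,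
    Complex.normSq_apply]
  simp
  ring

theorem continuous_linePt (φ p : ℝ) : Continuous (linePt φ p) := by
  unfold linePt
  fun_prop

theorem angleSq_linePt {φ p t : ℝ} (hp : p ≠ 0) (h : 1 ≤ 2 * (p ^ 2 + t ^ 2)) :
    angleSq (linePt φ p t) = Complex.exp (φ * Complex.I) ^ 2 * lineAngle p t := by
  have h1 : p ^ 2 + t ^ 2 ≠ 0 := by intro h0; rw [h0] at h; norm_num at h
  rw [angleSq, norm_sq_linePt, invCut_of_one_le h, linePt, lineAngle, mul_pow, mul_left_comm]
  congr 1
  have h2 : ((2 * (2 * (p ^ 2 + t ^ 2))⁻¹ : ℝ) : ℂ) =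
      (((t : ℂ) + p * Complex.I) * (t - p * Complex.I))⁻¹ := by
    rw [add_mul_I_mul_sub, ← Complex.ofReal_inv]
    congr 1
    rw [add_comm (t ^ 2)]
    field_simp
  rw [h2]
  have h3 := sub_mul_I_ne_zero hp t
  have h4 : (t : ℂ) + p * Complex.I ≠ 0 := by
    simpa using sub_mul_I_ne_zero (neg_ne_zero.2 hp) t
  field_simp

/-- The building blocks: a radial chirp near the origin, and rapidly oscillating functions of the
polar angle on the dyadic annuli `2 ^ (k + 1) (1 - r²) ∈ (1, 2)`. -/
noncomputable def ringPiece (N : ℕ) (K : ℝ) : ℕ → ℂ → ℝ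
  | 0, z => ringBump (2 * (1 - ‖z‖ ^ 2)) * Real.cos (K * ‖z‖ ^ 2)
  | k + 1, z => ringBump (2 ^ (k + 2) * (1 - ‖z‖ ^ 2)) * (angleSq z ^ (N * 4 ^ (k + 1))).re

variable {N : ℕ} {K : ℝ}

theorem abs_ringPiece_le_ringBump (k : ℕ) (z : ℂ) :
    |ringPiece N K k z| ≤ ringBump (2 ^ (k + 1) * (1 - ‖z‖ ^ 2)) := by
  cases k with
  | zero =>
    rw [ringPiece, abs_mul, abs_of_nonneg (ringBump_nonneg _), zero_add, pow_one]
    exact mul_le_of_le_one_right (ringBump_nonneg _) (Real.abs_cos_le_one _)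
  | succ k =>
    rw [ringPiece, abs_mul, abs_of_nonneg (ringBump_nonneg _)]
    refine mul_le_of_le_one_right (ringBump_nonneg _) ((Complex.abs_re_le_norm _).trans ?_)
    rw [norm_pow]
    exact pow_le_one₀ (norm_nonneg _) (norm_angleSq_le z)

theorem abs_ringPiece_le_one (k : ℕ) (z : ℂ) : |ringPiece N K k z| ≤ 1 :=
  (abs_ringPiece_le_ringBump k z).trans (ringBump_le_one _)

theorem ringPiece_eq_zero {k : ℕ} {z : ℂ} (h : 2 ^ (k + 1) * (1 - ‖z‖ ^ 2) ≤ 1) :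
    ringPiece N K k z = 0 :=
  abs_nonpos_iff.1 ((abs_ringPiece_le_ringBump k z).trans_eq (ringBump_eq_zero_of_le h))

theorem ringPiece_eq_zero' {k : ℕ} {z : ℂ} (h : 2 ≤ 2 ^ (k + 1) * (1 - ‖z‖ ^ 2)) :
    ringPiece N K k z = 0 :=
  abs_nonpos_iff.1 ((abs_ringPiece_le_ringBump k z).trans_eq (ringBump_eq_zero_of_ge h))

theorem ringPiece_eq_zero_of_one_le_norm (k : ℕ) {z : ℂ} (h : 1 ≤ ‖z‖) :
    ringPiece N K k z = 0 := by
  refine ringPiece_eq_zero ((mul_nonpos_of_nonneg_of_nonpos (by positivity) ?_).trans zero_le_one)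
  nlinarith

/-- If `2^(k+1) (1 - r²)` exceeds `1`, then doubling it at least once takes it past `2`, out of the
support of the bump. -/
theorem ringPiece_disjoint_of_lt {k j : ℕ} {z : ℂ} (hkj : k < j) (h : ringPiece N K k z ≠ 0) :
    ringPiece N K j z = 0 := by
  have h1 : 1 < 2 ^ (k + 1) * (1 - ‖z‖ ^ 2) := by
    by_contra! h1
    exact h (ringPiece_eq_zero h1)
  refine ringPiece_eq_zero' ?_
  have h2 : (2 : ℝ) ^ (k + 1 + 1) ≤ 2 ^ (j + 1) := pow_le_pow_right₀ (by norm_num) (by omega)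
  have h3 : 0 < 1 - ‖z‖ ^ 2 := by
    by_contra! h3
    have := mul_nonpos_of_nonneg_of_nonpos (by positivity : (0 : ℝ) ≤ 2 ^ (k + 1)) h3
    linarith
  rw [pow_succ] at h2
  nlinarith

theorem ringPiece_disjoint {k j : ℕ} {z : ℂ} (hkj : k ≠ j) (h : ringPiece N K k z ≠ 0) :
    ringPiece N K j z = 0 := by
  rcases hkj.lt_or_gt with h1 | h1
  · exact ringPiece_disjoint_of_lt h1 h
  · by_contra h2
    exact h (ringPiece_disjoint_of_lt h1 h2)

/-- The cut-off scale `2^k` and the frequency `N 4^k` are both geometric in `k`. Estimates on the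
disc of radius `2` suffice, as all pieces vanish off the unit disc. -/
theorem geomBounded_ringPiece (N : ℕ) (K : ℝ) : GeomBounded Set.univ (ringPiece N K) := by
  have hS : IsCompact (closedBall (0 : ℂ) 2) := isCompact_closedBall _ _
  have hsq : ContDiff ℝ ∞ fun z : ℂ => 1 - ‖z‖ ^ 2 := contDiff_const.sub (contDiff_norm_sq ℝ)
  have key : GeomBounded (closedBall (0 : ℂ) 2) (ringPiece N K) := by
    refine GeomBounded.of_succ hS ?_ ?_
    · exact (contDiff_ringBump.comp (contDiff_const.mul hsq)).mul
        (Real.contDiff_cos.comp (contDiff_const.mul (contDiff_norm_sq ℝ)))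
    · have hin : GeomBounded (closedBall (0 : ℂ) 2)
          (fun k z => (2 : ℝ) ^ (k + 2) * (1 - ‖z‖ ^ 2)) :=
        (GeomBounded.const hS hsq).geom_mul (r := 4) (by norm_num) fun k => by
          rw [abs_of_nonneg (by positivity), show (4 : ℝ) = 2 ^ 2 by norm_num, ← pow_mul]
          exact pow_le_pow_right₀ (by norm_num) (by omega)
      have hb : GeomBounded Set.univ (fun _ : ℕ => ringBump) :=
        GeomBounded.const_of_hasCompactSupport contDiff_ringBump
          (hasCompactSupport_of_zero_outside_Ioo (fun s => ringBump_eq_zero_of_le)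
            (fun s => ringBump_eq_zero_of_ge))
      have hp : GeomBounded (closedBall (0 : ℂ) 1) (fun k (w : ℂ) => w ^ (N * 4 ^ (k + 1))) := by
        refine GeomBounded.pow (r := (N + 1) * 4) (by
          have : (0 : ℝ) ≤ N := N.cast_nonneg
          linarith) fun k => ?_
        push_cast
        rw [mul_pow]
        gcongr
        have h1 : (1 : ℝ) ≤ N + 1 := by simp
        exact le_pow_succ_of_le h1 (by linarith) k
      exact (hb.comp hin fun k x _ => Set.mem_univ _).mul
        ((hp.comp (GeomBounded.const hS contDiff_angleSq)
          fun k x _ => by simpa using norm_angleSq_le x).clm_comp Complex.reCLM)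
  refine key.of_eq_zero_outside fun k x hx => ?_
  have : (closedBall (0 : ℂ) 1)ᶜ ∈ nhds x := by
    refine isClosed_closedBall.isOpen_compl.mem_nhds fun h => hx ?_
    exact closedBall_subset_closedBall (by norm_num) h
  filter_upwards [this] with y hy
  refine ringPiece_eq_zero_of_one_le_norm k ?_
  simp only [Set.mem_compl_iff, mem_closedBall, dist_zero_right, not_le] at hy
  exact hy.le

theorem contDiff_ringPiece (k : ℕ) : ContDiff ℝ ∞ (ringPiece N K k) :=
  (geomBounded_ringPiece N K).smooth k

theorem ringPiece_zero_linePt (φ p t : ℝ) :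
    ringPiece N K 0 (linePt φ p t) =
      scaledProfile ringBump 2 p t * Real.cos (K * (p ^ 2 + t ^ 2)) := by
  rw [ringPiece, norm_sq_linePt, scaledProfile, sub_sub]

/-- Where a piece of positive index lives, `r² ≥ 1/2`, so `angleSq` really is `e^{2iφ}` there. -/
theorem scaledProfile_eq_zero_or {k : ℕ} (p t : ℝ) :
    scaledProfile ringBump (2 ^ (k + 2)) p t = 0 ∨ 1 ≤ 2 * (p ^ 2 + t ^ 2) := by
  by_contra! h
  refine h.1 (ringBump_eq_zero_of_ge ?_)
  have h4 : (2 : ℝ) ^ 2 ≤ 2 ^ (k + 2) := pow_le_pow_right₀ (by norm_num) (by omega)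
  nlinarith

theorem ringPiece_succ_linePt {p : ℝ} (hp : p ≠ 0) (k : ℕ) (φ t : ℝ) :
    ringPiece N K (k + 1) (linePt φ p t) = scaledProfile ringBump (2 ^ (k + 2)) p t *
      (Complex.exp (φ * Complex.I) ^ (2 * (N * 4 ^ (k + 1))) *
        lineAngle p t ^ (N * 4 ^ (k + 1))).re := by
  rw [ringPiece, norm_sq_linePt, ← sub_sub]
  change scaledProfile ringBump (2 ^ (k + 2)) p t * _ = _
  rcases scaledProfile_eq_zero_or (k := k) p t with h | h
  · rw [h, zero_mul, zero_mul]
  · rw [angleSq_linePt hp h, mul_pow, ← pow_mul]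

/-- The integral of a function over a line. -/
noncomputable def lineInt (h : ℂ → ℝ) (φ p : ℝ) : ℝ := ∫ t, h (linePt φ p t)

theorem norm_exp_pow (φ : ℝ) (n : ℕ) : ‖Complex.exp (φ * Complex.I) ^ n‖ = 1 := by
  rw [norm_pow, Complex.norm_exp_ofReal_mul_I, one_pow]

theorem abs_integral_mul_re_le {a : ℝ → ℝ} {u : ℝ → ℂ} {w : ℂ} (hw : ‖w‖ = 1)
    (hi : Integrable fun t => (a t : ℂ) * u t) :
    |∫ t, a t * (w * u t).re| ≤ ‖∫ t, (a t : ℂ) * u t‖ := by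
  have h : ∀ t, a t * (w * u t).re = RCLike.re (w * ((a t : ℂ) * u t)) := fun t => by
    rw [mul_left_comm]
    simp
  simp_rw [h]
  rw [integral_re (hi.const_mul w), integral_const_mul]
  refine (RCLike.abs_re_le_norm _).trans ?_
  rw [norm_mul, hw, one_mul]

theorem integrable_scaledProfile_mul {Ψ : ℝ → ℝ} (hΨ : ContDiff ℝ ∞ Ψ) (h0 : ∀ s ≤ 1, Ψ s = 0)
    {q : ℝ} (hq : 0 ≤ q) (p : ℝ) {u : ℝ → ℂ} (hu : Continuous u) :
    Integrable fun t => (scaledProfile Ψ q p t : ℂ) * u t := by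
  have hc : HasCompactSupport (scaledProfile Ψ q p) :=
    HasCompactSupport.of_support_subset_isCompact isCompact_Icc
      ((subset_tsupport _).trans (tsupport_scaledProfile h0 p hq))
  exact ((Complex.continuous_ofReal.comp (contDiff_scaledProfile hΨ q p).continuous).mul
    hu).integrable_of_hasCompactSupport
      ((hc.comp_left (g := ((↑) : ℝ → ℂ)) Complex.ofReal_zero).mul_right)

/-- The estimate holds for every `p`, including lines through the origin, where an angular
oscillation would give no cancellation. -/
theorem exists_abs_lineInt_zero_le :
    ∃ C : ℝ, 0 ≤ C ∧ ∀ (N : ℕ) (K φ p : ℝ), 1 ≤ K →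
      |lineInt (ringPiece N K 0) φ p| ≤ C / √K := by
  obtain ⟨C, hC, h⟩ := exists_norm_integral_scaledProfile_chirp_le contDiff_ringBump
    (fun s => ringBump_eq_zero_of_le) (fun s => ringBump_eq_zero_of_ge)
  refine ⟨C, hC, fun N K φ p hK => le_trans ?_ (h K p hK)⟩
  refine le_trans (le_of_eq ?_) (abs_integral_mul_re_le (w := 1) norm_one
    (integrable_scaledProfile_mul contDiff_ringBump (fun s => ringBump_eq_zero_of_le)
      (by norm_num) p (by fun_prop)))
  congr 1
  refine integral_congr_ae (.of_forall fun t => ?_)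
  simp only
  rw [one_mul, ringPiece_zero_linePt, Complex.exp_ofReal_mul_I_re]

/-- Scale `q = 2^(k+2)` against frequency `n = N 4^(k+1)`: each of the `M` integrations by parts
gains `q / n`, small both in `k` and in `1 / N`. -/
theorem exists_abs_lineInt_succ_le (M : ℕ) :
    ∃ C : ℝ, 0 ≤ C ∧ ∀ (N k : ℕ) (K φ p : ℝ), 1 ≤ N → 1 / 2 ≤ |p| →
      |lineInt (ringPiece N K (k + 1)) φ p| ≤ C * (2 * (1 / 2) ^ (k + 1) / N) ^ M := by
  obtain ⟨C, hC, h⟩ := exists_norm_integral_scaledProfile_lineAngle_le contDiff_ringBump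
    (fun s => ringBump_eq_zero_of_le) (fun s => ringBump_eq_zero_of_ge) M
  refine ⟨C, hC, fun N k K φ p hN hp => ?_⟩
  have hp0 : p ≠ 0 := by rintro rfl; norm_num at hp
  have hN0 : (1 : ℝ) ≤ N := by exact_mod_cast hN
  have := h (2 ^ (k + 2)) p (N * 4 ^ (k + 1)) (one_le_pow₀ (by norm_num)) hp
    (Nat.one_le_iff_ne_zero.2 (by positivity))
  have e : (2 : ℝ) ^ (k + 2) / ((N * 4 ^ (k + 1) : ℕ) : ℝ) = 2 * (1 / 2) ^ (k + 1) / N := by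
    push_cast
    rw [show (4 : ℝ) = 2 * 2 by norm_num, mul_pow, one_div, inv_pow, pow_succ 2 (k + 1)]
    field_simp
  rw [e] at this
  refine le_trans ?_ this
  refine le_trans (le_of_eq ?_) (abs_integral_mul_re_le
    (norm_exp_pow φ (2 * (N * 4 ^ (k + 1))))
    (integrable_scaledProfile_mul contDiff_ringBump (fun s => ringBump_eq_zero_of_le)
      (by positivity) p (continuous_lineAngle_pow hp0 _)))
  congr 1
  exact integral_congr_ae (.of_forall fun t => ringPiece_succ_linePt hp0 k φ t)

theorem sq_re_of_norm_eq_one {w : ℂ} (hw : ‖w‖ = 1) : w.re ^ 2 = 1 / 2 + 1 / 2 * (w ^ 2).re := by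
  have h : Complex.normSq w = 1 := by rw [Complex.normSq_eq_norm_sq, hw, one_pow]
  rw [Complex.normSq_apply] at h
  rw [pow_two w, Complex.mul_re]
  linarith

/-- From `cos² = 1/2 + 1/2 cos (2 ·)`: the mean is the main term, and the doubled frequency gives an
oscillatory error. -/
theorem integral_scaledProfile_sq_mul_sq_re_ge {q p : ℝ} (hq : 0 ≤ q) {w : ℂ} {u : ℝ → ℂ}
    (hw : ‖w‖ = 1) (hu : ∀ t, ‖u t‖ = 1) (huc : Continuous u) :
    1 / 2 * (∫ t, scaledProfile (fun s => ringBump s ^ 2) q p t) -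
      1 / 2 * ‖∫ t, (scaledProfile (fun s => ringBump s ^ 2) q p t : ℂ) * u t ^ 2‖ ≤
      ∫ t, (scaledProfile ringBump q p t * (w * u t).re) ^ 2 := by
  have hΨ : ContDiff ℝ ∞ fun s => ringBump s ^ 2 := contDiff_ringBump.pow 2
  have h0 : ∀ s ≤ 1, ringBump s ^ 2 = 0 := fun s hs => by
    rw [ringBump_eq_zero_of_le hs, zero_pow two_ne_zero]
  have hi := integrable_scaledProfile_mul hΨ h0 hq p (huc.pow 2)
  have hi1 : Integrable fun t => scaledProfile (fun s => ringBump s ^ 2) q p t := by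
    simpa using (integrable_scaledProfile_mul hΨ h0 hq p (u := fun _ => 1) continuous_const).re
  have hi2 : Integrable fun t =>
      scaledProfile (fun s => ringBump s ^ 2) q p t * (w ^ 2 * u t ^ 2).re := by
    refine (hi.const_mul (w ^ 2)).re.congr (.of_forall fun t => ?_)
    simp only [Pi.pow_apply]
    rw [mul_left_comm]
    simp
  have e : ∀ t, (scaledProfile ringBump q p t * (w * u t).re) ^ 2 =
      1 / 2 * scaledProfile (fun s => ringBump s ^ 2) q p t +
        1 / 2 * (scaledProfile (fun s => ringBump s ^ 2) q p t * (w ^ 2 * u t ^ 2).re) := fun t => by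
    rw [mul_pow, sq_re_of_norm_eq_one (by rw [norm_mul, hw, hu, one_mul]), mul_pow]
    simp only [scaledProfile]
    ring
  simp_rw [e]
  rw [integral_add (hi1.const_mul _) (hi2.const_mul _), integral_const_mul, integral_const_mul]
  have := abs_integral_mul_re_le (w := w ^ 2) (by rw [norm_pow, hw, one_pow]) hi
  have := neg_le_of_abs_le this
  simp only [Pi.pow_apply] at this
  linarith

/-- Lower bounds for the integrals of the squares of the pieces along the lines of the
corresponding scale. -/
theorem exists_lineInt_sq_ge :
    ∃ c : ℝ, 0 < c ∧ ∃ N₀ : ℕ, ∃ K₀ : ℝ, ∀ (N k : ℕ) (K φ p : ℝ), N₀ ≤ N → K₀ ≤ K →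
      5 / 4 ≤ 2 ^ (k + 1) * (1 - p ^ 2) → 2 ^ (k + 1) * (1 - p ^ 2) ≤ 3 →
      c / 2 ^ (k + 1) ≤ lineInt (fun z => ringPiece N K k z ^ 2) φ p := by
  obtain ⟨c, hc, hlow⟩ := exists_integral_scaledProfile_sq_ge
  have hΨ : ContDiff ℝ ∞ fun s => ringBump s ^ 2 := contDiff_ringBump.pow 2
  have h0 : ∀ s ≤ 1, ringBump s ^ 2 = 0 := fun s hs => by
    rw [ringBump_eq_zero_of_le hs, zero_pow two_ne_zero]
  have h1 : ∀ s, 2 ≤ s → ringBump s ^ 2 = 0 := fun s hs => by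
    rw [ringBump_eq_zero_of_ge hs, zero_pow two_ne_zero]
  obtain ⟨C, hC, hosc⟩ := exists_norm_integral_scaledProfile_lineAngle_le hΨ h0 h1 1
  obtain ⟨C', hC', hchirp⟩ := exists_norm_integral_scaledProfile_chirp_le hΨ h0 h1
  obtain ⟨N₀, hN₀⟩ := exists_nat_ge (4 * C / c)
  -- With `q = 2^(k+1)`, the mean of `cos²` leaves `c / (2q)`, and `N`, `K` are taken so large that
  -- the oscillatory error eats at most half of it.
  refine ⟨c / 4, by positivity, N₀ + 1, max 1 ((4 * C' / c) ^ 2), fun N k K φ p hN hK hs hs' => ?_⟩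
  have hK1 : 1 ≤ K := (le_max_left _ _).trans hK
  have hK2 : (4 * C' / c) ^ 2 ≤ K := (le_max_right _ _).trans hK
  have hq : (1 : ℝ) ≤ 2 ^ (k + 1) := one_le_pow₀ (by norm_num)
  have hl := hlow _ p hq hs hs'
  cases k with
  | zero =>
    have key := integral_scaledProfile_sq_mul_sq_re_ge (q := 2) (p := p) (by norm_num) (w := 1)
      (u := fun t => Complex.exp ((K * (p ^ 2 + t ^ 2) : ℝ) * Complex.I)) norm_one
      (fun t => Complex.norm_exp_ofReal_mul_I _) (by fun_prop)
    have hb := hchirp (2 * K) p (by linarith)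
    have e1 : ∀ t : ℝ, Complex.exp ((K * (p ^ 2 + t ^ 2) : ℝ) * Complex.I) ^ 2 =
        Complex.exp ((2 * K * (p ^ 2 + t ^ 2) : ℝ) * Complex.I) := fun t => by
      rw [← Complex.exp_nat_mul]; congr 1; push_cast; ring
    simp_rw [e1, one_mul, Complex.exp_ofReal_mul_I_re] at key
    simp_rw [lineInt, ringPiece_zero_linePt]
    simp only [zero_add, pow_one] at hl ⊢
    have h3 : C' / √(2 * K) ≤ c / 4 := by
      have h4 : 4 * C' / c ≤ √K := Real.le_sqrt_of_sq_le hK2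
      have h5 : √K ≤ √(2 * K) := Real.sqrt_le_sqrt (by linarith)
      have h6 : 0 < √K := Real.sqrt_pos.2 (by linarith)
      rw [div_le_div_iff₀ (by linarith) (by norm_num)]
      rw [div_le_iff₀ hc] at h4
      nlinarith
    linarith
  | succ k =>
    have h4 : (2 : ℝ) ^ 2 ≤ 2 ^ (k + 1 + 1) := pow_le_pow_right₀ (by norm_num) (by omega)
    have hp2 : (1 / 2) ^ 2 ≤ p ^ 2 := by nlinarith
    have hp : 1 / 2 ≤ |p| := by
      have := sq_le_sq.1 hp2
      rwa [abs_of_pos (by norm_num : (0 : ℝ) < 1 / 2)] at this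
    have hp0 : p ≠ 0 := by rintro rfl; norm_num at hp
    have key := integral_scaledProfile_sq_mul_sq_re_ge (q := 2 ^ (k + 1 + 1)) (p := p)
      (by positivity) (norm_exp_pow φ (2 * (N * 4 ^ (k + 1))))
      (fun t => by rw [norm_pow, norm_lineAngle hp0, one_pow])
      (continuous_lineAngle_pow hp0 (N * 4 ^ (k + 1)))
    have hNpos : 0 < N := by omega
    have hb := hosc (2 ^ (k + 1 + 1)) p (N * 4 ^ (k + 1) * 2) hq hp
      (Nat.one_le_iff_ne_zero.2 (by positivity))
    simp_rw [← pow_mul] at key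
    simp_rw [lineInt, ringPiece_succ_linePt hp0]
    have h5 : C * ((2 : ℝ) ^ (k + 1 + 1) / ((N * 4 ^ (k + 1) * 2 : ℕ) : ℝ)) ^ 1 ≤
        c / 2 ^ (k + 1 + 1) / 2 := by
      have hN' : 4 * C / c ≤ N := hN₀.trans (by exact_mod_cast (by omega : N₀ ≤ N))
      rw [div_le_iff₀ hc] at hN'
      have hNr : (0 : ℝ) < N := by exact_mod_cast hNpos
      push_cast
      rw [pow_one, ← mul_div_assoc, div_div, div_le_div_iff₀ (by positivity) (by positivity),
        show (4 : ℝ) = 2 * 2 by norm_num, mul_pow, pow_succ 2 (k + 1)]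
      set y : ℝ := 2 ^ (k + 1)
      have hy : 0 < y := by positivity
      have : 4 * C * (2 * (y * y)) ≤ N * c * (2 * (y * y)) := by gcongr
      linarith
    have h6 : c / 4 / 2 ^ (k + 1 + 1) = c / 2 ^ (k + 1 + 1) / 4 := by ring
    rw [h6]
    linarith

theorem integrable_ringPiece_linePt (k : ℕ) (φ p : ℝ) :
    Integrable fun t => ringPiece N K k (linePt φ p t) := by
  refine ((contDiff_ringPiece k).continuous.comp
    (continuous_linePt φ p)).integrable_of_hasCompactSupport
    (HasCompactSupport.intro (isCompact_Icc (a := -1) (b := 1)) fun t ht => ?_)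
  refine ringPiece_eq_zero_of_one_le_norm k ?_
  rw [Set.mem_Icc, ← abs_le, not_le] at ht
  have := norm_sq_linePt φ p t
  by_contra! h
  nlinarith [norm_nonneg (linePt φ p t), sq_abs t, sq_nonneg p]

theorem integral_norm_ringPiece_le (k : ℕ) (φ p : ℝ) :
    ∫ t, ‖ringPiece N K k (linePt φ p t)‖ ≤ 2 := by
  have hz : ∀ t ∉ Set.Icc (-1 : ℝ) 1, ‖ringPiece N K k (linePt φ p t)‖ = 0 := fun t ht => by
    rw [norm_eq_zero]
    refine ringPiece_eq_zero_of_one_le_norm k ?_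
    rw [Set.mem_Icc, ← abs_le, not_le] at ht
    have := norm_sq_linePt φ p t
    by_contra! h
    nlinarith [norm_nonneg (linePt φ p t), sq_abs t, sq_nonneg p]
  rw [← setIntegral_eq_integral_of_forall_compl_eq_zero hz]
  refine (Real.le_norm_self _).trans ((norm_setIntegral_le_of_norm_le_const (C := 1) measure_Icc_lt_top
    fun t _ => ?_).trans (le_of_eq ?_))
  · rw [norm_norm]; exact abs_ringPiece_le_one k _
  · rw [Real.volume_real_Icc_of_le (by norm_num)]; norm_num

end Pieces

/-! ### Rescaled tails of the series and the choice of parameters -/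

section Tails

/-- The coefficients `B ^ (k² - j²)` for `k - 1 ≤ j`. -/
noncomputable def tailCoeff (B : ℝ) (k j : ℕ) : ℝ :=
  if k ≤ j + 1 then B ^ k ^ 2 / B ^ j ^ 2 else 0

variable {B : ℝ} {N : ℕ} {K : ℝ}

theorem tailCoeff_nonneg (hB : 1 ≤ B) (k j : ℕ) : 0 ≤ tailCoeff B k j := by
  unfold tailCoeff
  split_ifs <;> positivity

theorem tailCoeff_le (hB : 1 ≤ B) (k j : ℕ) : tailCoeff B k j ≤ B ^ (2 * k) := by
  unfold tailCoeff
  split_ifs with h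
  · rw [div_le_iff₀ (by positivity), ← pow_add]
    refine pow_le_pow_right₀ hB ?_
    cases k with
    | zero => simp
    | succ k =>
      have := Nat.pow_le_pow_left (Nat.le_of_succ_le_succ h) 2
      rw [add_sq]
      omega
  · positivity

theorem tailCoeff_le_geometric (hB : 1 ≤ B) (k j : ℕ) :
    tailCoeff B k j ≤ B ^ k ^ 2 * (1 / B) ^ j := by
  unfold tailCoeff
  split_ifs with h
  · rw [div_eq_mul_inv, one_div, inv_pow]
    gcongr
    exact Nat.le_self_pow two_ne_zero j
  · positivity

theorem summable_tailCoeff (hB : 1 < B) (k : ℕ) : Summable (tailCoeff B k) :=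
  Summable.of_nonneg_of_le (tailCoeff_nonneg hB.le k) (tailCoeff_le_geometric hB.le k)
    ((summable_geometric_of_lt_one (by positivity)
      ((div_lt_one (by linarith)).2 hB)).mul_left _)

/-- Write `j + 1 = k + i`. Then `k² - j² ≤ 2k + 2i - i²`, and the Gaussian factor `B^(-i²)` absorbs
`(B² r)^i` up to the constant `B^(m²)`. -/
theorem exists_tailCoeff_mul_pow_le (hB : 1 < B) {r : ℝ} (hr : 1 ≤ r) :
    ∃ R : ℝ, 1 ≤ R ∧ ∀ k j, |tailCoeff B k j| * r ^ (j + 1) ≤ R ^ (k + 1) := by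
  obtain ⟨m, hm⟩ := pow_unbounded_of_one_lt (B ^ 2 * r) hB
  have h1 : 1 ≤ B ^ m ^ 2 := one_le_pow₀ hB.le
  have h2 : 1 ≤ B ^ 2 * r := one_le_mul_of_one_le_of_one_le (one_le_pow₀ hB.le) hr
  refine ⟨B ^ 2 * r * B ^ m ^ 2, one_le_mul_of_one_le_of_one_le h2 h1, fun k j => ?_⟩
  rw [abs_of_nonneg (tailCoeff_nonneg hB.le k j)]
  unfold tailCoeff
  split_ifs with h
  · obtain ⟨i, hi⟩ := Nat.exists_eq_add_of_le h
    rw [div_mul_eq_mul_div, div_le_iff₀ (by positivity)]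
    have e1 : k ^ 2 + i ^ 2 ≤ j ^ 2 + 2 * k + 2 * i := by
      zify at hi ⊢
      have : (j : ℤ) = k + i - 1 := by omega
      rw [this]; nlinarith
    have e2 : m * i ≤ m ^ 2 + i ^ 2 := by
      nlinarith [two_mul_le_add_sq m i, Nat.zero_le (m * i)]
    have h3 : B ^ k ^ 2 * r ^ (j + 1) * B ^ i ^ 2 ≤
        ((B ^ 2 * r * B ^ m ^ 2) ^ (k + 1) * B ^ j ^ 2) * B ^ i ^ 2 := by
      calc B ^ k ^ 2 * r ^ (j + 1) * B ^ i ^ 2 = B ^ (k ^ 2 + i ^ 2) * r ^ (k + i) := by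
            rw [hi]; ring
        _ ≤ B ^ (j ^ 2 + 2 * k + 2 * i) * r ^ (k + i) := by
            gcongr
            exact hB.le
        _ = (B ^ 2 * r) ^ k * B ^ j ^ 2 * (B ^ 2 * r) ^ i := by ring
        _ ≤ (B ^ 2 * r) ^ k * B ^ j ^ 2 * (B ^ m) ^ i := by gcongr
        _ = (B ^ 2 * r) ^ k * B ^ j ^ 2 * B ^ (m * i) := by rw [← pow_mul]
        _ ≤ (B ^ 2 * r) ^ k * B ^ j ^ 2 * B ^ (m ^ 2 + i ^ 2) := by
            gcongr
            exact hB.le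
        _ = ((B ^ 2 * r) ^ k * B ^ m ^ 2) * B ^ j ^ 2 * B ^ i ^ 2 := by ring
        _ ≤ _ := by
            gcongr
            rw [mul_pow (B ^ 2 * r)]
            gcongr
            · omega
            · exact le_self_pow₀ h1 (by omega)
    exact le_of_mul_le_mul_right h3 (by positivity)
  · rw [zero_mul]; positivity

/-- The rescaled tails of the series `∑ B ^ (-j²) ringPiece j`. -/
noncomputable def ringTail (B : ℝ) (N : ℕ) (K : ℝ) (k : ℕ) (z : ℂ) : ℝ :=
  ∑' j, tailCoeff B k j * ringPiece N K j z

theorem geomBounded_ringTail (hB : 1 < B) : GeomBounded Set.univ (ringTail B N K) :=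
  (geomBounded_ringPiece N K).tsum_mul fun _ hr => exists_tailCoeff_mul_pow_le hB hr

theorem ringTail_eq_zero_of_one_le_norm (k : ℕ) {z : ℂ} (h : 1 ≤ ‖z‖) :
    ringTail B N K k z = 0 := by
  simp [ringTail, ringPiece_eq_zero_of_one_le_norm _ h]

/-- By disjointness of supports only the term `j = k` of the series survives. This is what makes
`g_k` a usable corrector for the full series. -/
theorem ringTail_zero_mul_ringPiece (k : ℕ) (z : ℂ) :
    ringPiece N K k z * ringTail B N K 0 z = ringPiece N K k z ^ 2 / B ^ k ^ 2 := by
  by_cases h : ringPiece N K k z = 0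
  · simp [h]
  · rw [ringTail, tsum_eq_single k fun j hj => by
      rw [ringPiece_disjoint hj.symm h, mul_zero]]
    simp [tailCoeff]
    ring

/-- On the lines of scale `k`, the rescaled tail is a multiple of the full series. -/
theorem ringTail_eq {k : ℕ} {z : ℂ} (h : 2 ^ (k + 1) * (1 - ‖z‖ ^ 2) ≤ 3) :
    ringTail B N K k z = B ^ k ^ 2 * ringTail B N K 0 z := by
  rw [ringTail, ringTail, ← tsum_mul_left]
  congr 1 with j
  unfold tailCoeff
  split_ifs with h1 h2
  · simp; ring
  · omega
  -- The terms dropped from the tail have `j + 2 ≤ k`; there `2^(j+1) (1 - r²) ≤ 3/4`, below the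
  -- support of the bump.
  · rw [ringPiece_eq_zero]
    · simp
    · rcases le_or_gt (1 - ‖z‖ ^ 2) 0 with h3 | h3
      · exact (mul_nonpos_of_nonneg_of_nonpos (by positivity) h3).trans zero_le_one
      · have h4 : (2 : ℝ) ^ (j + 1 + 2) ≤ 2 ^ (k + 1) :=
          pow_le_pow_right₀ (by norm_num) (by omega)
        rw [pow_add] at h4
        nlinarith
  · simp at *

theorem lineInt_ringTail (hB : 1 < B) (k : ℕ) (φ p : ℝ) :
    lineInt (ringTail B N K k) φ p = ∑' j, tailCoeff B k j * lineInt (ringPiece N K j) φ p := by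
  unfold lineInt ringTail
  rw [← integral_tsum_of_summable_integral_norm
    (fun j => (integrable_ringPiece_linePt j φ p).const_mul _)]
  · simp_rw [integral_const_mul]
  · refine Summable.of_nonneg_of_le (fun j => integral_nonneg fun t => norm_nonneg _)
      (fun j => ?_) ((summable_tailCoeff hB k).mul_right 2)
    simp_rw [norm_mul]
    rw [integral_const_mul, Real.norm_of_nonneg (tailCoeff_nonneg hB.le k j)]
    exact mul_le_mul_of_nonneg_left (integral_norm_ringPiece_le j φ p)
      (tailCoeff_nonneg hB.le k j)

theorem hasSum_ite_add_geometric (a b : ℝ) :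
    HasSum (fun j : ℕ => (if j = 0 then a else 0) + b * (1 / 2) ^ (j + 1)) (a + b) := by
  refine (hasSum_ite_eq 0 a).add ?_
  have := hasSum_geometric_two.mul_left (b / 2)
  rw [div_mul_cancel₀ b two_ne_zero] at this
  refine this.congr_fun fun j => ?_
  rw [pow_succ]; ring

theorem abs_lineInt_ringPiece_le_two (k : ℕ) (φ p : ℝ) : |lineInt (ringPiece N K k) φ p| ≤ 2 :=
  (norm_integral_le_integral_norm _).trans (integral_norm_ringPiece_le k φ p)

/-- No oscillation is needed for `1 ≤ j`: the coefficients `B^(-j²)` and the trivial bound `2` for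
the line integrals already give `O(1 / B)`. -/
theorem abs_lineInt_ringTail_zero_le (hB : 2 ≤ B) {φ p e : ℝ}
    (he : |lineInt (ringPiece N K 0) φ p| ≤ e) :
    |lineInt (ringTail B N K 0) φ p| ≤ e + 8 / B := by
  rw [lineInt_ringTail (by linarith)]
  rw [← Real.norm_eq_abs]
  refine tsum_of_norm_bounded (hasSum_ite_add_geometric e (8 / B)) fun j => ?_
  rw [norm_mul, Real.norm_of_nonneg (tailCoeff_nonneg (by linarith) _ _), Real.norm_eq_abs]
  cases j with
  | zero =>
    simp only [tailCoeff, if_true, zero_le, ne_eq, OfNat.ofNat_ne_zero, not_false_eq_true,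
      zero_pow, pow_zero, div_one, one_mul]
    have : 0 ≤ 8 / B * (1 / 2) ^ (0 + 1) := by positivity
    linarith
  | succ j =>
    have h1 := tailCoeff_le_geometric (B := B) (by linarith) 0 (j + 1)
    have h2 : (1 / B) ^ j ≤ (1 / 2) ^ j := by gcongr
    calc tailCoeff B 0 (j + 1) * |lineInt (ringPiece N K (j + 1)) φ p|
        ≤ (B ^ 0 ^ 2 * (1 / B) ^ (j + 1)) * 2 := by
          gcongr
          exact abs_lineInt_ringPiece_le_two _ _ _
      _ = 2 / B * (1 / B) ^ j := by simp [pow_succ]; ring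
      _ ≤ 2 / B * (1 / 2) ^ j := by gcongr
      _ = _ := by rw [if_neg (by omega), pow_succ, pow_succ]; ring

/-- Of the `L + 1` powers of `2^(-j)` gained by oscillation, one sums the series in `j` and `L` give
`2^(-Lk)` up to a constant, since `k - 1 ≤ j`; they compete with the coefficient bound `B^(2k)`. The
chirp enters only for `k = 1`, with coefficient `B`. It matters that `X` depends on `L` alone, so
that `N` can be chosen after `B`. -/
theorem exists_abs_lineInt_ringTail_le (L : ℕ) :
    ∃ X : ℝ, 0 ≤ X ∧ ∀ (B : ℝ) (N k : ℕ) (K φ p e : ℝ), 1 < B → 1 ≤ N → 1 ≤ k → 1 / 2 ≤ |p| →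
      |lineInt (ringPiece N K 0) φ p| ≤ e →
      |lineInt (ringTail B N K k) φ p| ≤
        (if k = 1 then B * e else 0) + X / N * (B ^ 2 / 2 ^ L) ^ k := by
  obtain ⟨C, hC, h⟩ := exists_abs_lineInt_succ_le (L + 1)
  refine ⟨C * (2 ^ L * 2 ^ L * 4), by positivity, fun B N k K φ p e hB hN hk hp he => ?_⟩
  have hN0 : (1 : ℝ) ≤ N := by exact_mod_cast hN
  have he0 : 0 ≤ e := (abs_nonneg _).trans he
  rw [lineInt_ringTail hB]
  rw [← Real.norm_eq_abs]
  refine tsum_of_norm_bounded (hasSum_ite_add_geometric _ _) fun j => ?_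
  rw [norm_mul, Real.norm_of_nonneg (tailCoeff_nonneg hB.le _ _), Real.norm_eq_abs]
  have hpos : 0 ≤ C * (2 ^ L * 2 ^ L * 4) / N * (B ^ 2 / 2 ^ L) ^ k * (1 / 2) ^ (j + 1) := by
    positivity
  by_cases hkj : k ≤ j + 1
  swap
  · rw [tailCoeff, if_neg hkj, zero_mul]
    split_ifs <;> positivity
  cases j with
  | zero =>
    have hk1 : k = 1 := by omega
    subst hk1
    have : tailCoeff B 1 0 * |lineInt (ringPiece N K 0) φ p| ≤ B * e := by
      simp only [tailCoeff, zero_add, le_refl, if_true, one_pow, pow_one, ne_eq,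
        OfNat.ofNat_ne_zero, not_false_eq_true, zero_pow, pow_zero, div_one]
      gcongr
    simp only [if_true]
    linarith
  | succ j =>
    rw [if_neg (by omega), zero_add]
    obtain ⟨i, hi⟩ := Nat.exists_eq_add_of_le hk
    have h1 := h N j K φ p hN hp
    have h2 : ((1 : ℝ) / 2) ^ ((j + 1) * L) ≤ (1 / 2) ^ (i * L) :=
      pow_le_pow_of_le_one (by norm_num) (by norm_num) (Nat.mul_le_mul_right _ (by omega))
    have h3 : (1 / N : ℝ) ^ (L + 1) ≤ 1 / N := by
      refine pow_le_of_le_one (by positivity) ?_ (by omega)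
      rw [div_le_one (by linarith)]; exact hN0
    calc tailCoeff B k (j + 1) * |lineInt (ringPiece N K (j + 1)) φ p|
        ≤ B ^ (2 * k) * (C * (2 * (1 / 2) ^ (j + 1) / N) ^ (L + 1)) := by
          gcongr
          exact tailCoeff_le hB.le _ _
      _ = B ^ (2 * k) * C * 2 ^ (L + 1) * (1 / N : ℝ) ^ (L + 1) * (1 / 2) ^ (j + 1) *
            (1 / 2) ^ ((j + 1) * L) := by
          rw [div_eq_mul_one_div, mul_pow, mul_pow, ← pow_mul, mul_add (j + 1) L 1, mul_one,
            pow_add _ ((j + 1) * L)]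
          ring
      _ ≤ B ^ (2 * k) * C * 2 ^ (L + 1) * (1 / N) * (1 / 2) ^ (j + 1) * (1 / 2) ^ (i * L) := by
          gcongr
      _ = _ := by
          subst hi
          simp only [div_pow, one_pow, pow_mul, pow_add, pow_one]
          rw [pow_right_comm 2 i L]
          field_simp
          ring

/-- A choice of the parameters for which all the integrals of the rescaled tails are small. -/
theorem exists_ring_parameters :
    ∃ (B : ℝ) (N : ℕ) (K c : ℝ), 1 < B ∧ 0 < c ∧
      (∀ (k : ℕ) (φ p : ℝ), 5 / 4 ≤ 2 ^ (k + 1) * (1 - p ^ 2) → 2 ^ (k + 1) * (1 - p ^ 2) ≤ 3 →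
        c / 2 ^ (k + 1) ≤ lineInt (fun z => ringPiece N K k z ^ 2) φ p ∧
        |lineInt (ringTail B N K k) φ p| * (2 ^ (k + 1) / c) ≤ 1 / 3) ∧
      ∀ r : ℝ, 0 < r → ∃ C : ℝ, 0 ≤ C ∧ ∀ (k : ℕ) (φ p : ℝ),
        5 / 4 ≤ 2 ^ (k + 1) * (1 - p ^ 2) → 2 ^ (k + 1) * (1 - p ^ 2) ≤ 3 →
        |lineInt (ringTail B N K k) φ p| ≤ C * r ^ k := by
  obtain ⟨c, hc, N₀, K₀, hlow⟩ := exists_lineInt_sq_ge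
  obtain ⟨C₀, hC₀, hzero⟩ := exists_abs_lineInt_zero_le
  -- The lower bound `c` is uniform in `N` and `K`, so the choices are made in the order `B`, `L`,
  -- `N`, `K`. The condition on `B` gives `8 / B ≤ c / 12`; `2 B² < 2^L` absorbs the factor
  -- `2^(k+1)`; `N` and `K` make the two parts of the tail bound at most `c / 6` each.
  set B : ℝ := max 2 (96 / c)
  have hB2 : 2 ≤ B := le_max_left _ _
  have hBc : 96 ≤ B * c := by
    rw [← div_le_iff₀ hc]; exact le_max_right _ _
  have hB0 : 0 < B := by linarith
  obtain ⟨L, hL⟩ := pow_unbounded_of_one_lt (2 * B ^ 2) (one_lt_two (α := ℝ))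
  obtain ⟨X, hX, htail⟩ := exists_abs_lineInt_ringTail_le L
  obtain ⟨N₁, hN₁⟩ := exists_nat_ge (12 * X / c)
  set N : ℕ := N₀ + N₁ + 1
  set K : ℝ := max (max 1 K₀) ((24 * B * C₀ / c) ^ 2)
  have hK1 : 1 ≤ K := (le_max_left _ _).trans (le_max_left _ _)
  have hK0 : K₀ ≤ K := (le_max_right _ _).trans (le_max_left _ _)
  have hsK : 0 < √K := Real.sqrt_pos.2 (by linarith)
  have hKs : 24 * (B * (C₀ / √K)) ≤ c := by
    have h := Real.le_sqrt_of_sq_le (le_max_right (max 1 K₀) ((24 * B * C₀ / c) ^ 2))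
    change 24 * B * C₀ / c ≤ √K at h
    rw [div_le_iff₀ hc] at h
    rw [← mul_div_assoc, ← mul_div_assoc, div_le_iff₀ hsK]
    linarith
  have hN1 : 1 ≤ N := by omega
  have hN0 : (1 : ℝ) ≤ N := by exact_mod_cast hN1
  have hXN : 12 * (X / N) ≤ c := by
    have h : 12 * X / c ≤ N := hN₁.trans (by exact_mod_cast (by omega : N₁ ≤ N))
    rw [div_le_iff₀ hc] at h
    rw [← mul_div_assoc, div_le_iff₀ (by linarith)]
    linarith
  have hp : ∀ {k : ℕ} {p : ℝ}, 1 ≤ k → 2 ^ (k + 1) * (1 - p ^ 2) ≤ 3 → 1 / 2 ≤ |p| := by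
    intro k p hk h
    have h4 : (2 : ℝ) ^ 2 ≤ 2 ^ (k + 1) := pow_le_pow_right₀ (by norm_num) (by omega)
    have hp2 : (1 / 2) ^ 2 ≤ p ^ 2 := by
      by_contra! h5
      nlinarith
    have := sq_le_sq.1 hp2
    rwa [abs_of_pos (by norm_num : (0 : ℝ) < 1 / 2)] at this
  refine ⟨B, N, K, c, by linarith, hc, fun k φ p hs hs' =>
    ⟨hlow N k K φ p (by omega) hK0 hs hs', ?_⟩, fun r hr => ?_⟩
  · rw [← mul_div_assoc, div_le_iff₀ hc]
    cases k with
    | zero =>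
      have h1 := abs_lineInt_ringTail_zero_le hB2 (hzero N K φ p hK1)
      have h2 : C₀ / √K ≤ B * (C₀ / √K) := le_mul_of_one_le_left (by positivity) (by linarith)
      have h3 : 8 / B ≤ c / 12 := by
        rw [div_le_div_iff₀ hB0 (by norm_num)]; linarith
      norm_num
      linarith
    | succ k =>
      have h1 := htail B N (k + 1) K φ p _ (by linarith) hN1 (by omega) (hp (by omega) hs')
        (hzero N K φ p hK1)
      have h2 : X / N * (B ^ 2 / 2 ^ L) ^ (k + 1) * 2 ^ (k + 1 + 1) ≤ c / 6 := by
        have h3 : (2 * B ^ 2 / 2 ^ L) ^ (k + 1) ≤ 1 :=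
          pow_le_one₀ (by positivity) ((div_le_one (by positivity)).2 hL.le)
        calc X / N * (B ^ 2 / 2 ^ L) ^ (k + 1) * 2 ^ (k + 1 + 1)
            = 2 * (X / N) * (2 * B ^ 2 / 2 ^ L) ^ (k + 1) := by
              rw [div_pow, div_pow, mul_pow, pow_succ 2 (k + 1)]; ring
          _ ≤ 2 * (X / N) * 1 := by gcongr
          _ ≤ c / 6 := by linarith
      have h4 : (if k + 1 = 1 then B * (C₀ / √K) else 0) * 2 ^ (k + 1 + 1) ≤ c / 6 := by
        split_ifs with hk
        · have : k = 0 := by omega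
          subst this
          norm_num
          linarith
        · rw [zero_mul]; positivity
      calc _ ≤ ((if k + 1 = 1 then B * (C₀ / √K) else 0) + X / N * (B ^ 2 / 2 ^ L) ^ (k + 1)) *
            2 ^ (k + 1 + 1) := by gcongr
        _ ≤ _ := by rw [add_mul]; linarith
  -- Here `B`, `N`, `K` are fixed, and only the number of integrations by parts grows as `r`
  -- decreases.
  · obtain ⟨L', hL'⟩ := pow_unbounded_of_one_lt (B ^ 2 / r) (one_lt_two (α := ℝ))
    rw [div_lt_iff₀ hr] at hL'
    obtain ⟨X', hX', htail'⟩ := exists_abs_lineInt_ringTail_le L'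
    refine ⟨(C₀ / √K + 8 / B) + B * (C₀ / √K) / r + X' / N, by positivity,
      fun k φ p hs hs' => ?_⟩
    cases k with
    | zero =>
      have h1 := abs_lineInt_ringTail_zero_le hB2 (hzero N K φ p hK1)
      rw [pow_zero, mul_one]
      have : 0 ≤ B * (C₀ / √K) / r + X' / N := by positivity
      linarith
    | succ k =>
      refine (htail' B N (k + 1) K φ p _ (by linarith) hN1 (by omega) (hp (by omega) hs')
        (hzero N K φ p hK1)).trans ?_
      have h2 : (B ^ 2 / 2 ^ L') ^ (k + 1) ≤ r ^ (k + 1) := by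
        gcongr
        rw [div_le_iff₀ (by positivity), mul_comm]; exact hL'.le
      have h3 : X' / N * (B ^ 2 / 2 ^ L') ^ (k + 1) ≤ X' / N * r ^ (k + 1) := by gcongr
      have h4 : (if k + 1 = 1 then B * (C₀ / √K) else 0) ≤
          B * (C₀ / √K) / r * r ^ (k + 1) := by
        split_ifs with hk
        · rw [hk, pow_one, div_mul_cancel₀ _ hr.ne']
        · positivity
      have h5 : 0 ≤ (C₀ / √K + 8 / B) * r ^ (k + 1) := by positivity
      rw [add_mul, add_mul]
      linarith

end Tails

/-! ### The corrected weight and the vanishing of the planar integrals -/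

section Correction

/-- A smooth step, from `0` for `s ≤ 5/4` to `1` for `3/2 ≤ s`. -/
noncomputable def scaleStep (s : ℝ) : ℝ := Real.smoothTransition (4 * (s - 5 / 4))

/-- A dyadic partition of unity of the half line is given by the dilates of this function. -/
noncomputable def scaleCut (s : ℝ) : ℝ := scaleStep s - scaleStep (s / 2)

theorem scaleStep_of_le {s : ℝ} (h : s ≤ 5 / 4) : scaleStep s = 0 :=
  Real.smoothTransition.zero_of_nonpos (by linarith)

theorem scaleStep_of_ge {s : ℝ} (h : 3 / 2 ≤ s) : scaleStep s = 1 :=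
  Real.smoothTransition.one_of_one_le (by linarith)

theorem scaleCut_of_le {s : ℝ} (h : s ≤ 5 / 4) : scaleCut s = 0 := by
  rw [scaleCut, scaleStep_of_le h, scaleStep, Real.smoothTransition.zero_of_nonpos, sub_zero]
  linarith

theorem scaleCut_of_ge {s : ℝ} (h : 3 ≤ s) : scaleCut s = 0 := by
  rw [scaleCut, scaleStep_of_ge (by linarith), scaleStep_of_ge (by linarith), sub_self]

theorem abs_scaleCut_le_one (s : ℝ) : |scaleCut s| ≤ 1 := by
  have h1 := Real.smoothTransition.nonneg (4 * (s - 5 / 4))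
  have h2 := Real.smoothTransition.le_one (4 * (s - 5 / 4))
  have h3 := Real.smoothTransition.nonneg (4 * (s / 2 - 5 / 4))
  have h4 := Real.smoothTransition.le_one (4 * (s / 2 - 5 / 4))
  rw [scaleCut, scaleStep, scaleStep, abs_le]
  constructor <;> linarith

theorem contDiff_scaleStep : ContDiff ℝ ∞ scaleStep :=
  Real.smoothTransition.contDiff.comp (contDiff_const.mul (contDiff_id.sub contDiff_const))

theorem contDiff_scaleCut : ContDiff ℝ ∞ scaleCut :=
  contDiff_scaleStep.sub (contDiff_scaleStep.comp (contDiff_id.div_const 2))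

/-- The signed distance from the origin of the line through `z` with direction `e^{iφ}`. -/
noncomputable def lineHeight (x : ℂ × ℝ) : ℝ := (Complex.exp (-(x.2 * Complex.I)) * x.1).im

/-- The integral of a function over a segment with center `z` and direction `e^{iφ}`. -/
noncomputable def segInt (h : ℂ → ℝ) (x : ℂ × ℝ) : ℝ :=
  ∫ t in (-3 : ℝ)..3, h (x.1 + t * Complex.exp (x.2 * Complex.I))

theorem linePt_lineHeight (x : ℂ × ℝ) (t : ℝ) :
    linePt x.2 (lineHeight x) (t + (Complex.exp (-(x.2 * Complex.I)) * x.1).re) =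
      x.1 + t * Complex.exp (x.2 * Complex.I) := by
  have h : ((t + (Complex.exp (-(x.2 * Complex.I)) * x.1).re : ℝ) : ℂ) +
      lineHeight x * Complex.I = t + Complex.exp (-(x.2 * Complex.I)) * x.1 := by
    rw [lineHeight, Complex.ofReal_add, add_assoc, Complex.re_add_im]
  rw [linePt, h, mul_add, ← mul_assoc, ← Complex.exp_add, add_neg_cancel, Complex.exp_zero,
    one_mul]
  ring

theorem lineHeight_linePt (φ p t : ℝ) : lineHeight (linePt φ p t, φ) = p := by
  rw [lineHeight, linePt, ← mul_assoc, ← Complex.exp_add, neg_add_cancel, Complex.exp_zero,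
    one_mul]
  simp

/-- For `‖z‖ ≤ 1` the points at parameter `3 ≤ |t|` lie outside the unit disc. A fixed interval of
integration makes smooth dependence on the parameters immediate. -/
theorem segInt_eq_lineInt {h : ℂ → ℝ} (h0 : ∀ z, 1 ≤ ‖z‖ → h z = 0) {x : ℂ × ℝ}
    (hx : ‖x.1‖ ≤ 1) : segInt h x = lineInt h x.2 (lineHeight x) := by
  rw [segInt, lineInt, intervalIntegral.integral_of_le (by norm_num),
    setIntegral_eq_integral_of_forall_compl_eq_zero,
    ← integral_add_right_eq_self (fun t => h (linePt x.2 (lineHeight x) t))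
      (Complex.exp (-(x.2 * Complex.I)) * x.1).re]
  · simp_rw [linePt_lineHeight]
  · intro t ht
    refine h0 _ ?_
    have h1 : 3 ≤ |t| := by
      by_contra! h2
      rw [abs_lt] at h2
      exact ht ⟨h2.1, h2.2.le⟩
    have h2 := norm_sub_le (x.1 + t * Complex.exp (x.2 * Complex.I)) x.1
    rw [add_sub_cancel_left, norm_mul, Complex.norm_exp_ofReal_mul_I, mul_one,
      Complex.norm_real, Real.norm_eq_abs] at h2
    linarith

variable {B : ℝ} {N : ℕ} {K c : ℝ}

/-- The contribution of the lines of scale `k` to the deviation of the weight from a constant. -/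
noncomputable def correctionTerm (B : ℝ) (N : ℕ) (K c : ℝ) (k : ℕ) (x : ℂ × ℝ) : ℝ :=
  scaleCut (2 ^ (k + 1) * (1 - lineHeight x ^ 2)) * ringPiece N K k x.1 *
    segInt (ringTail B N K k) x *
      (2 ^ (k + 1) / c * invCut (2 ^ (k + 1) / c * segInt (fun z => ringPiece N K k z ^ 2) x))

theorem segInt_congr_exp (h : ℂ → ℝ) (z : ℂ) {φ φ' : ℝ}
    (he : Complex.exp (φ * Complex.I) = Complex.exp (φ' * Complex.I)) :
    segInt h (z, φ) = segInt h (z, φ') := by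
  simp only [segInt, he]

theorem correctionTerm_congr_exp (k : ℕ) (z : ℂ) {φ φ' : ℝ}
    (he : Complex.exp (φ * Complex.I) = Complex.exp (φ' * Complex.I)) :
    correctionTerm B N K c k (z, φ) = correctionTerm B N K c k (z, φ') := by
  have h : lineHeight (z, φ) = lineHeight (z, φ') := by
    simp only [lineHeight, Complex.exp_neg, he]
  simp only [correctionTerm, segInt_congr_exp _ z he, h]

theorem exp_add_int_mul_two_pi (φ : ℝ) (n : ℤ) :
    Complex.exp ((φ + n * (2 * Real.pi) : ℝ) * Complex.I) = Complex.exp (φ * Complex.I) := by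
  rw [Complex.exp_eq_exp_iff_exists_int]
  exact ⟨n, by push_cast; ring⟩

/-- Periodicity in the angle replaces compactness: translation by a period does not change
derivatives. -/
theorem GeomBounded.of_periodic {S : Set ℂ} {F : ℕ → ℂ × ℝ → ℝ}
    (hF : GeomBounded (S ×ˢ Set.Icc 0 (2 * Real.pi)) F)
    (hp : ∀ k z (φ : ℝ) (n : ℤ), F k (z, φ + n * (2 * Real.pi)) = F k (z, φ)) :
    GeomBounded (S ×ˢ Set.univ) F := by
  refine ⟨hF.smooth, fun m => ?_⟩
  obtain ⟨R, hR, hb⟩ := hF.bound m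
  refine ⟨R, hR, fun k x hx => ?_⟩
  obtain ⟨n, hn⟩ : ∃ n : ℤ, x.2 + n * (2 * Real.pi) ∈ Set.Icc 0 (2 * Real.pi) := by
    obtain ⟨n, hn, -⟩ := existsUnique_add_zsmul_mem_Ico Real.two_pi_pos x.2 0
    refine ⟨n, ?_⟩
    rw [zsmul_eq_mul, zero_add] at hn
    exact ⟨hn.1, hn.2.le⟩
  have h : (fun y => F k (y + (0, n * (2 * Real.pi)))) = F k := by
    ext y
    rw [show y + (0, n * (2 * Real.pi)) = (y.1, y.2 + n * (2 * Real.pi)) by ext <;> simp]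
    exact hp k y.1 y.2 n
  rw [← h, iteratedFDeriv_comp_add_right]
  exact hb k _ ⟨by simpa using hx.1, by simpa using hn⟩

theorem contDiff_lineHeight : ContDiff ℝ ∞ lineHeight := by
  have h : ContDiff ℝ ∞ fun x : ℂ × ℝ => Complex.exp (-(x.2 * Complex.I)) * x.1 :=
    ((((Complex.ofRealCLM.contDiff.comp contDiff_snd).mul contDiff_const).neg).cexp).mul
      contDiff_fst
  exact Complex.imCLM.contDiff.comp h

theorem GeomBounded.segInt {S : Set (ℂ × ℝ)} (hS : IsCompact S) {h : ℕ → ℂ → ℝ}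
    (hh : GeomBounded Set.univ h) : GeomBounded S (fun k x => segInt (h k) x) := by
  have hline : ContDiff ℝ ∞ fun y : (ℂ × ℝ) × ℝ =>
      y.1.1 + y.2 * Complex.exp (y.1.2 * Complex.I) :=
    (contDiff_fst.comp contDiff_fst).add ((Complex.ofRealCLM.contDiff.comp contDiff_snd).mul
      (((Complex.ofRealCLM.contDiff.comp (contDiff_snd.comp contDiff_fst)).mul
        contDiff_const).cexp))
  exact GeomBounded.intervalIntegral (hh.comp (GeomBounded.const
    (hS.prod (isCompact_uIcc (a := (-3 : ℝ)) (b := 3))) hline) fun _ _ _ => Set.mem_univ _)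

theorem abs_two_pow_div_le (c : ℝ) (k : ℕ) :
    |2 ^ (k + 1) / c| ≤ (2 * max |1 / c| 1) ^ (k + 1) := by
  rw [mul_pow, div_eq_mul_one_div, abs_mul, abs_of_nonneg (by positivity : (0 : ℝ) ≤ 2 ^ (k + 1))]
  gcongr
  exact le_pow_succ_of_le (le_max_right _ _) (le_max_left _ _) k

/-- All factors are built from geometric families by products, compositions and integration over
segments; `invCut` keeps the division smooth even where `∫ g_k²` is small. The factor `ringPiece`
extends the bound from a compact set to the whole space. -/
theorem geomBounded_correctionTerm (hB : 1 < B) :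
    GeomBounded Set.univ (correctionTerm B N K c) := by
  set S : Set (ℂ × ℝ) := closedBall (0 : ℂ) 2 ×ˢ Set.Icc 0 (2 * Real.pi)
  have hS : IsCompact S := (isCompact_closedBall _ _).prod isCompact_Icc
  have hr : 1 ≤ 2 * max |1 / c| 1 := by linarith [le_max_right |1 / c| 1]
  have h1 : GeomBounded S fun k x => scaleCut (2 ^ (k + 1) * (1 - lineHeight x ^ 2)) := by
    refine (GeomBounded.const_of_hasCompactSupport (S := Set.univ) contDiff_scaleCut
      (hasCompactSupport_of_zero_outside_Ioo (fun s => scaleCut_of_le)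
        (fun s => scaleCut_of_ge))).comp ?_ fun _ _ _ => Set.mem_univ _
    exact (GeomBounded.const hS (contDiff_const.sub (contDiff_lineHeight.pow 2))).geom_mul
      (r := 2) (by norm_num) fun k => by rw [abs_of_nonneg (by positivity)]
  have h2 : GeomBounded S fun k x => ringPiece N K k x.1 :=
    (geomBounded_ringPiece N K).comp (GeomBounded.const hS contDiff_fst) fun _ _ _ => Set.mem_univ _
  have h3 : GeomBounded S fun k x => segInt (ringTail B N K k) x :=
    (geomBounded_ringTail hB).segInt hS
  have h4 : GeomBounded S fun k x => segInt (fun z => ringPiece N K k z ^ 2) x := by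
    have := ((geomBounded_ringPiece N K).mul (geomBounded_ringPiece N K)).segInt hS
    simpa only [pow_two] using this
  have h5 : GeomBounded S fun k x => 2 ^ (k + 1) / c *
      invCut (2 ^ (k + 1) / c * segInt (fun z => ringPiece N K k z ^ 2) x) :=
    ((GeomBounded.const_of_bound contDiff_invCut exists_bound_iteratedFDeriv_invCut).comp
      (h4.geom_mul hr (abs_two_pow_div_le c)) fun _ _ _ => Set.mem_univ _).geom_mul hr
        (abs_two_pow_div_le c)
  have key : GeomBounded S (correctionTerm B N K c) := ((h1.mul h2).mul h3).mul h5
  refine (key.of_periodic fun k z φ n => correctionTerm_congr_exp k z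
    (exp_add_int_mul_two_pi φ n)).of_eq_zero_outside fun k x hx => ?_
  have hx' : x.1 ∉ closedBall (0 : ℂ) 1 := fun h =>
    hx ⟨closedBall_subset_closedBall (by norm_num) h, Set.mem_univ _⟩
  filter_upwards [continuous_fst.continuousAt.preimage_mem_nhds
    (isClosed_closedBall.isOpen_compl.mem_nhds hx')] with y hy
  simp only [Set.mem_preimage, Set.mem_compl_iff, mem_closedBall, dist_zero_right, not_le] at hy
  simp [correctionTerm, ringPiece_eq_zero_of_one_le_norm k hy.le]

/-- The lower bound for the integrals of the squares of the pieces along the lines of the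
corresponding scale. -/
def RingLowerBound (N : ℕ) (K c : ℝ) : Prop :=
  ∀ (k : ℕ) (φ p : ℝ), 5 / 4 ≤ 2 ^ (k + 1) * (1 - p ^ 2) → 2 ^ (k + 1) * (1 - p ^ 2) ≤ 3 →
    c / 2 ^ (k + 1) ≤ lineInt (fun z => ringPiece N K k z ^ 2) φ p

/-- Where `scaleCut` does not vanish, the lower bound puts the argument of `invCut` in `[1, ∞)`, so
`invCut` is a true reciprocal and the factors `2^(k+1) / c` cancel. -/
theorem correctionTerm_eq (hc : 0 < c) (hlow : RingLowerBound N K c) (k : ℕ) {x : ℂ × ℝ}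
    (hx : ‖x.1‖ ≤ 1) :
    correctionTerm B N K c k x =
      scaleCut (2 ^ (k + 1) * (1 - lineHeight x ^ 2)) * ringPiece N K k x.1 *
        (lineInt (ringTail B N K k) x.2 (lineHeight x) /
          lineInt (fun z => ringPiece N K k z ^ 2) x.2 (lineHeight x)) := by
  rw [correctionTerm, segInt_eq_lineInt (fun z => ringTail_eq_zero_of_one_le_norm k) hx,
    segInt_eq_lineInt (h := fun z => ringPiece N K k z ^ 2) (fun z hz => by
      rw [ringPiece_eq_zero_of_one_le_norm k hz, zero_pow two_ne_zero]) hx]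
  rcases le_or_gt (2 ^ (k + 1) * (1 - lineHeight x ^ 2)) (5 / 4) with h1 | h1
  · rw [scaleCut_of_le h1]; simp
  rcases le_or_gt 3 (2 ^ (k + 1) * (1 - lineHeight x ^ 2)) with h2 | h2
  · rw [scaleCut_of_ge h2]; simp
  have h3 := hlow k x.2 _ h1.le h2.le
  have h4 : 1 ≤ 2 ^ (k + 1) / c *
      lineInt (fun z => ringPiece N K k z ^ 2) x.2 (lineHeight x) := by
    calc (1 : ℝ) = 2 ^ (k + 1) / c * (c / 2 ^ (k + 1)) := by field_simp
      _ ≤ _ := by gcongr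
  rw [invCut_of_one_le h4, mul_inv, ← mul_assoc (2 ^ (k + 1) / c), mul_inv_cancel₀ (by positivity),
    one_mul, mul_assoc _ (lineInt _ _ _), div_eq_mul_inv]

theorem abs_correctionTerm_le (hc : 0 < c) (hlow : RingLowerBound N K c) (k : ℕ) (x : ℂ × ℝ)
    {a : ℝ} (ha : 0 ≤ a) (hb : ∀ (φ p : ℝ), 5 / 4 ≤ 2 ^ (k + 1) * (1 - p ^ 2) →
      2 ^ (k + 1) * (1 - p ^ 2) ≤ 3 → |lineInt (ringTail B N K k) φ p| * (2 ^ (k + 1) / c) ≤ a) :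
    |correctionTerm B N K c k x| ≤ a := by
  rcases le_or_gt 1 ‖x.1‖ with hx | hx
  · simpa [correctionTerm, ringPiece_eq_zero_of_one_le_norm k hx] using ha
  rw [correctionTerm_eq hc hlow k hx.le]
  rcases le_or_gt (2 ^ (k + 1) * (1 - lineHeight x ^ 2)) (5 / 4) with h1 | h1
  · rw [scaleCut_of_le h1]; simpa using ha
  rcases le_or_gt 3 (2 ^ (k + 1) * (1 - lineHeight x ^ 2)) with h2 | h2
  · rw [scaleCut_of_ge h2]; simpa using ha
  have h3 := hlow k x.2 _ h1.le h2.le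
  have h4 := hb x.2 _ h1.le h2.le
  have h5 : 0 < c / 2 ^ (k + 1) := by positivity
  rw [abs_mul, abs_mul, abs_div]
  calc _ ≤ 1 * 1 * (|lineInt (ringTail B N K k) x.2 (lineHeight x)| / (c / 2 ^ (k + 1))) := by
        gcongr
        · exact abs_scaleCut_le_one _
        · exact abs_ringPiece_le_one _ _
        · exact h3.trans (le_abs_self _)
    _ ≤ a := by rw [one_mul, one_mul, div_eq_mul_inv, inv_div]; exact h4

/-- At each point at most one term is nonzero, since the pieces have disjoint supports; a bound for
the terms is thus a bound for the sum. -/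
theorem abs_tsum_correctionTerm_le {a : ℝ} (ha : 0 ≤ a)
    (hb : ∀ k x, |correctionTerm B N K c k x| ≤ a) (x : ℂ × ℝ) :
    |∑' k, correctionTerm B N K c k x| ≤ a := by
  by_cases h : ∃ k, ringPiece N K k x.1 ≠ 0
  · obtain ⟨k, hk⟩ := h
    rw [tsum_eq_single k fun j hj => by
      simp [correctionTerm, ringPiece_disjoint hj.symm hk]]
    exact hb k x
  · push Not at h
    simpa [correctionTerm, h] using ha

theorem exists_lt_two_pow_mul {s : ℝ} (hs : 0 < s) : ∃ n : ℕ, ∀ k, n ≤ k → 3 ≤ 2 ^ k * s := by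
  obtain ⟨n, hn⟩ := pow_unbounded_of_one_lt (3 / s) (one_lt_two (α := ℝ))
  refine ⟨n, fun k hk => ?_⟩
  rw [div_lt_iff₀ hs] at hn
  have : (2 : ℝ) ^ n ≤ 2 ^ k := pow_le_pow_right₀ (by norm_num) hk
  nlinarith

/-- On a line of scale `k` the tail integral is `B^(k²)` times that of the full series, and this
factor cancels against `g_k f = B^(-k²) g_k²`. Only finitely many scales belong to a line with `p² <
1`. -/
theorem tsum_correctionTerm_mul (hc : 0 < c) (hB : 1 < B) (hlow : RingLowerBound N K c)
    {φ p : ℝ} {n : ℕ} (hn : ∀ k, n ≤ k → 3 ≤ 2 ^ k * (1 - p ^ 2)) (t : ℝ) :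
    (∑' k, correctionTerm B N K c k (linePt φ p t, φ)) * ringTail B N K 0 (linePt φ p t) =
      ∑ k ∈ Finset.range n, scaleCut (2 ^ (k + 1) * (1 - p ^ 2)) *
        (lineInt (ringTail B N K 0) φ p / lineInt (fun z => ringPiece N K k z ^ 2) φ p) *
          ringPiece N K k (linePt φ p t) ^ 2 := by
  rcases le_or_gt 1 ‖linePt φ p t‖ with h | h
  · simp [ringTail_eq_zero_of_one_le_norm _ h, ringPiece_eq_zero_of_one_le_norm _ h]
  have hterm : ∀ k, correctionTerm B N K c k (linePt φ p t, φ) * ringTail B N K 0 (linePt φ p t) =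
      scaleCut (2 ^ (k + 1) * (1 - p ^ 2)) *
        (lineInt (ringTail B N K 0) φ p / lineInt (fun z => ringPiece N K k z ^ 2) φ p) *
          ringPiece N K k (linePt φ p t) ^ 2 := by
    intro k
    rw [correctionTerm_eq hc hlow k h.le]
    simp only [lineHeight_linePt]
    rcases le_or_gt 3 (2 ^ (k + 1) * (1 - p ^ 2)) with h2 | h2
    · rw [scaleCut_of_ge h2]; simp
    have h3 : lineInt (ringTail B N K k) φ p = B ^ k ^ 2 * lineInt (ringTail B N K 0) φ p := by
      rw [lineInt, lineInt, ← integral_const_mul]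
      refine integral_congr_ae (.of_forall fun u => ringTail_eq ?_)
      refine le_trans ?_ h2.le
      rw [norm_sq_linePt]
      gcongr
      linarith [sq_nonneg u]
    have h4 := ringTail_zero_mul_ringPiece (B := B) (N := N) (K := K) k (linePt φ p t)
    have h5 : B ^ k ^ 2 ≠ 0 := by positivity
    rw [eq_div_iff h5] at h4
    rw [h3, ← h4]
    ring
  rw [← tsum_mul_right, tsum_eq_sum (s := Finset.range n) fun k hk => ?_]
  · exact Finset.sum_congr rfl fun k _ => hterm k
  · rw [hterm, scaleCut_of_ge (hn _ (by rw [Finset.mem_range] at hk; omega))]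
    simp

theorem integrable_comp_linePt {h : ℂ → ℝ} (hc : Continuous h) (h0 : ∀ z, 1 ≤ ‖z‖ → h z = 0)
    (φ p : ℝ) : Integrable fun t => h (linePt φ p t) := by
  refine (hc.comp (continuous_linePt φ p)).integrable_of_hasCompactSupport
    (HasCompactSupport.intro (isCompact_Icc (a := -1) (b := 1)) fun t ht => h0 _ ?_)
  rw [Set.mem_Icc, ← abs_le, not_le] at ht
  have := norm_sq_linePt φ p t
  by_contra! h
  nlinarith [norm_nonneg (linePt φ p t), sq_abs t, sq_nonneg p]

/-- After integration each term is `scaleCut` times the integral of the full series. The cut-offs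
telescope to `1`: the last step is `1` by the choice of `n`, the first is `0` because `1 - p² ≤
5/4`. -/
theorem integral_correction_eq_zero (hc : 0 < c) (hB : 1 < B) (hlow : RingLowerBound N K c)
    (φ p : ℝ) :
    ∫ t, (1 - ∑' k, correctionTerm B N K c k (linePt φ p t, φ)) *
      ringTail B N K 0 (linePt φ p t) = 0 := by
  rcases le_or_gt (1 - p ^ 2) 0 with hp | hp
  · have : ∀ t, ringTail B N K 0 (linePt φ p t) = 0 := fun t => by
      refine ringTail_eq_zero_of_one_le_norm _ ?_
      have := norm_sq_linePt φ p t
      by_contra! h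
      nlinarith [norm_nonneg (linePt φ p t), sq_nonneg t]
    simp [this]
  obtain ⟨n, hn⟩ := exists_lt_two_pow_mul hp
  simp_rw [sub_mul, one_mul, tsum_correctionTerm_mul hc hB hlow hn]
  have hi : ∀ k, Integrable fun t => ringPiece N K k (linePt φ p t) ^ 2 := fun k =>
    integrable_comp_linePt (h := fun z => ringPiece N K k z ^ 2)
      ((contDiff_ringPiece k).continuous.pow 2) (fun z hz => by
        rw [ringPiece_eq_zero_of_one_le_norm k hz, zero_pow two_ne_zero]) φ p
  rw [integral_sub (integrable_comp_linePt ((geomBounded_ringTail hB).smooth 0).continuous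
      (fun z => ringTail_eq_zero_of_one_le_norm 0) φ p)
    (integrable_finsetSum _ fun k _ => (hi k).const_mul _),
    integral_finsetSum _ fun k _ => (hi k).const_mul _]
  have hterm : ∀ k, ∫ t, scaleCut (2 ^ (k + 1) * (1 - p ^ 2)) *
        (lineInt (ringTail B N K 0) φ p / lineInt (fun z => ringPiece N K k z ^ 2) φ p) *
          ringPiece N K k (linePt φ p t) ^ 2 =
      (scaleStep (2 ^ (k + 1) * (1 - p ^ 2)) - scaleStep (2 ^ k * (1 - p ^ 2))) *
        lineInt (ringTail B N K 0) φ p := by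
    intro k
    have e : scaleStep (2 ^ (k + 1) * (1 - p ^ 2)) - scaleStep (2 ^ k * (1 - p ^ 2)) =
        scaleCut (2 ^ (k + 1) * (1 - p ^ 2)) := by
      rw [scaleCut]
      congr 2
      rw [pow_succ]; ring
    rw [e, integral_const_mul]
    rcases le_or_gt (2 ^ (k + 1) * (1 - p ^ 2)) (5 / 4) with h1 | h1
    · rw [scaleCut_of_le h1]; simp
    rcases le_or_gt 3 (2 ^ (k + 1) * (1 - p ^ 2)) with h2 | h2
    · rw [scaleCut_of_ge h2]; simp
    have h3 : 0 < lineInt (fun z => ringPiece N K k z ^ 2) φ p :=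
      lt_of_lt_of_le (by positivity) (hlow k φ p h1.le h2.le)
    change _ * lineInt (fun z => ringPiece N K k z ^ 2) φ p = _
    field_simp
  simp_rw [hterm]
  rw [← Finset.sum_mul, Finset.sum_range_sub fun k => scaleStep (2 ^ k * (1 - p ^ 2)),
    scaleStep_of_ge (by linarith [hn n le_rfl]), scaleStep_of_le (by
      rw [pow_zero, one_mul]; linarith [sq_nonneg p])]
  simp [lineInt]

/-- A planar pair of Boman's type, in complex notation. -/
theorem exists_complex_boman_pair :
    ∃ (f : ℂ → ℝ) (G : ℂ × ℝ → ℝ), ContDiff ℝ ∞ f ∧ ContDiff ℝ ∞ G ∧ f ≠ 0 ∧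
      (∀ z, 1 ≤ ‖z‖ → f z = 0) ∧ (∀ x, |G x| ≤ 1 / 3) ∧
      (∀ (z : ℂ) (φ φ' : ℝ), Complex.exp (φ * Complex.I) = Complex.exp (φ' * Complex.I) →
        G (z, φ) = G (z, φ')) ∧
      ∀ φ p : ℝ, ∫ t, (1 - G (linePt φ p t, φ)) * f (linePt φ p t) = 0 := by
  obtain ⟨B, N, K, c, hB, hc, hbounds, hrapid⟩ := exists_ring_parameters
  have hlow : RingLowerBound N K c := fun k φ p h1 h2 => (hbounds k φ p h1 h2).1
  have hdecay : RapidDecay (correctionTerm B N K c) := by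
    intro r hr
    obtain ⟨C, hC, hb⟩ := hrapid (r / 2) (by positivity)
    -- Dividing by the lower bound `c / 2^(k+1)` costs a factor `2^k`, which is why the decay is
    -- invoked with rate `r / 2`.
    refine ⟨2 * C / c, by positivity, fun k x => ?_⟩
    refine abs_correctionTerm_le hc hlow k x (by positivity) fun φ p h1 h2 => ?_
    calc _ ≤ C * (r / 2) ^ k * (2 ^ (k + 1) / c) := by gcongr; exact hb k φ p h1 h2
      _ = _ := by rw [div_pow, pow_succ]; field_simp
  refine ⟨ringTail B N K 0, fun x => ∑' k, correctionTerm B N K c k x,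
    (geomBounded_ringTail hB).smooth 0, (geomBounded_correctionTerm hB).contDiff_tsum hdecay,
    fun h0 => ?_, fun z => ringTail_eq_zero_of_one_le_norm 0,
    abs_tsum_correctionTerm_le (by norm_num) fun k x => abs_correctionTerm_le hc hlow k x
      (by norm_num) fun φ p h1 h2 => (hbounds k φ p h1 h2).2,
    fun z φ φ' he => ?_, integral_correction_eq_zero hc hB hlow⟩
  -- If the series vanished, so would `g_0²`, against the lower bound on a line through the origin,
  -- where `2 (1 - p²) = 2` is admissible.
  · have h1 := hlow 0 0 0 (by norm_num) (by norm_num)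
    have h2 : ∀ z, ringPiece N K 0 z ^ 2 = 0 := fun z => by
      have := ringTail_zero_mul_ringPiece (B := B) (N := N) (K := K) 0 z
      rw [h0] at this
      simpa using this.symm
    simp only [lineInt, h2, integral_zero] at h1
    have : 0 < c / 2 ^ (0 + 1) := by positivity
    linarith
  · simp_rw [correctionTerm_congr_exp _ z he]

end Correction

/-! ### From angles to unit vectors: the planar weight -/

section PlanarWeight

theorem contMDiff_coe_sph {n : ℕ} :
    ContMDiff (𝓡 (n + 1)) 𝓘(ℝ, Euc (n + 2)) ∞ (Subtype.val : Sph (n + 2) → Euc (n + 2)) := by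
  have := Fact.mk (finrank_euclideanSpace_fin (𝕜 := ℝ) (n := n + 1 + 1))
  exact contMDiff_coe_sphere (n := n + 1)

/-- The identification of `ℝ²` with the complex plane. -/
noncomputable def planeToComplex : Euc 2 ≃ₗᵢ[ℝ] ℂ := Complex.orthonormalBasisOneI.repr.symm

/-- The weight obtained from a periodic function of a point and an angle, extended to all
directions as a homogeneous function of degree zero. -/
noncomputable def angularWeight (G : ℂ × ℝ → ℝ) (x : Euc 2 × Euc 2) : ℝ :=
  3 / 4 * (1 - G (planeToComplex x.1, Complex.arg (planeToComplex x.2)))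

variable {G : ℂ × ℝ → ℝ}

theorem angularWeight_smul (x θ : Euc 2) {r : ℝ} (hr : 0 < r) :
    angularWeight G (x, r • θ) = angularWeight G (x, θ) := by
  simp only [angularWeight, map_smul, Complex.real_smul, Complex.arg_real_mul _ hr]

theorem exp_arg_mul_I {w : ℂ} (hw : w ≠ 0) :
    Complex.exp (w.arg * Complex.I) = w / ‖w‖ := by
  have : (‖w‖ : ℂ) ≠ 0 := by exact_mod_cast norm_ne_zero_iff.2 hw
  rw [eq_div_iff this, mul_comm, Complex.norm_mul_exp_arg_mul_I]

theorem contDiffAt_arg {w : ℂ} (hw : w ∈ Complex.slitPlane) : ContDiffAt ℝ ∞ Complex.arg w := by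
  have h : ContDiffAt ℝ ∞ Complex.log w := (Complex.contDiffAt_log hw).restrict_scalars ℝ
  exact (Complex.imCLM.contDiff.contDiffAt.comp w h).congr_of_eventuallyEq
    (.of_forall fun z => (Complex.log_im z).symm)

/-- On the branch cut, `arg (-w) + π` is a smooth choice of the angle with the same exponential, and
`G` does not see the difference. -/
theorem contDiffAt_comp_arg (hG : ContDiff ℝ ∞ G)
    (hper : ∀ (z : ℂ) (φ φ' : ℝ), Complex.exp (φ * Complex.I) = Complex.exp (φ' * Complex.I) →
      G (z, φ) = G (z, φ')) {x : ℂ × ℂ} (hx : x.2 ≠ 0) :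
    ContDiffAt ℝ ∞ (fun y : ℂ × ℂ => G (y.1, Complex.arg y.2)) x := by
  by_cases h : x.2 ∈ Complex.slitPlane
  · exact hG.contDiffAt.comp x (contDiffAt_fst.prodMk ((contDiffAt_arg h).comp x contDiffAt_snd))
  · have h' : -x.2 ∈ Complex.slitPlane := by
      rw [Complex.mem_slitPlane_iff] at h ⊢
      push Not at h
      rcases h.1.lt_or_eq with h1 | h1
      · left; simpa using h1
      · exact absurd (Complex.ext h1 h.2) hx
    have harg : ContDiffAt ℝ ∞ (fun y : ℂ × ℂ => Complex.arg (-y.2) + Real.pi) x := by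
      have h2 : ContDiffAt ℝ ∞ (fun y : ℂ × ℂ => -y.2) x := contDiffAt_snd.neg
      exact (ContDiffAt.comp (g := Complex.arg) x (contDiffAt_arg h') h2).add contDiffAt_const
    have hcomp : ContDiffAt ℝ ∞ (fun y : ℂ × ℂ => G (y.1, Complex.arg (-y.2) + Real.pi)) x :=
      hG.contDiffAt.comp x (contDiffAt_fst.prodMk harg)
    refine hcomp.congr_of_eventuallyEq ?_
    filter_upwards [continuous_snd.continuousAt.eventually_ne hx] with y hy
    refine hper _ _ _ ?_
    rw [Complex.ofReal_add, add_mul, Complex.exp_add, Complex.exp_pi_mul_I, exp_arg_mul_I hy,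
      exp_arg_mul_I (neg_ne_zero.2 hy), norm_neg]
    ring

theorem contDiffAt_angularWeight (hG : ContDiff ℝ ∞ G)
    (hper : ∀ (z : ℂ) (φ φ' : ℝ), Complex.exp (φ * Complex.I) = Complex.exp (φ' * Complex.I) →
      G (z, φ) = G (z, φ')) {x : Euc 2 × Euc 2} (hx : x.2 ≠ 0) :
    ContDiffAt ℝ ∞ (angularWeight G) x := by
  have hL : ContDiff ℝ ∞ planeToComplex := planeToComplex.contDiff
  have h1 : ContDiffAt ℝ ∞
      (fun y : Euc 2 × Euc 2 => (planeToComplex y.1, planeToComplex y.2)) x :=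
    ((hL.comp contDiff_fst).prodMk (hL.comp contDiff_snd)).contDiffAt
  have h2 : ContDiffAt ℝ ∞ (fun y : Euc 2 × Euc 2 =>
      G (planeToComplex y.1, Complex.arg (planeToComplex y.2))) x :=
    ContDiffAt.comp (g := fun y : ℂ × ℂ => G (y.1, Complex.arg y.2)) x
      (contDiffAt_comp_arg hG hper (x := (planeToComplex x.1, planeToComplex x.2))
        (by simpa using hx)) h1
  exact contDiffAt_const.mul (contDiffAt_const.sub h2)

/-- A planar pair of Boman's type; the weight extends smoothly to all nonzero directions, and the
ray integrals vanish for all base points of the lines. -/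
theorem exists_isBomanPair :
    ∃ (V : Euc 2 × Euc 2 → ℝ) (f₀ : Euc 2 → ℝ),
      (∀ x : Euc 2 × Euc 2, x.2 ≠ 0 → ContDiffAt ℝ ∞ V x) ∧
      (∀ (x θ : Euc 2) (r : ℝ), 0 < r → V (x, r • θ) = V (x, θ)) ∧
      IsBomanPair (fun x θ => V (x, θ)) f₀ ∧
      ∀ (x : Euc 2) (θ : Sph 2), weightedRay (fun x θ => V (x, θ)) f₀ x θ = 0 := by
  obtain ⟨f, G, hf, hG, hf0, hfs, hGb, hper, hint⟩ := exists_complex_boman_pair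
  have hV : ∀ x : Euc 2 × Euc 2, x.2 ≠ 0 → ContDiffAt ℝ ∞ (angularWeight G) x := fun x hx =>
    contDiffAt_angularWeight hG hper hx
  have hne : ∀ θ : Sph 2, (θ : Euc 2) ≠ 0 := fun θ => ne_zero_of_mem_unit_sphere θ
  have hray : ∀ (x : Euc 2) (θ : Sph 2), weightedRay (fun x θ => angularWeight G (x, θ))
      (fun x => f (planeToComplex x)) x θ = 0 := by
    intro x θ
    set φ := Complex.arg (planeToComplex θ) with hφ
    have hθ : planeToComplex θ = Complex.exp (φ * Complex.I) := by
      rw [exp_arg_mul_I (by simpa using hne θ), planeToComplex.norm_map, norm_eq_of_mem_sphere]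
      simp
    have hx : ∀ t : ℝ, planeToComplex (x + t • (θ : Euc 2)) =
        linePt φ (lineHeight (planeToComplex x, φ))
          (t + (Complex.exp (-(φ * Complex.I)) * planeToComplex x).re) := fun t => by
      rw [linePt_lineHeight (planeToComplex x, φ), map_add, map_smul, hθ, Complex.real_smul]
    simp only [weightedRay, angularWeight, hx, ← hφ]
    -- The base point `x` only shifts the parameter relative to the foot of the perpendicular, so it
    -- need not be orthogonal to `θ`.
    rw [integral_add_right_eq_self (fun t =>
      3 / 4 * (1 - G (linePt φ (lineHeight (planeToComplex x, φ)) t, φ)) *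
        f (linePt φ (lineHeight (planeToComplex x, φ)) t))]
    simp_rw [mul_assoc]
    rw [integral_const_mul, hint, mul_zero]
  refine ⟨angularWeight G, fun x => f (planeToComplex x), hV,
    fun x θ r hr => angularWeight_smul x θ hr, ⟨fun x θ => ?_, ?_, ?_, ?_, ?_, fun x θ _ => hray x θ⟩,
    hray⟩
  · have := abs_le.1 (hGb (planeToComplex x, Complex.arg (planeToComplex θ)))
    simp only [angularWeight]
    constructor <;> linarith
  · intro y
    have h1 : ContMDiff (𝓘(ℝ, Euc 2).prod (𝓡 1)) 𝓘(ℝ, Euc 2 × Euc 2) ∞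
        (fun y : Euc 2 × Sph 2 => (y.1, (y.2 : Euc 2))) :=
      ContMDiff.prodMk_space contMDiff_fst
        ((contMDiff_coe_sph (n := 0)).comp contMDiff_snd)
    exact ContMDiffAt.comp y (hV (y.1, (y.2 : Euc 2)) (hne y.2)).contMDiffAt (h1 y)
  · exact hf.comp planeToComplex.contDiff
  · intro h
    refine hf0 (funext fun z => ?_)
    have := congrFun h (planeToComplex.symm z)
    simpa using this
  · refine closure_minimal (fun x hx => ?_) isClosed_closedBall
    by_contra h
    refine hx (hfs _ ?_)
    rw [planeToComplex.norm_map]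
    simp only [mem_closedBall, dist_zero_right, not_le] at h
    exact h.le

end PlanarWeight

/-! ### Lifting the planar pair to hyperplanes in higher dimensions -/

section Lift

variable {n : ℕ}

theorem isCutoff_expNegInvGlue (n : ℕ) :
    IsCutoff (fun x : Euc n => expNegInvGlue (1 - ‖x‖ ^ 2)) := by
  have hpos : ∀ x : Euc n, ‖x‖ < 1 → 0 < expNegInvGlue (1 - ‖x‖ ^ 2) := fun x hx =>
    expNegInvGlue.pos_of_pos (by nlinarith [norm_nonneg x])
  refine ⟨expNegInvGlue.contDiff.comp (contDiff_const.sub (contDiff_norm_sq ℝ)), ?_,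
    fun x hx => hpos x (by simpa using hx)⟩
  have : Function.support (fun x : Euc n => expNegInvGlue (1 - ‖x‖ ^ 2)) = ball 0 1 := by
    ext x
    rw [Function.mem_support, mem_ball_zero_iff, ne_eq, expNegInvGlue.zero_iff_nonpos, not_le]
    constructor
    · intro h
      nlinarith [norm_nonneg x]
    · intro h
      nlinarith [norm_nonneg x]
  rw [tsupport, this, closure_ball _ one_ne_zero]

theorem planeVec_apply_zero (a : Euc 2) : (planeVec a : Euc (n + 2)) 0 = a 0 := by
  simp [planeVec, stdVec]

theorem planeVec_apply_one (a : Euc 2) : (planeVec a : Euc (n + 2)) 1 = a 1 := by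
  simp [planeVec, stdVec]

theorem planeVec_apply_succ_succ (a : Euc 2) (i : Fin n) :
    (planeVec a : Euc (n + 2)) i.succ.succ = 0 := by
  simp [planeVec, stdVec, Fin.ext_iff]

theorem inner_eq_sum_head_tail (x y : Euc (n + 2)) :
    ⟪x, y⟫ = x 0 * y 0 + x 1 * y 1 + ∑ i : Fin n, x i.succ.succ * y i.succ.succ := by
  rw [PiLp.inner_apply, Fin.sum_univ_succ, Fin.sum_univ_succ, ← add_assoc]
  simp [mul_comm]

theorem inner_planeVec (a : Euc 2) (θ : Euc (n + 2)) :
    ⟪(planeVec a : Euc (n + 2)), θ⟫ = a 0 * θ 0 + a 1 * θ 1 := by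
  rw [inner_eq_sum_head_tail, planeVec_apply_zero, planeVec_apply_one]
  simp [planeVec_apply_succ_succ]

theorem norm_sq_head_tail (x : Euc (n + 2)) : ‖x‖ ^ 2 = ‖headPart x‖ ^ 2 + ‖tailPart x‖ ^ 2 := by
  rw [EuclideanSpace.norm_sq_eq, EuclideanSpace.norm_sq_eq, EuclideanSpace.norm_sq_eq,
    Fin.sum_univ_succ, Fin.sum_univ_succ, ← add_assoc]
  simp [headPart, tailPart]

theorem norm_planeVec (a : Euc 2) : ‖(planeVec a : Euc (n + 2))‖ = ‖a‖ := by
  have h : ‖(planeVec a : Euc (n + 2))‖ ^ 2 = ‖a‖ ^ 2 := by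
    rw [← real_inner_self_eq_norm_sq, inner_planeVec, planeVec_apply_zero, planeVec_apply_one,
      EuclideanSpace.norm_sq_eq]
    simp [pow_two]
  exact (sq_eq_sq₀ (norm_nonneg _) (norm_nonneg _)).1 h

/-- Expansion along the first row leaves two minors which are lower triangular, with ones on the
diagonal except for the first entry. -/
theorem frameDet_eq (u v : Euc (n + 2)) : frameDet u v = u 0 * v 1 - u 1 * v 0 := by
  have key : ∀ w : Fin (n + 1) → ℝ, Matrix.det (Matrix.of fun i j : Fin (n + 1) =>
      (Fin.cons w fun k : Fin n => Pi.single k.succ 1 : Fin (n + 1) → Fin (n + 1) → ℝ) j i) =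
        w 0 := by
    intro w
    rw [Matrix.det_of_isLowerTriangular]
    · rw [Fin.prod_univ_succ]
      simp
    · intro i j hij
      have hij' : i < j := hij
      obtain ⟨k, rfl⟩ := Fin.exists_succ_eq.2 (Fin.ne_zero_of_lt hij')
      simp [hij'.ne]
  have hstd : ∀ k : Fin n, ∀ i : Fin (n + 1), (stdVec k.succ.succ : Euc (n + 2)) i.succ =
      (Pi.single k.succ 1 : Fin (n + 1) → ℝ) i := fun k i => by
    simp [stdVec, Pi.single_apply]
  rw [frameDet, Matrix.det_succ_row_zero, Fin.sum_univ_succ, Fin.sum_univ_succ]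
  have h0 : (Matrix.submatrix (Matrix.of fun i j : Fin (n + 2) =>
      (Fin.cons u (Fin.cons v fun k : Fin n => stdVec k.succ.succ) : Fin (n + 2) → Euc (n + 2)) j i)
      Fin.succ (Fin.succAbove 0)).det = v 1 := by
    rw [← Fin.succ_zero_eq_one, ← key fun i => v i.succ]
    congr 1
    ext i j
    refine Fin.cases ?_ (fun k => ?_) j
    · simp
    · simp [hstd]
  have h1 : (Matrix.submatrix (Matrix.of fun i j : Fin (n + 2) =>
      (Fin.cons u (Fin.cons v fun k : Fin n => stdVec k.succ.succ) : Fin (n + 2) → Euc (n + 2)) j i)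
      Fin.succ (Fin.succAbove (Fin.succ 0))).det = u 1 := by
    rw [← Fin.succ_zero_eq_one, ← key fun i => u i.succ]
    congr 1
    ext i j
    refine Fin.cases ?_ (fun k => ?_) j
    · simp
    · simp [hstd]
  rw [h0, h1]
  have h2 : ∀ k : Fin n, (stdVec k.succ.succ : Euc (n + 2)) 0 = 0 := fun k => by
    simp [stdVec, Fin.ext_iff]
  simp [h2]
  ring

theorem mem_orthSphere_iff (θ : Sph (n + 2)) :
    θ ∈ orthSphere (stdVec 0 : Euc (n + 2)) (stdVec 1) ↔
      (θ : Euc (n + 2)) 0 = 0 ∧ (θ : Euc (n + 2)) 1 = 0 := by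
  simp [orthSphere, stdVec, EuclideanSpace.inner_single_right]

/-- The vector `(θ₂, -θ₁)`. -/
noncomputable def rotatedHead (θ : Euc (n + 2)) : Euc 2 := !₂[θ 1, -θ 0]

theorem contDiff_headPart : ContDiff ℝ ∞ (headPart : Euc (n + 2) → Euc 2) := by
  refine contDiff_euclidean.2 fun i => ?_
  fin_cases i
  · exact (EuclideanSpace.proj (𝕜 := ℝ) (0 : Fin (n + 2))).contDiff
  · exact (EuclideanSpace.proj (𝕜 := ℝ) (1 : Fin (n + 2))).contDiff

theorem contDiff_tailPart : ContDiff ℝ ∞ (tailPart : Euc (n + 2) → Euc n) :=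
  contDiff_euclidean.2 fun i => (EuclideanSpace.proj (𝕜 := ℝ) i.succ.succ).contDiff

theorem contDiff_rotatedHead : ContDiff ℝ ∞ (rotatedHead : Euc (n + 2) → Euc 2) := by
  refine contDiff_euclidean.2 fun i => ?_
  fin_cases i
  · exact (EuclideanSpace.proj (𝕜 := ℝ) (1 : Fin (n + 2))).contDiff
  · exact (EuclideanSpace.proj (𝕜 := ℝ) (0 : Fin (n + 2))).contDiff.neg

theorem rotatedHead_ne_zero {θ : Sph (n + 2)}
    (hθ : θ ∉ orthSphere (stdVec 0 : Euc (n + 2)) (stdVec 1)) :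
    rotatedHead (θ : Euc (n + 2)) ≠ 0 := by
  intro h
  refine hθ ((mem_orthSphere_iff θ).2 ⟨?_, ?_⟩)
  · simpa [rotatedHead] using congrArg (fun v : Euc 2 => v 1) h
  · simpa [rotatedHead] using congrArg (fun v : Euc 2 => v 0) h

theorem exists_isDirectionMap (n : ℕ) : ∃ α : Sph (n + 2) → Sph 2, IsDirectionMap α := by
  classical
  let e : Sph 2 := ⟨EuclideanSpace.single 0 1, by simp⟩
  refine ⟨fun θ => if h : rotatedHead (θ : Euc (n + 2)) = 0 then e else
    ⟨‖rotatedHead (θ : Euc (n + 2))‖⁻¹ • rotatedHead (θ : Euc (n + 2)), by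
      rw [mem_sphere_zero_iff_norm, norm_smul, norm_inv, norm_norm,
        inv_mul_cancel₀ (norm_ne_zero_iff.2 h)]⟩, fun θ hθ => ?_⟩
  have h := rotatedHead_ne_zero hθ
  have hpos : 0 < ‖rotatedHead (θ : Euc (n + 2))‖ := norm_pos_iff.2 h
  have hsq : 0 < (θ : Euc (n + 2)) 1 * (θ : Euc (n + 2)) 1 +
      (θ : Euc (n + 2)) 0 * (θ : Euc (n + 2)) 0 := by
    have := pow_pos hpos 2
    rw [EuclideanSpace.norm_sq_eq] at this
    simpa [rotatedHead, pow_two] using this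
  simp only [dif_neg h]
  refine ⟨?_, ?_⟩
  · rw [inner_planeVec]
    simp [rotatedHead]
    ring
  · rw [frameDet_eq, planeVec_apply_zero, planeVec_apply_one]
    have e : ∀ r a b : ℝ, r * a * a - -(r * b) * b = r * (a * a + b * b) := fun r a b => by ring
    simp only [rotatedHead, PiLp.smul_apply, Matrix.cons_val_zero, Matrix.cons_val_one,
      smul_eq_mul, mul_neg]
    rw [e]
    exact mul_pos (inv_pos.2 hpos) hsq

/-- Orthogonality fixes the line of `α(θ)` in the plane and the determinant fixes its orientation;
the factor `r` is the determinant itself. -/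
theorem IsDirectionMap.rotatedHead_eq {α : Sph (n + 2) → Sph 2} (hα : IsDirectionMap α)
    {θ : Sph (n + 2)} (hθ : θ ∉ orthSphere (stdVec 0 : Euc (n + 2)) (stdVec 1)) :
    ∃ r : ℝ, 0 < r ∧ rotatedHead (θ : Euc (n + 2)) = r • (α θ : Euc 2) := by
  obtain ⟨h1, h2⟩ := hα θ hθ
  rw [inner_planeVec] at h1
  rw [frameDet_eq, planeVec_apply_zero, planeVec_apply_one] at h2
  have h3 : (α θ : Euc 2) 0 ^ 2 + (α θ : Euc 2) 1 ^ 2 = 1 := by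
    have := EuclideanSpace.norm_sq_eq (α θ : Euc 2)
    rw [norm_eq_of_mem_sphere] at this
    simpa using this.symm
  refine ⟨_, h2, ?_⟩
  ext i
  fin_cases i
  · simp [rotatedHead]
    linear_combination (-(θ : Euc (n + 2)) 1) * h3 + (α θ : Euc 2) 1 * h1
  · simp [rotatedHead]
    linear_combination ((θ : Euc (n + 2)) 0) * h3 - (α θ : Euc 2) 0 * h1

/-- On the exceptional set `θ` is orthogonal to the whole plane, so an arbitrary `α(θ)` is still a
direction of the hyperplane, and the transform vanishes there too. -/
theorem IsDirectionMap.inner_eq_zero {α : Sph (n + 2) → Sph 2} (hα : IsDirectionMap α)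
    (θ : Sph (n + 2)) : ⟪(planeVec (α θ : Euc 2) : Euc (n + 2)), (θ : Euc (n + 2))⟫ = 0 := by
  by_cases hθ : θ ∈ orthSphere (stdVec 0 : Euc (n + 2)) (stdVec 1)
  · obtain ⟨h0, h1⟩ := (mem_orthSphere_iff θ).1 hθ
    rw [inner_planeVec, h0, h1, mul_zero, mul_zero, add_zero]
  · exact (hα θ hθ).1

theorem isClosed_orthSphere {d : ℕ} (v₁ v₂ : Euc d) : IsClosed (orthSphere v₁ v₂) :=
  (isClosed_eq (by fun_prop) continuous_const).inter (isClosed_eq (by fun_prop) continuous_const)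

/-- The surface measure is computed from the cone over the set, which lies in the null hyperplane
`x₁ = 0`. -/
theorem toSphere_orthSphere (n : ℕ) :
    (volume : Measure (Euc (n + 2))).toSphere (orthSphere (stdVec 0) (stdVec 1)) = 0 := by
  rw [Measure.toSphere_apply' _ (isClosed_orthSphere _ _).measurableSet]
  refine mul_eq_zero_of_right _ (measure_mono_null ?_ (Measure.addHaar_submodule volume
    (LinearMap.ker (EuclideanSpace.proj (𝕜 := ℝ) (0 : Fin (n + 2)) :
      Euc (n + 2) →L[ℝ] ℝ).toLinearMap) fun h => ?_))
  · rintro _ ⟨r, -, _, ⟨θ, hθ, rfl⟩, rfl⟩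
    simp [((mem_orthSphere_iff θ).1 hθ).1]
  · have : (stdVec 0 : Euc (n + 2)) ∈ LinearMap.ker (EuclideanSpace.proj (𝕜 := ℝ)
        (0 : Fin (n + 2)) : Euc (n + 2) →L[ℝ] ℝ).toLinearMap := by rw [h]; trivial
    simp [stdVec] at this

/-- If all the integrals of a function over the lines with a given direction vanish, then so does
its integral. -/
theorem integral_eq_zero_of_integral_line_eq_zero {H : Type*} [NormedAddCommGroup H]
    [InnerProductSpace ℝ H] [FiniteDimensional ℝ H] [MeasurableSpace H] [BorelSpace H]
    {g : H → ℝ} (hg : Continuous g) {R : ℝ} (hR : ∀ y, R < ‖y‖ → g y = 0) {a : H} (ha : ‖a‖ = 1)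
    (h0 : ∀ y, ∫ t : ℝ, g (y + t • a) = 0) : ∫ y, g y = 0 := by
  let b : ContDiffBump (0 : ℝ) := default
  set κ : ℝ → ℝ := b.normed volume
  have hκ : Continuous κ := b.continuous_normed
  have hκ1 : ∫ t, κ t = 1 := b.integral_normed
  obtain ⟨R', hR'⟩ := b.hasCompactSupport_normed (μ := volume).isCompact.isBounded.subset_closedBall 0
  have hκ0 : ∀ t, R' < |t| → κ t = 0 := fun t ht => by
    refine image_eq_zero_of_notMem_tsupport fun h => ?_
    have := hR' h
    rw [mem_closedBall_zero_iff, Real.norm_eq_abs] at this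
    linarith
  have hin : ∀ y : H, |⟪a, y⟫| ≤ ‖y‖ := fun y => by
    simpa [ha] using abs_real_inner_le_norm a y
  have hia : ∀ (y : H) (t : ℝ), ⟪a, y + t • a⟫ = ⟪a, y⟫ + t := fun y t => by
    rw [inner_add_right, inner_smul_right, real_inner_self_eq_norm_sq, ha]; ring
  have hs1 : HasCompactSupport (Function.uncurry fun (y : H) (t : ℝ) => g y * κ (t - ⟪a, y⟫)) := by
    refine HasCompactSupport.intro ((isCompact_closedBall (0 : H) R).prod
      (isCompact_closedBall (0 : ℝ) (R' + R))) fun x hx => ?_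
    simp only [Function.uncurry]
    by_contra hne
    have h1 : ‖x.1‖ ≤ R := by
      by_contra! h; exact hne (by rw [hR _ h, zero_mul])
    have h2 : |x.2 - ⟪a, x.1⟫| ≤ R' := by
      by_contra! h; exact hne (by rw [hκ0 _ h, mul_zero])
    refine hx ⟨by simpa using h1, ?_⟩
    rw [mem_closedBall_zero_iff, Real.norm_eq_abs]
    have h3 := hin x.1
    rw [abs_le] at h2 h3 ⊢
    constructor <;> linarith
  have hs2 : HasCompactSupport (Function.uncurry fun (t : ℝ) (y : H) =>
      g (y + t • a) * κ (-⟪a, y⟫)) := by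
    refine HasCompactSupport.intro ((isCompact_closedBall (0 : ℝ) (R' + R)).prod
      (isCompact_closedBall (0 : H) (R + (R' + R)))) fun x hx => ?_
    simp only [Function.uncurry]
    by_contra hne
    have h1 : ‖x.2 + x.1 • a‖ ≤ R := by
      by_contra! h; exact hne (by rw [hR _ h, zero_mul])
    have h2 : |-⟪a, x.2⟫| ≤ R' := by
      by_contra! h; exact hne (by rw [hκ0 _ h, mul_zero])
    have h4 : |x.1| ≤ R' + R := by
      have h3 := hin (x.2 + x.1 • a)
      rw [hia] at h3
      rw [abs_le] at h2 h3 ⊢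
      constructor <;> linarith
    refine hx ⟨by simpa using h4, ?_⟩
    rw [mem_closedBall_zero_iff]
    have h5 := norm_sub_le (x.2 + x.1 • a) (x.1 • a)
    rw [add_sub_cancel_right, norm_smul, ha, mul_one, Real.norm_eq_abs] at h5
    linarith
  -- Fubini without splitting the space: insert `1 = ∫ κ (t - ⟪a, y⟫) dt`, swap, translate `y` by `t
  -- a`, and swap back. The kernel is then free of `t`, and the inner integral is one over a line.
  calc ∫ y, g y = ∫ y, ∫ t : ℝ, g y * κ (t - ⟪a, y⟫) := by
        refine integral_congr_ae (.of_forall fun y => ?_)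
        simp only
        rw [integral_const_mul, integral_sub_right_eq_self κ, hκ1, mul_one]
    _ = ∫ t : ℝ, ∫ y, g y * κ (t - ⟪a, y⟫) :=
        integral_integral_swap_of_hasCompactSupport (by fun_prop) hs1
    _ = ∫ t : ℝ, ∫ y, g (y + t • a) * κ (-⟪a, y⟫) := by
        refine integral_congr_ae (.of_forall fun t => ?_)
        simp only
        rw [← integral_add_right_eq_self (fun y => g y * κ (t - ⟪a, y⟫)) (t • a)]
        refine integral_congr_ae (.of_forall fun y => ?_)
        simp only
        rw [hia, sub_add_cancel_right]
    _ = ∫ y, ∫ t : ℝ, g (y + t • a) * κ (-⟪a, y⟫) :=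
        integral_integral_swap_of_hasCompactSupport (by fun_prop) hs2
    _ = 0 := by
        simp_rw [integral_mul_const, h0, zero_mul, integral_zero]

theorem headPart_add_smul_planeVec (x : Euc (n + 2)) (a : Euc 2) (t : ℝ) :
    headPart (x + t • planeVec a) = headPart x + t • a := by
  ext i
  fin_cases i
  · simp [headPart, planeVec_apply_zero]
  · simp [headPart, planeVec_apply_one]

theorem tailPart_add_smul_planeVec (x : Euc (n + 2)) (a : Euc 2) (t : ℝ) :
    tailPart (x + t • planeVec a) = tailPart x := by
  ext i
  simp [tailPart, planeVec_apply_succ_succ]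

theorem IsBomanPair.eq_zero_of_lt {w₀ : Euc 2 → Sph 2 → ℝ} {f₀ : Euc 2 → ℝ}
    (h : IsBomanPair w₀ f₀) {x : Euc 2} (hx : 1 < ‖x‖) : f₀ x = 0 :=
  image_eq_zero_of_notMem_tsupport fun hm => by
    have := h.support_subset hm
    rw [mem_closedBall_zero_iff] at this
    linarith

theorem IsCutoff.eq_zero_of_lt {ψ : Euc n → ℝ} (h : IsCutoff ψ) {x : Euc n} (hx : 1 < ‖x‖) :
    ψ x = 0 :=
  image_eq_zero_of_notMem_tsupport fun hm => by
    rw [h.support_eq, mem_closedBall_zero_iff] at hm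
    linarith

theorem liftedFun_eq_zero_of_lt {w₀ : Euc 2 → Sph 2 → ℝ} {f₀ : Euc 2 → ℝ}
    (h : IsBomanPair w₀ f₀) {ψ : Euc n → ℝ} (hψ : IsCutoff ψ) {x : Euc (n + 2)} (hx : 2 < ‖x‖) :
    liftedFun ψ f₀ x = 0 := by
  have := norm_sq_head_tail x
  rcases lt_or_ge 1 ‖headPart x‖ with h1 | h1
  · rw [liftedFun, h.eq_zero_of_lt h1, mul_zero]
  · rw [liftedFun, hψ.eq_zero_of_lt, zero_mul]
    by_contra! h2
    nlinarith [norm_nonneg (headPart x), norm_nonneg (tailPart x)]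

/-- Moving along `α(θ)` changes only the first two coordinates. So `ψ` factors out of each line
integral, leaving the planar ray transform at an arbitrary base point; hence the hypothesis `hray`
without an orthogonality condition. -/
theorem radon_lifted {w₀ : Euc 2 → Sph 2 → ℝ} {f₀ : Euc 2 → ℝ} (h : IsBomanPair w₀ f₀)
    (hray : ∀ (x : Euc 2) (θ : Sph 2), weightedRay w₀ f₀ x θ = 0)
    {ψ : Euc n → ℝ} (hψ : IsCutoff ψ) {α : Sph (n + 2) → Sph 2} (hα : IsDirectionMap α)
    (s : ℝ) (θ : Sph (n + 2)) :
    Integrable (radonIntegrand (liftedWeight w₀ α) (liftedFun ψ f₀) s θ) ∧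
      weightedRadon (liftedWeight w₀ α) (liftedFun ψ f₀) s θ = 0 := by
  have hw : Continuous fun x => w₀ x (α θ) :=
    h.smooth_weight.continuous.comp (Continuous.prodMk_left (α θ))
  have hpt : Continuous fun y : (ℝ ∙ (θ : Euc (n + 2)))ᗮ =>
      s • (θ : Euc (n + 2)) + (y : Euc (n + 2)) := by fun_prop
  have hc : Continuous (radonIntegrand (liftedWeight w₀ α) (liftedFun ψ f₀) s θ) := by
    have h1 := (contDiff_headPart (n := n)).continuous.comp hpt
    have h2 := (contDiff_tailPart (n := n)).continuous.comp hpt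
    exact (hw.comp h1).mul ((hψ.smooth.continuous.comp h2).mul (h.smooth_fun.continuous.comp h1))
  have hz : ∀ y : (ℝ ∙ (θ : Euc (n + 2)))ᗮ, 2 + |s| < ‖y‖ →
      radonIntegrand (liftedWeight w₀ α) (liftedFun ψ f₀) s θ y = 0 := by
    intro y hy
    rw [radonIntegrand, liftedFun_eq_zero_of_lt h hψ, mul_zero]
    have := norm_sub_le (s • (θ : Euc (n + 2)) + (y : Euc (n + 2))) (s • (θ : Euc (n + 2)))
    rw [add_sub_cancel_left, norm_smul, norm_eq_of_mem_sphere, mul_one, Real.norm_eq_abs] at this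
    have hy' : 2 + |s| < ‖(y : Euc (n + 2))‖ := hy
    linarith
  refine ⟨hc.integrable_of_hasCompactSupport (HasCompactSupport.intro
    (isCompact_closedBall 0 (2 + |s|)) fun y hy => hz y (by simpa using hy)), ?_⟩
  have hmem : (planeVec (α θ : Euc 2) : Euc (n + 2)) ∈ (ℝ ∙ (θ : Euc (n + 2)))ᗮ := by
    rw [Submodule.mem_orthogonal_singleton_iff_inner_left]
    exact hα.inner_eq_zero θ
  refine integral_eq_zero_of_integral_line_eq_zero hc hz
    (a := ⟨planeVec (α θ : Euc 2), hmem⟩) ?_ fun y => ?_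
  · rw [Submodule.coe_norm, norm_planeVec, norm_eq_of_mem_sphere]
  · simp only [radonIntegrand, liftedWeight, liftedFun, Submodule.coe_add, Submodule.coe_smul,
      ← add_assoc, headPart_add_smul_planeVec, tailPart_add_smul_planeVec]
    simp_rw [mul_left_comm _ (ψ _)]
    rw [integral_const_mul]
    have := hray (headPart (s • (θ : Euc (n + 2)) + (y : Euc (n + 2)))) (α θ)
    rw [weightedRay] at this
    rw [this, mul_zero]

/-- By homogeneity of degree zero, `α(θ)` may be replaced by its positive multiple `(θ₂, -θ₁)`,
which is linear in `θ` and nonzero off the exceptional set. -/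
theorem contMDiffOn_liftedWeight {V : Euc 2 × Euc 2 → ℝ}
    (hV : ∀ x : Euc 2 × Euc 2, x.2 ≠ 0 → ContDiffAt ℝ ∞ V x)
    (hV' : ∀ (x θ : Euc 2) (r : ℝ), 0 < r → V (x, r • θ) = V (x, θ))
    {α : Sph (n + 2) → Sph 2} (hα : IsDirectionMap α) :
    ContMDiffOn (𝓘(ℝ, Euc (n + 2)).prod (𝓡 (n + 1))) 𝓘(ℝ, ℝ) ∞
      (Function.uncurry (liftedWeight (fun x θ => V (x, θ)) α))
      (Set.univ ×ˢ (orthSphere (stdVec 0) (stdVec 1))ᶜ) := by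
  have h1 : ContMDiff (𝓘(ℝ, Euc (n + 2)).prod (𝓡 (n + 1))) 𝓘(ℝ, Euc (n + 2) × Euc (n + 2)) ∞
      (fun y : Euc (n + 2) × Sph (n + 2) => (y.1, (y.2 : Euc (n + 2)))) :=
    ContMDiff.prodMk_space contMDiff_fst
      (contMDiff_coe_sph.comp contMDiff_snd)
  have h2 : ContDiff ℝ ∞ fun y : Euc (n + 2) × Euc (n + 2) => (headPart y.1, rotatedHead y.2) :=
    (contDiff_headPart.comp contDiff_fst).prodMk (contDiff_rotatedHead.comp contDiff_snd)
  have h3 : ContMDiffOn (𝓘(ℝ, Euc (n + 2)).prod (𝓡 (n + 1))) 𝓘(ℝ, ℝ) ∞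
      (fun y : Euc (n + 2) × Sph (n + 2) => V (headPart y.1, rotatedHead (y.2 : Euc (n + 2))))
      (Set.univ ×ˢ (orthSphere (stdVec 0) (stdVec 1))ᶜ) := by
    intro y hy
    have h4 : ContDiffAt ℝ ∞ (fun y : Euc (n + 2) × Euc (n + 2) =>
        V (headPart y.1, rotatedHead y.2)) (y.1, (y.2 : Euc (n + 2))) :=
      ContDiffAt.comp (g := V) _ (hV _ (rotatedHead_ne_zero hy.2)) h2.contDiffAt
    exact (ContMDiffAt.comp y h4.contMDiffAt (h1 y)).contMDiffWithinAt
  refine h3.congr fun y hy => ?_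
  obtain ⟨r, hr, he⟩ := hα.rotatedHead_eq hy.2
  rw [he, hV' _ _ r hr]
  rfl

/-- The weight may fail to be measurable over the exceptional directions, where `α` is arbitrary;
these form a null set, so continuity elsewhere suffices. -/
theorem isAdmissibleWeight_of_continuousOn {W : Euc (n + 2) → Sph (n + 2) → ℝ}
    (hb : ∀ x θ, 1 / 2 ≤ W x θ ∧ W x θ ≤ 1)
    (hc : ContinuousOn (Function.uncurry W)
      (Set.univ ×ˢ (orthSphere (stdVec 0) (stdVec 1))ᶜ)) : IsAdmissibleWeight W := by
  refine ⟨⟨1 / 2, by norm_num, fun x θ => (hb x θ).1⟩, memLp_top_of_bound ?_ 1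
    (.of_forall fun x => ?_)⟩
  · have hm : MeasurableSet ((Set.univ : Set (Euc (n + 2))) ×ˢ
        (orthSphere (stdVec 0 : Euc (n + 2)) (stdVec 1))ᶜ) :=
      MeasurableSet.univ.prod (isClosed_orthSphere _ _).measurableSet.compl
    rw [← Measure.restrict_eq_self_of_ae_mem (s := (Set.univ : Set (Euc (n + 2))) ×ˢ
        (orthSphere (stdVec 0 : Euc (n + 2)) (stdVec 1))ᶜ)
      (μ := (volume : Measure (Euc (n + 2))).prod (volume : Measure (Euc (n + 2))).toSphere)]
    · exact hc.aestronglyMeasurable hm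
    · rw [ae_iff]
      have : {a : Euc (n + 2) × Sph (n + 2) | ¬ a ∈ (Set.univ : Set (Euc (n + 2))) ×ˢ
          (orthSphere (stdVec 0 : Euc (n + 2)) (stdVec 1))ᶜ} =
          Set.univ ×ˢ orthSphere (stdVec 0 : Euc (n + 2)) (stdVec 1) := by
        ext a; simp
      rw [this, Measure.prod_prod, toSphere_orthSphere, mul_zero]
  · have := hb x.1 x.2
    rw [Real.norm_eq_abs, Function.uncurry, abs_le]
    constructor <;> linarith

theorem liftedFun_ne_zero {f₀ : Euc 2 → ℝ} (hf : f₀ ≠ 0) {ψ : Euc n → ℝ} (hψ : IsCutoff ψ) :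
    liftedFun ψ f₀ ≠ 0 := by
  obtain ⟨x, hx⟩ := Function.ne_iff.1 hf
  intro h
  have h1 : headPart (planeVec x : Euc (n + 2)) = x := by
    ext i
    fin_cases i
    · simp [headPart, planeVec_apply_zero]
    · simp [headPart, planeVec_apply_one]
  have h2 : tailPart (planeVec x : Euc (n + 2)) = 0 := by
    ext i
    simp [tailPart, planeVec_apply_succ_succ]
  have h3 := congrFun h (planeVec x : Euc (n + 2))
  rw [liftedFun, h1, h2] at h3
  exact mul_ne_zero (hψ.pos 0 (by simp)).ne' hx h3

end Lift

/-- The dimension is `d = n + 2`, so that `1 ≤ n` means `3 ≤ d`. -/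
theorem theorem1 :
    ∃ (w₀ : Euc 2 → Sph 2 → ℝ) (f₀ : Euc 2 → ℝ), IsBomanPair w₀ f₀ ∧
      ∀ n : ℕ, 1 ≤ n →
        (∃ ψ : Euc n → ℝ, IsCutoff ψ) ∧
        (∃ α : Sph (n + 2) → Sph 2, IsDirectionMap α) ∧
        (volume : Measure (Euc (n + 2))).toSphere (orthSphere (stdVec 0) (stdVec 1)) = 0 ∧
        ∀ (ψ : Euc n → ℝ) (α : Sph (n + 2) → Sph 2), IsCutoff ψ → IsDirectionMap α →
          ∃ (W : Euc (n + 2) → Sph (n + 2) → ℝ) (f : Euc (n + 2) → ℝ),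
            W = liftedWeight w₀ α ∧ f = liftedFun ψ f₀ ∧
            (∀ (s : ℝ) (θ : Sph (n + 2)),
              Integrable (radonIntegrand W f s θ) ∧ weightedRadon W f s θ = 0) ∧
            IsAdmissibleWeight W ∧
            ContDiff ℝ ∞ f ∧ HasCompactSupport f ∧ f ≠ 0 ∧
            (∀ x θ, 1 / 2 ≤ W x θ ∧ W x θ ≤ 1) ∧
            ContMDiffOn (𝓘(ℝ, Euc (n + 2)).prod (𝓡 (n + 1))) 𝓘(ℝ, ℝ) ∞ (Function.uncurry W)
              (Set.univ ×ˢ (orthSphere (stdVec 0) (stdVec 1))ᶜ) := by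
  obtain ⟨V, f₀, hV, hV', hpair, hray⟩ := exists_isBomanPair
  refine ⟨fun x θ => V (x, θ), f₀, hpair, fun n _ =>
    ⟨⟨_, isCutoff_expNegInvGlue n⟩, exists_isDirectionMap n, toSphere_orthSphere n,
      fun ψ α hψ hα => ?_⟩⟩
  have hb : ∀ (x : Euc (n + 2)) (θ : Sph (n + 2)),
      1 / 2 ≤ liftedWeight (fun x θ => V (x, θ)) α x θ ∧
        liftedWeight (fun x θ => V (x, θ)) α x θ ≤ 1 := fun x θ => hpair.bounds _ _
  have hs := contMDiffOn_liftedWeight hV hV' hα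
  exact ⟨_, _, rfl, rfl, radon_lifted hpair hray hψ hα,
    isAdmissibleWeight_of_continuousOn hb hs.continuousOn,
    (hψ.smooth.comp contDiff_tailPart).mul (hpair.smooth_fun.comp contDiff_headPart),
    HasCompactSupport.intro (isCompact_closedBall 0 2) fun x hx =>
      liftedFun_eq_zero_of_lt hpair hψ (by simpa using hx),
    liftedFun_ne_zero hpair.ne_zero hψ, hb, hs⟩
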